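/- **Setting.** A *roadmap* on $n$ viewpoints is a connected undirected simple graph $G=(V,E)$, $|V|=n$, with real edge lengths $\ell(e)>0$ such that $\ell(uw)\le \ell(uv)+\ell(vw)$ whenever $u,v,w$ are pairwise adjacent; we regard $G$ also as a metric graph, each edge $e$ being a segment of length $\ell(e)$. Let $0<m<n$ be the number of robots and let $T>0$ be a time horizon. A *team trajectory* $X=(x_1,\dots,x_m)$ consists of continuous maps $x_i:[0,T]\to G$ that are differentiable with speed at most $1$ except at finitely many times. Its *refresh time* is $$\mathrm{RT}(X)=\max_{v\in V}\ \max\{\,t_2-t_1 : 0\le t_1\le t_2\le T,\ x_i(t)\ne v \text{ for all } i \text{ and all } t_1<t<t_2\,\}.$$ A *path* is a nonempty sequence of vertices, possibly with repetitions, in which consecutive vertices are adjacent; its cost is the sum of the lengths of its edges. A *path cover* of cardinality $m$ is a family of $m$ paths that together contain every vertex; its cost is the largest cost of one of its paths. **Lemma ($8$-approximation of the refresh time).** There is a polynomial-time algorithm which, given a roadmap $G$ on $n$ viewpoints and a number $0<m<n$ of robots, computes a path cover $p_1,\dots,p_m$ of $G$ with the following properties. 1. The cost of $p_1,\dots,p_m$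 is at most $4$ times the cost of every path cover of $G$ of cardinality $m$. 2. For every horizon $T>0$, let $X$ be given by letting robot $i$ sweep $p_i$ back and forth at unit speed, starting at its first vertex (and rest if $p_i$ has a single vertex). Then $X$ is a team trajectory, and $\mathrm{RT}(X)\le 8\,\mathrm{RT}(Y)$ for every team trajectory $Y$ of $m$ robots with horizon $T$. That is, the refresh time of $X$ is at most $8$ times the minimum. Here polynomial time means the following: the algorithm is one fixed program, independent of $G$ and $m$, for a random access machine with natural-number and real memory cells, whose operations (addition, subtraction, comparison, indexed reading and writing) have unit cost and which has no real constant but $0$; it halts after at most $q(n)$ operations, for a fixed polynomial $q$. -/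

import Mathlib

namespace Patrol

/-! ### Roadmaps and paths -/

/-- A roadmap on `n` viewpoints: a connected undirected graph with a positive length on each edge;
the lengths satisfy the triangle inequality. (`len u v` is meaningful only on edges.) -/
structure Roadmap (n : ℕ) where
  graph : SimpleGraph (Fin n)
  connected : graph.Connected
  len : Fin n → Fin n → ℝ
  len_symm : ∀ u v, graph.Adj u v → len u v = len v u
  len_pos : ∀ u v, graph.Adj u v → 0 < len u v
  triangle : ∀ u v w, graph.Adj u v → graph.Adj v w → graph.Adj u w →
    len u w ≤ len u v + len v w

variable {n m : ℕ}

/-- A vertex path: a nonempty sequence of vertices, consecutive ones being adjacent. -/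
def IsPath (R : Roadmap n) (p : List (Fin n)) : Prop :=
  p ≠ [] ∧ p.IsChain R.graph.Adj

/-- The cost of a path: the sum of the lengths of its edges. -/
def pathCost (R : Roadmap n) : List (Fin n) → ℝ
  | [] => 0
  | [_] => 0
  | u :: v :: r => R.len u v + pathCost R (v :: r)

/-- A path cover of cardinality `m`: every vertex lies on one of the `m` paths. -/
def IsPathCover (R : Roadmap n) (p : Fin m → List (Fin n)) : Prop :=
  (∀ i, IsPath R (p i)) ∧ ∀ v, ∃ i, v ∈ p i

/-- The cost of a path cover: the largest cost of one of its paths. -/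
noncomputable def coverCost (R : Roadmap n) (p : Fin m → List (Fin n)) : ℝ :=
  ⨆ i, pathCost R (p i)

/-! ### Motion on a roadmap

A position is a point of the geometric realization of the graph, in barycentric coordinates:
the point that divides the edge `uv` in the ratio `θ : 1 - θ` has the coordinates `1 - θ` at `u`
and `θ` at `v`; its distance from `u` along the edge is `θ * len u v`. -/

/-- The position of the viewpoint `v`. -/
def vertexPoint (v : Fin n) : Fin n → ℝ := Pi.single v 1

/-- The position at the fraction `θ` of the way from `u` to `v`. -/
def edgePoint (u v : Fin n) (θ : ℝ) : Fin n → ℝ :=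
  (1 - θ) • vertexPoint u + θ • vertexPoint v

/-- The set of all positions on the roadmap. -/
def Roadmap.carrier (R : Roadmap n) : Set (Fin n → ℝ) :=
  {x | ∃ u v, (u = v ∨ R.graph.Adj u v) ∧ ∃ θ ∈ Set.Icc (0 : ℝ) 1, x = edgePoint u v θ}

/-- A trajectory of one robot on `[0, T]`: it stays on the roadmap, it is continuous, and outside a
finite set of times it is differentiable with speed at most one. While the robot is on the edge `uv`
its speed is `len u v` times the absolute value of the derivative of its coordinate at `v`. -/
def IsTrajectory (R : Roadmap n) (T : ℝ) (x : ℝ → Fin n → ℝ) : Prop :=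
  (∀ t ∈ Set.Icc 0 T, x t ∈ R.carrier) ∧
  ContinuousOn x (Set.Icc 0 T) ∧
  ∃ B : Finset ℝ, ∀ t ∈ Set.Ioo 0 T, t ∉ B →
    DifferentiableAt ℝ x t ∧
    ∀ u v, R.graph.Adj u v → x t u + x t v = 1 →
      R.len u v * |deriv (fun s => x s v) t| ≤ 1

/-- A team trajectory of `m` robots with time horizon `T`. -/
def IsTeamTrajectory (R : Roadmap n) (T : ℝ) (X : Fin m → ℝ → Fin n → ℝ) : Prop :=
  ∀ i, IsTrajectory R T (X i)

/-- The refresh time of a team trajectory with horizon `T`: the largest length of a time interval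
in `[0, T]` in whose interior some viewpoint is not visited by any robot. -/
noncomputable def refreshTime (T : ℝ) (X : Fin m → ℝ → Fin n → ℝ) : ℝ :=
  sSup {d | ∃ (v : Fin n) (t₁ t₂ : ℝ), 0 ≤ t₁ ∧ t₁ ≤ t₂ ∧ t₂ ≤ T ∧
    (∀ (i : Fin m) (t : ℝ), t₁ < t → t < t₂ → X i t ≠ vertexPoint v) ∧ d = t₂ - t₁}

/-- The position on the path `p` at distance `s` from its start, for `0 ≤ s ≤ pathCost R p`. -/
noncomputable def pathPoint (R : Roadmap n) : List (Fin n) → ℝ → Fin n → ℝ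
  | [], _ => 0
  | [v], _ => vertexPoint v
  | u :: v :: r, s =>
    if s ≤ R.len u v then edgePoint u v (s / R.len u v)
    else pathPoint R (v :: r) (s - R.len u v)

/-- The triangle wave of slope `±1` that runs from `0` to `L` and back with period `2 * L`: the
distance from `t` to the nearest integer multiple of `2 * L`. -/
noncomputable def triangleWave (L t : ℝ) : ℝ := |t - 2 * L * round (t / (2 * L))|

/-- Robot `i` sweeps the path `p i` back and forth at unit speed, starting at its first vertex.
(On a path with a single vertex the robot rests there.) -/
noncomputable def sweep (R : Roadmap n) (p : Fin m → List (Fin n)) :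
    Fin m → ℝ → Fin n → ℝ :=
  fun i t => pathPoint R (p i) (triangleWave (pathCost R (p i)) t)

/-! ### The machine model

While programs over two kinds of two-dimensional arrays, one holding natural numbers and one
holding real numbers. Arithmetic consists of addition and subtraction only, the only real constant
is `0`, and reals influence the control flow only through comparisons. Every operation, array
access, comparison and assignment costs one unit. -/

/-- Expressions of natural number type. `get a i j` reads the cell `(i, j)` of the array `a`;
subtraction is truncated. -/
inductive IExp
  | lit (c : ℕ)
  | get (a : ℕ) (i j : IExp)
  | add (e f : IExp)
  | sub (e f : IExp)

/-- Expressions of real type. -/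
inductive DExp
  | zero
  | get (a : ℕ) (i j : IExp)
  | add (e f : DExp)
  | sub (e f : DExp)

/-- Tests: strict comparisons and their Boolean combinations. -/
inductive Test
  | ilt (e f : IExp)
  | dlt (e f : DExp)
  | neg (b : Test)
  | conj (b c : Test)

/-- Programs. `seti a i j e` and `setd a i j e` assign to the cell `(i, j)` of the array `a`. -/
inductive Prog
  | skip
  | seti (a : ℕ) (i j e : IExp)
  | setd (a : ℕ) (i j : IExp) (e : DExp)
  | seq (P Q : Prog)
  | ite (b : Test) (P Q : Prog)
  | loop (b : Test) (P : Prog)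

/-- The contents of the memory: `idx a i j` and `dat a i j` are the cells `(i, j)` of the arrays
numbered `a`. -/
structure Store where
  idx : ℕ → ℕ → ℕ → ℕ
  dat : ℕ → ℕ → ℕ → ℝ

/-- Overwrite one cell. -/
def setCell {α : Type} (f : ℕ → ℕ → ℕ → α) (a i j : ℕ) (x : α) : ℕ → ℕ → ℕ → α :=
  fun a' i' j' => if a' = a ∧ i' = i ∧ j' = j then x else f a' i' j'

def IExp.eval (s : Store) : IExp → ℕ
  | lit c => c
  | get a i j => s.idx a (i.eval s) (j.eval s)
  | add e f => e.eval s + f.eval s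
  | sub e f => e.eval s - f.eval s

noncomputable def DExp.eval (s : Store) : DExp → ℝ
  | zero => 0
  | get a i j => s.dat a (i.eval s) (j.eval s)
  | add e f => e.eval s + f.eval s
  | sub e f => e.eval s - f.eval s

def Test.holds (s : Store) : Test → Prop
  | ilt e f => e.eval s < f.eval s
  | dlt e f => e.eval s < f.eval s
  | neg b => ¬ b.holds s
  | conj b c => b.holds s ∧ c.holds s

/-- The cost of evaluating an expression; the constant `c` is charged `c + 1`. -/
def IExp.cost : IExp → ℕ
  | lit c => c + 1
  | get _ i j => i.cost + j.cost + 1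
  | add e f => e.cost + f.cost + 1
  | sub e f => e.cost + f.cost + 1

def DExp.cost : DExp → ℕ
  | zero => 1
  | get _ i j => i.cost + j.cost + 1
  | add e f => e.cost + f.cost + 1
  | sub e f => e.cost + f.cost + 1

def Test.cost : Test → ℕ
  | ilt e f => e.cost + f.cost + 1
  | dlt e f => e.cost + f.cost + 1
  | neg b => b.cost + 1
  | conj b c => b.cost + c.cost + 1

/-- `Exec P s s' c`: the program `P`, started with memory `s`, halts with memory `s'` after exactly
`c` units of time. -/
inductive Exec : Prog → Store → Store → ℕ → Prop
  | skip (s : Store) : Exec .skip s s 1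
  | seti (a : ℕ) (i j e : IExp) (s : Store) :
      Exec (.seti a i j e) s ⟨setCell s.idx a (i.eval s) (j.eval s) (e.eval s), s.dat⟩
        (i.cost + j.cost + e.cost + 1)
  | setd (a : ℕ) (i j : IExp) (e : DExp) (s : Store) :
      Exec (.setd a i j e) s ⟨s.idx, setCell s.dat a (i.eval s) (j.eval s) (e.eval s)⟩
        (i.cost + j.cost + e.cost + 1)
  | seq {P Q : Prog} {s s' s'' : Store} {c d : ℕ} :
      Exec P s s' c → Exec Q s' s'' d → Exec (.seq P Q) s s'' (c + d)
  | ite_true {b : Test} {P Q : Prog} {s s' : Store} {c : ℕ} :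
      b.holds s → Exec P s s' c → Exec (.ite b P Q) s s' (b.cost + c)
  | ite_false {b : Test} {P Q : Prog} {s s' : Store} {c : ℕ} :
      ¬ b.holds s → Exec Q s s' c → Exec (.ite b P Q) s s' (b.cost + c)
  | loop_done {b : Test} {P : Prog} {s : Store} :
      ¬ b.holds s → Exec (.loop b P) s s b.cost
  | loop_step {b : Test} {P : Prog} {s s' s'' : Store} {c d : ℕ} :
      b.holds s → Exec P s s' c → Exec (.loop b P) s' s'' d →
      Exec (.loop b P) s s'' (b.cost + c + d)

/-- Programs are deterministic. -/
theorem Exec.unique {P : Prog} {s s₁ s₂ : Store} {c₁ c₂ : ℕ}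
    (h₁ : Exec P s s₁ c₁) (h₂ : Exec P s s₂ c₂) : s₁ = s₂ ∧ c₁ = c₂ := by
  induction h₁ generalizing s₂ c₂ with
  | skip s => cases h₂; exact ⟨rfl, rfl⟩
  | seti a i j e s => cases h₂; exact ⟨rfl, rfl⟩
  | setd a i j e s => cases h₂; exact ⟨rfl, rfl⟩
  | seq _ _ ih₁ ih₂ =>
    cases h₂ with
    | seq k₁ k₂ =>
      obtain ⟨rfl, rfl⟩ := ih₁ k₁
      obtain ⟨rfl, rfl⟩ := ih₂ k₂
      exact ⟨rfl, rfl⟩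
  | ite_true hb _ ih =>
    cases h₂ with
    | ite_true _ k => obtain ⟨rfl, rfl⟩ := ih k; exact ⟨rfl, rfl⟩
    | ite_false hb' _ => exact absurd hb hb'
  | ite_false hb _ ih =>
    cases h₂ with
    | ite_true hb' _ => exact absurd hb' hb
    | ite_false _ k => obtain ⟨rfl, rfl⟩ := ih k; exact ⟨rfl, rfl⟩
  | loop_done hb =>
    cases h₂ with
    | loop_done _ => exact ⟨rfl, rfl⟩
    | loop_step hb' _ _ => exact absurd hb' hb
  | loop_step hb _ _ ih₁ ih₂ =>
    cases h₂ with
    | loop_done hb' => exact absurd hb hb'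
    | loop_step _ k₁ k₂ =>
      obtain ⟨rfl, rfl⟩ := ih₁ k₁
      obtain ⟨rfl, rfl⟩ := ih₂ k₂
      exact ⟨rfl, rfl⟩

theorem IExp.eval_le {s : Store} {M : ℕ} (hM : 1 ≤ M) (h : ∀ a i j, s.idx a i j ≤ M) :
    ∀ e : IExp, e.eval s ≤ 2 ^ e.cost * M
  | lit c => by
    have : c < 2 ^ (c + 1) := lt_trans (Nat.lt_succ_self c) Nat.lt_two_pow_self
    simp only [eval, cost]; nlinarith
  | get a i j => (h _ _ _).trans (Nat.le_mul_of_pos_left _ (by positivity))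
  | add e f => by
    have he := IExp.eval_le hM h e
    have hf := IExp.eval_le hM h f
    have h1 : 2 ^ e.cost * M ≤ 2 ^ (e.cost + f.cost) * M := by gcongr <;> omega
    have h2 : 2 ^ f.cost * M ≤ 2 ^ (e.cost + f.cost) * M := by gcongr <;> omega
    simp only [eval, cost]
    rw [pow_succ]
    linarith
  | sub e f => by
    have he := IExp.eval_le hM h e
    have h1 : 2 ^ e.cost * M ≤ 2 ^ (e.cost + f.cost + 1) * M := by gcongr <;> omega
    simp only [eval, cost]
    omega

theorem DExp.eval_bound {s : Store} {δ : ℝ} {B : ℕ}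
    (h : ∀ a i j, ∃ z : ℤ, s.dat a i j = z * δ ∧ |z| ≤ (B : ℤ)) :
    ∀ e : DExp, ∃ z : ℤ, e.eval s = z * δ ∧ |z| ≤ 2 ^ e.cost * (B : ℤ)
  | zero => ⟨0, by simp [eval], by simp⟩
  | get a i j => by
    obtain ⟨z, hz, hB⟩ := h a (i.eval s) (j.eval s)
    refine ⟨z, hz, hB.trans ?_⟩
    exact le_mul_of_one_le_left (by positivity) (one_le_pow₀ (by norm_num))
  | add e f => by
    obtain ⟨y, hy, hy'⟩ := DExp.eval_bound h e
    obtain ⟨z, hz, hz'⟩ := DExp.eval_bound h f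
    refine ⟨y + z, by simp only [eval, hy, hz]; push_cast; ring, (abs_add_le y z).trans ?_⟩
    have h1 : (2 : ℤ) ^ e.cost * B ≤ 2 ^ (e.cost + f.cost) * B := by gcongr <;> norm_num
    have h2 : (2 : ℤ) ^ f.cost * B ≤ 2 ^ (e.cost + f.cost) * B := by gcongr <;> norm_num
    simp only [cost]
    rw [pow_succ]
    linarith
  | sub e f => by
    obtain ⟨y, hy, hy'⟩ := DExp.eval_bound h e
    obtain ⟨z, hz, hz'⟩ := DExp.eval_bound h f
    refine ⟨y - z, by simp only [eval, hy, hz]; push_cast; ring, (abs_sub y z).trans ?_⟩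
    have h1 : (2 : ℤ) ^ e.cost * B ≤ 2 ^ (e.cost + f.cost) * B := by gcongr <;> norm_num
    have h2 : (2 : ℤ) ^ f.cost * B ≤ 2 ^ (e.cost + f.cost) * B := by gcongr <;> norm_num
    simp only [cost]
    rw [pow_succ]
    linarith

/-- Numbers grow by at most one bit per unit of time: the natural numbers in memory at most double,
and if the real inputs are integer multiples of `δ` (for instance rationals with common denominator
`1 / δ`), then so are all reals in memory, with integer factors that at most double. Hence a
polynomial bound on the running time in this model is one in the bit model as well. -/
theorem Exec.growth {P : Prog} {s s' : Store} {c : ℕ} (h : Exec P s s' c) {δ : ℝ} {M B : ℕ}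
    (hM : 1 ≤ M) (hi : ∀ a i j, s.idx a i j ≤ M)
    (hd : ∀ a i j, ∃ z : ℤ, s.dat a i j = z * δ ∧ |z| ≤ (B : ℤ)) :
    (∀ a i j, s'.idx a i j ≤ 2 ^ c * M) ∧
    ∀ a i j, ∃ z : ℤ, s'.dat a i j = z * δ ∧ |z| ≤ ((2 ^ c * B : ℕ) : ℤ) := by
  have mono : ∀ {x y k : ℕ}, x ≤ y → 2 ^ x * k ≤ 2 ^ y * k := fun h =>
    Nat.mul_le_mul_right _ (Nat.pow_le_pow_right (by norm_num) h)
  have one : ∀ (x k : ℕ), k ≤ 2 ^ x * k := fun x k => Nat.le_mul_of_pos_left _ (by positivity)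
  have one' : ∀ (x k : ℕ), (k : ℤ) ≤ ((2 ^ x * k : ℕ) : ℤ) := fun x k => by exact_mod_cast one x k
  induction h generalizing M B with
  | skip s => exact ⟨fun a i j => (hi a i j).trans (one _ _), fun a i j =>
      let ⟨z, hz, hB⟩ := hd a i j; ⟨z, hz, hB.trans (one' _ _)⟩⟩
  | seti a i j e s =>
    refine ⟨fun a' i' j' => ?_, fun a i j =>
      let ⟨z, hz, hB⟩ := hd a i j; ⟨z, hz, hB.trans (one' _ _)⟩⟩
    simp only [setCell]
    split_ifs
    · exact (e.eval_le hM hi).trans (mono (by omega))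
    · exact (hi _ _ _).trans (one _ _)
  | setd a i j e s =>
    refine ⟨fun a' i' j' => (hi _ _ _).trans (one _ _), fun a' i' j' => ?_⟩
    simp only [setCell]
    split_ifs
    · obtain ⟨z, hz, hB⟩ := e.eval_bound hd
      refine ⟨z, hz, hB.trans ?_⟩
      exact_mod_cast mono (show e.cost ≤ i.cost + j.cost + e.cost + 1 by omega)
    · obtain ⟨z, hz, hB⟩ := hd a' i' j'
      exact ⟨z, hz, hB.trans (one' _ _)⟩
  | @seq P Q s s₁ s₂ c d _ _ ih₁ ih₂ =>
    obtain ⟨h1, h2⟩ := ih₁ hM hi hd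
    obtain ⟨h3, h4⟩ := ih₂ (hM.trans (one c M)) h1 h2
    have e : ∀ k, 2 ^ d * (2 ^ c * k) = 2 ^ (c + d) * k := fun k => by rw [pow_add]; ring
    exact ⟨by simpa only [e] using h3, by simpa only [e] using h4⟩
  | @ite_true b _ _ _ _ c _ _ ih =>
    obtain ⟨h1, h2⟩ := ih hM hi hd
    have hc : c ≤ b.cost + c := by omega
    exact ⟨fun a i j => (h1 a i j).trans (mono hc), fun a i j =>
      let ⟨z, hz, hB⟩ := h2 a i j; ⟨z, hz, hB.trans (by exact_mod_cast mono hc)⟩⟩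
  | @ite_false b _ _ _ _ c _ _ ih =>
    obtain ⟨h1, h2⟩ := ih hM hi hd
    have hc : c ≤ b.cost + c := by omega
    exact ⟨fun a i j => (h1 a i j).trans (mono hc), fun a i j =>
      let ⟨z, hz, hB⟩ := h2 a i j; ⟨z, hz, hB.trans (by exact_mod_cast mono hc)⟩⟩
  | loop_done _ => exact ⟨fun a i j => (hi a i j).trans (one _ _), fun a i j =>
      let ⟨z, hz, hB⟩ := hd a i j; ⟨z, hz, hB.trans (one' _ _)⟩⟩
  | @loop_step b P s s₁ s₂ c d _ _ _ ih₁ ih₂ =>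
    obtain ⟨h1, h2⟩ := ih₁ hM hi hd
    obtain ⟨h3, h4⟩ := ih₂ (hM.trans (one c M)) h1 h2
    have e : ∀ k, 2 ^ d * (2 ^ c * k) ≤ 2 ^ (b.cost + c + d) * k := fun k => by
      have : 2 ^ d * (2 ^ c * k) = 2 ^ (c + d) * k := by rw [pow_add]; ring
      rw [this]; exact mono (by omega)
    exact ⟨fun a i j => (h3 a i j).trans (e M), fun a i j =>
      let ⟨z, hz, hB⟩ := h4 a i j; ⟨z, hz, hB.trans (by exact_mod_cast e B)⟩⟩

open Classical in
/-- The memory that presents a roadmap and a number `m` of robots to a program: the cell `(0, 0)` of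
the natural number array `0` holds `n`, that of array `1` holds `m`, array `2` is the adjacency
matrix, the real array `0` is the matrix of edge lengths, and everything else is `0`. -/
noncomputable def input (R : Roadmap n) (m : ℕ) : Store where
  idx a i j :=
    if a = 0 ∧ i = 0 ∧ j = 0 then n
    else if a = 1 ∧ i = 0 ∧ j = 0 then m
    else if h : i < n ∧ j < n then
      if a = 2 ∧ R.graph.Adj ⟨i, h.1⟩ ⟨j, h.2⟩ then 1 else 0
    else 0
  dat a i j :=
    if h : i < n ∧ j < n then
      if a = 0 ∧ R.graph.Adj ⟨i, h.1⟩ ⟨j, h.2⟩ then R.len ⟨i, h.1⟩ ⟨j, h.2⟩ else 0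
    else 0

/-- The memory `s` holds the vertex sequences `p`: the cell `(i, 0)` of array `3` is the number of
terms of `p i`, and row `i` of array `4` begins with these terms. -/
def Outputs (s : Store) (p : Fin m → List (Fin n)) : Prop :=
  ∀ i : Fin m, (p i).map Fin.val = (List.range (s.idx 3 i 0)).map (s.idx 4 i)

end Patrol

/-! The factor 8 is 2 · 4. Sweeping a path of cost `L` passes each of its vertices in every time
interval longer than `2 * L`, so the refresh time of a sweep is at most twice the cost of the cover
(`refreshTime_sweep_le`). Conversely, if a team has refresh time below some `τ ≤ T`, then every
vertex is visited during `[0, τ]`. Since speeds are at most one, the vertices visited by one robot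
lie on a path hardly longer than `τ` (`exists_path_through_visits`). So the refresh time of a team
is at least the infimum of the costs of path covers, or else it is the whole horizon, which no team
exceeds (`refreshTime_sweep_le_mul`). What remains is to compute a 4-approximate min-max path cover.

Fix a cover by `m` paths of cost `c`, and run Kruskal's greedy construction until every edge between
different components is longer than `c`. The edges of the paths have length at most `c`, so each
path stays in one component. In a component that contains `k` of the paths, these cost at most `k c`
together, and `k - 1` further edges of length at most `c` join them. As the greedy choice is always
shortest, an exchange argument shows that the tree weighs at most `(2k - 1) c`
(`Kruskal.exists_potential`, `Kruskal.weightIn_le`). Going around the doubled tree is a closed tour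
of cost at most `(4k - 2) c < k · 4c`. Cut this tour greedily into segments of cost at most `4c`.
Each segment but the last costs more than `4c` together with the step that ended it, and these
stretches are disjoint, so there are at most `k` segments. Over all components this makes at most
`m`.

The program knows neither `c` nor the right moment to stop. It therefore treats the forest at every
stage of the construction. At each stage it tries as bound every cost of a contiguous part of a
tour: greedy cutting compares its bound with such costs only, so the largest of them below `4c`
works as well as `4c` (`Tight`, `Feasible`, `exists_feasible`). It keeps the cover with the smallest
successful bound, which is then good against all covers at once. The running time is read off the
program text: every loop makes at most `3 * n` iterations, because the tours never have more than `3
* n` nodes, and substituting this number for the variable of `Prog.costPoly` bounds the cost. -/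

namespace Patrol

variable {n m : ℕ}

/-! ### Walks -/

/-- `l` is a walk from `u` to `v`. -/
def IsWalk (R : Roadmap n) (u v : Fin n) (l : List (Fin n)) : Prop :=
  (u :: l).IsChain R.graph.Adj ∧ (u :: l).getLast (List.cons_ne_nil _ _) = v

theorem pathCost_nonneg (R : Roadmap n) :
    ∀ {p : List (Fin n)}, p.IsChain R.graph.Adj → 0 ≤ pathCost R p
  | [], _ => le_rfl
  | [_], _ => le_rfl
  | u :: v :: r, h => by
    rw [List.isChain_cons_cons] at h
    exact add_nonneg (R.len_pos _ _ h.1).le (pathCost_nonneg R h.2)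

theorem IsWalk.join {R : Roadmap n} {v w : Fin n} {l' : List (Fin n)} (h' : IsWalk R v w l') :
    ∀ {l : List (Fin n)} {u : Fin n}, IsWalk R u v l → IsWalk R u w (l ++ l') ∧
      pathCost R (u :: (l ++ l')) = pathCost R (u :: l) + pathCost R (v :: l')
  | [], u, h => by
    obtain rfl : u = v := h.2
    exact ⟨h', by simp [pathCost]⟩
  | x :: l, u, h => by
    obtain ⟨h1, h2⟩ := h
    rw [List.isChain_cons_cons] at h1
    rw [List.getLast_cons (List.cons_ne_nil _ _)] at h2
    obtain ⟨⟨h3, h4⟩, h5⟩ := h'.join (l := l) (u := x) ⟨h1.2, h2⟩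
    refine ⟨⟨List.isChain_cons_cons.2 ⟨h1.1, h3⟩, ?_⟩, ?_⟩
    · rw [← h4]; exact List.getLast_cons (List.cons_ne_nil _ _)
    · simp only [List.cons_append, pathCost, h5]; ring

theorem exists_isWalk (R : Roadmap n) (u v : Fin n) : ∃ l, IsWalk R u v l := by
  obtain ⟨p⟩ := R.connected.preconnected u v
  refine ⟨p.support.tail, ?_, ?_⟩
  · rw [p.cons_tail_support]; exact p.isChain_adj_support
  · have := p.getLast_support
    simpa only [p.cons_tail_support] using this

theorem exists_isWalk_covering (R : Roadmap n) (u : Fin n) (s : Finset (Fin n)) :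
    ∃ l v, IsWalk R u v l ∧ ∀ x ∈ s, x ∈ u :: l := by
  induction s using Finset.induction_on with
  | empty => exact ⟨[], u, ⟨by simp, rfl⟩, by simp⟩
  | insert a s _ ih =>
    obtain ⟨l, v, h, hs⟩ := ih
    obtain ⟨l', h'⟩ := exists_isWalk R v a
    refine ⟨l ++ l', a, (h'.join h).1, fun x hx => ?_⟩
    obtain rfl | hx := Finset.mem_insert.1 hx
    · rw [← h'.join h |>.1.2]; exact List.getLast_mem _
    · have := hs x hx
      simp only [List.mem_cons, List.mem_append] at this ⊢; tauto

/-- All `m` paths may be the same walk through the whole graph. One cover of whatever cost is needed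
at the end, to know that the program has produced output at all. -/
theorem exists_isPathCover (R : Roadmap n) (hm : 0 < m) (hn : 0 < n) :
    ∃ p : Fin m → List (Fin n), IsPathCover R p := by
  obtain ⟨l, v, h, hl⟩ := exists_isWalk_covering R ⟨0, hn⟩ Finset.univ
  exact ⟨fun _ => _ :: l, fun _ => ⟨List.cons_ne_nil _ _, h.1⟩, fun v => ⟨⟨0, hm⟩, hl v (by simp)⟩⟩

/-- The distance of two vertices in a roadmap. -/
noncomputable def walkDist (R : Roadmap n) (u v : Fin n) : ℝ :=
  sInf {c | ∃ l, IsWalk R u v l ∧ c = pathCost R (u :: l)}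

theorem walkDist_bddBelow (R : Roadmap n) (u v : Fin n) :
    BddBelow {c | ∃ l, IsWalk R u v l ∧ c = pathCost R (u :: l)} :=
  ⟨0, by rintro _ ⟨l, h, rfl⟩; exact pathCost_nonneg R h.1⟩

theorem walkDist_nonempty (R : Roadmap n) (u v : Fin n) :
    {c | ∃ l, IsWalk R u v l ∧ c = pathCost R (u :: l)}.Nonempty :=
  let ⟨l, h⟩ := exists_isWalk R u v; ⟨_, l, h, rfl⟩

theorem walkDist_self_le (R : Roadmap n) (u : Fin n) : walkDist R u u ≤ 0 :=
  csInf_le (walkDist_bddBelow R u u) ⟨[], ⟨by simp, rfl⟩, rfl⟩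

theorem exists_isWalk_lt (R : Roadmap n) (u v : Fin n) {c : ℝ} (h : walkDist R u v < c) :
    ∃ l, IsWalk R u v l ∧ pathCost R (u :: l) < c := by
  obtain ⟨_, ⟨l, h, rfl⟩, h'⟩ := exists_lt_of_csInf_lt (walkDist_nonempty R u v) h
  exact ⟨l, h, h'⟩

theorem walkDist_le_add (R : Roadmap n) (u : Fin n) {a b : Fin n} (hab : R.graph.Adj a b) :
    walkDist R u b ≤ walkDist R u a + R.len a b := by
  refine le_of_forall_pos_lt_add fun ε hε => ?_
  obtain ⟨l, h, hl⟩ := exists_isWalk_lt R u a (c := walkDist R u a + ε) (by linarith)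
  have h' : IsWalk R a b [b] := ⟨by simp [hab], rfl⟩
  obtain ⟨h1, h2⟩ := h'.join h
  refine (csInf_le (walkDist_bddBelow R u b) ⟨_, h1, rfl⟩).trans_lt ?_
  rw [h2]; simp only [pathCost]; linarith

/-- This is the slope condition on the function `D` in `deriv_interpolation_le`. -/
theorem abs_walkDist_sub_le (R : Roadmap n) (u : Fin n) {a b : Fin n} (hab : R.graph.Adj a b) :
    |walkDist R u b - walkDist R u a| ≤ R.len a b := by
  have h1 := walkDist_le_add R u hab
  have h2 := walkDist_le_add R u hab.symm
  rw [R.len_symm b a hab.symm] at h2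
  rw [abs_le]; constructor <;> linarith

/-! ### Motion of one robot -/

theorem edgePoint_apply (u v w : Fin n) (θ : ℝ) :
    edgePoint u v θ w = (1 - θ) * (if w = u then 1 else 0) + θ * (if w = v then 1 else 0) := by
  simp [edgePoint, vertexPoint, Pi.single_apply]

theorem edgePoint_zero (u v : Fin n) : edgePoint u v 0 = vertexPoint u := by
  simp [edgePoint]

theorem edgePoint_one (u v : Fin n) : edgePoint u v 1 = vertexPoint v := by
  simp [edgePoint]

theorem Roadmap.nonneg_of_mem_carrier {R : Roadmap n} {x : Fin n → ℝ} (hx : x ∈ R.carrier)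
    (w : Fin n) : 0 ≤ x w := by
  obtain ⟨u, v, -, θ, hθ, rfl⟩ := hx
  rw [edgePoint_apply]
  have h1 := hθ.1
  have h2 : 0 ≤ 1 - θ := by linarith [hθ.2]
  split_ifs <;> nlinarith

theorem Roadmap.sum_of_mem_carrier {R : Roadmap n} {x : Fin n → ℝ} (hx : x ∈ R.carrier) :
    ∑ w, x w = 1 := by
  obtain ⟨u, v, -, θ, hθ, rfl⟩ := hx
  simp [edgePoint_apply, Finset.sum_add_distrib]

/-- A function on `[s, t]` with derivative at most one outside a finite set. -/
theorem sub_le_of_deriv_le_one {f : ℝ → ℝ} (B : Finset ℝ) : ∀ {s t : ℝ}, s ≤ t →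
    ContinuousOn f (Set.Icc s t) →
    (∀ r ∈ Set.Ioo s t, r ∉ B → DifferentiableAt ℝ f r ∧ deriv f r ≤ 1) → f t - f s ≤ t - s := by
  induction B using Finset.induction_on with
  | empty =>
    intro s t hst hc hd
    have := (convex_Icc s t).image_sub_le_mul_sub_of_deriv_le (C := 1) hc
      (by rw [interior_Icc]; exact fun r hr => (hd r hr (by simp)).1.differentiableWithinAt)
      (by rw [interior_Icc]; exact fun r hr => (hd r hr (by simp)).2)
      s ⟨le_rfl, hst⟩ t ⟨hst, le_rfl⟩ hst
    simpa using this
  | insert b B _ ih =>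
    intro s t hst hc hd
    by_cases hb : b ∈ Set.Ioo s t
    · have h1 := ih (s := s) (t := b) hb.1.le (hc.mono (Set.Icc_subset_Icc le_rfl hb.2.le))
        fun r hr hrB => hd r ⟨hr.1, hr.2.trans hb.2⟩ (by simp [hrB, hr.2.ne])
      have h2 := ih (s := b) (t := t) hb.2.le (hc.mono (Set.Icc_subset_Icc hb.1.le le_rfl))
        fun r hr hrB => hd r ⟨hb.1.trans hr.1, hr.2⟩ (by simp [hrB, hr.1.ne'])
      linarith
    · refine ih hst hc fun r hr hrB => hd r hr ?_
      rw [Finset.mem_insert]; rintro (rfl | h)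
      exacts [hb hr, hrB h]

/-- At a time of differentiability, the interpolation of a function with slope at most one
along the edges has derivative at most one along a trajectory. -/
theorem deriv_interpolation_le {R : Roadmap n} {T : ℝ} {x : ℝ → Fin n → ℝ} {D : Fin n → ℝ}
    (hD : ∀ a b, R.graph.Adj a b → |D b - D a| ≤ R.len a b)
    (hx : ∀ t ∈ Set.Icc 0 T, x t ∈ R.carrier) {t : ℝ} (ht : t ∈ Set.Ioo 0 T)
    (hd : DifferentiableAt ℝ x t)
    (hs : ∀ u v, R.graph.Adj u v → x t u + x t v = 1 →
      R.len u v * |deriv (fun s => x s v) t| ≤ 1) :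
    DifferentiableAt ℝ (fun s => ∑ w, D w * x s w) t ∧
      deriv (fun s => ∑ w, D w * x s w) t ≤ 1 := by
  have hdw : ∀ w, DifferentiableAt ℝ (fun s => x s w) t := differentiableAt_pi.1 hd
  have hnhds : ∀ᶠ s in nhds t, x s ∈ R.carrier := by
    filter_upwards [Ioo_mem_nhds ht.1 ht.2] with s hs using hx s ⟨hs.1.le, hs.2.le⟩
  -- Barycentric coordinates are nonnegative, so a coordinate that vanishes at the interior time `t`
  -- has a local minimum there. Only the coordinates at the ends of the current edge can change, and
  -- they change oppositely because the sum is constant.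
  have hzero : ∀ w, x t w = 0 → deriv (fun s => x s w) t = 0 := fun w hw => by
    refine IsLocalMin.deriv_eq_zero ?_
    filter_upwards [hnhds] with s hs
    rw [hw]; exact Roadmap.nonneg_of_mem_carrier hs w
  have hsum : ∑ w, deriv (fun s => x s w) t = 0 := by
    rw [← deriv_fun_sum fun w _ => hdw w]
    have : (fun s => ∑ w, x s w) =ᶠ[nhds t] fun _ => 1 := by
      filter_upwards [hnhds] with s hs using Roadmap.sum_of_mem_carrier hs
    rw [this.deriv_eq, deriv_const]
  refine ⟨DifferentiableAt.fun_sum fun w _ => (hdw w).const_mul _, ?_⟩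
  rw [deriv_fun_sum fun w _ => (hdw w).const_mul _]
  simp only [deriv_const_mul _ (hdw _)]
  obtain ⟨u, v, huv, θ, hθ, hxt⟩ := hx t ⟨ht.1.le, ht.2.le⟩
  have hne : ∀ w, w ≠ u → w ≠ v → deriv (fun s => x s w) t = 0 := fun w h1 h2 =>
    hzero w (by rw [hxt, edgePoint_apply]; simp [h1, h2])
  by_cases huv' : u = v
  · subst huv'
    have hu : deriv (fun s => x s u) t = 0 := by
      rw [← hsum, Finset.sum_eq_single u (fun w _ h => hne w h h) (by simp)]
    rw [Finset.sum_eq_zero]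
    · norm_num
    · intro w _
      by_cases h : w = u
      · rw [h, hu, mul_zero]
      · rw [hne w h h, mul_zero]
  · have hadj := huv.resolve_left huv'
    have hpair : ∀ f : Fin n → ℝ, (∀ w, w ≠ u → w ≠ v → f w = 0) → ∑ w, f w = f u + f v :=
      fun f hf => Fintype.sum_eq_add u v huv' fun w hw => hf w hw.1 hw.2
    rw [hpair _ hne] at hsum
    rw [hpair _ fun w h1 h2 => by rw [hne w h1 h2, mul_zero]]
    have h1 := hs u v hadj (by rw [hxt]; simp [edgePoint_apply, huv', Ne.symm huv'])
    have h2 : deriv (fun s => x s u) t = - deriv (fun s => x s v) t := by linarith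
    have h3 : D u * deriv (fun s => x s u) t + D v * deriv (fun s => x s v) t =
        (D v - D u) * deriv (fun s => x s v) t := by rw [h2]; ring
    rw [h3]
    calc _ ≤ |D v - D u| * |deriv (fun s => x s v) t| := by rw [← abs_mul]; exact le_abs_self _
      _ ≤ R.len u v * |deriv (fun s => x s v) t| := by gcongr; exact hD u v hadj
      _ ≤ 1 := h1

/-- The distance from `u`, interpolated linearly along edges, grows at rate at most one along the
trajectory. This avoids having to reconstruct the sequence of edges that the robot traverses. -/
theorem walkDist_le_of_trajectory {R : Roadmap n} {T : ℝ} {x : ℝ → Fin n → ℝ}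
    (hx : IsTrajectory R T x) {s t : ℝ} (hs : 0 ≤ s) (hst : s ≤ t) (ht : t ≤ T) {u v : Fin n}
    (hu : x s = vertexPoint u) (hv : x t = vertexPoint v) : walkDist R u v ≤ t - s := by
  obtain ⟨h1, h2, B, h3⟩ := hx
  have key := sub_le_of_deriv_le_one (f := fun r => ∑ w, walkDist R u w * x r w) B hst
    ?_ fun r hr hrB => ?_
  · simp only [hu, hv, vertexPoint, Pi.single_apply, mul_ite, mul_one, mul_zero,
      Finset.sum_ite_eq', Finset.mem_univ, if_true] at key
    linarith [walkDist_self_le R u]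
  · have h2' := h2.mono (Set.Icc_subset_Icc hs ht)
    exact continuousOn_finsetSum _ fun w _ => continuousOn_const.mul
      ((continuous_apply w).comp_continuousOn h2')
  · have hr' : r ∈ Set.Ioo 0 T := ⟨hs.trans_lt hr.1, hr.2.trans_le ht⟩
    obtain ⟨h4, h5⟩ := h3 r hr' hrB
    exact deriv_interpolation_le (fun a b hab => abs_walkDist_sub_le R u hab) h1 hr' h4 h5

/-- The vertices that a robot visits lie on a path that is hardly longer than its travel time. -/
theorem exists_path_through_visits {R : Roadmap n} {T : ℝ} {x : ℝ → Fin n → ℝ}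
    (hx : IsTrajectory R T x) {τ : ℝ} (hτ : τ ≤ T) {ε : ℝ} (hε : 0 < ε) (tm : Fin n → ℝ)
    (W : Finset (Fin n)) (hW : ∀ v ∈ W, 0 ≤ tm v ∧ tm v ≤ τ ∧ x (tm v) = vertexPoint v)
    (hne : W.Nonempty) :
    ∃ u l z, IsWalk R u z l ∧ z ∈ W ∧ (∀ v ∈ W, v ∈ u :: l ∧ tm v ≤ tm z) ∧
      pathCost R (u :: l) ≤ tm z + W.card * ε := by
  -- Vertices are added in the order of their chosen visit times. The walk so far ends at the latest
  -- vertex `z`, and the link from `z` to the new vertex `a` costs less than `tm a - tm z + ε`, so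
  -- the sum telescopes. The `ε` pays for `walkDist` being defined as an infimum.
  induction W using Finset.induction_on_max_value tm with
  | empty => simp at hne
  | insert a s ha hmax ih =>
    rcases s.eq_empty_or_nonempty with rfl | hs
    · refine ⟨a, [], a, ⟨by simp, rfl⟩, by simp, by simp, ?_⟩
      have := (hW a (by simp)).1
      simp only [pathCost]; positivity
    · obtain ⟨u, l, z, h1, h2, h3, h4⟩ := ih (fun v hv => hW v (by simp [hv])) hs
      obtain ⟨hz1, hz2, hz3⟩ := hW z (by simp [h2])
      obtain ⟨ha1, ha2, ha3⟩ := hW a (by simp)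
      have hd := walkDist_le_of_trajectory hx hz1 (hmax z h2) (ha2.trans hτ) hz3 ha3
      obtain ⟨l', h5, h6⟩ := exists_isWalk_lt R z a (c := tm a - tm z + ε) (by linarith)
      obtain ⟨h7, h8⟩ := h5.join h1
      refine ⟨u, l ++ l', a, h7, by simp, fun v hv => ?_, ?_⟩
      · obtain rfl | hv := Finset.mem_insert.1 hv
        · refine ⟨?_, le_rfl⟩
          rw [← h7.2]; exact List.getLast_mem _
        · have := (h3 v hv).1
          refine ⟨?_, hmax v hv⟩
          simp only [List.mem_cons, List.mem_append] at this ⊢; tauto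
      · rw [h8, Finset.card_insert_of_notMem ha]; push_cast; linarith

/-! ### Refresh times and costs of covers -/

theorem le_coverCost (R : Roadmap n) (p : Fin m → List (Fin n)) (i : Fin m) :
    pathCost R (p i) ≤ coverCost R p :=
  le_ciSup (Set.finite_range fun i => pathCost R (p i)).bddAbove i

theorem coverCost_le (R : Roadmap n) {p : Fin m → List (Fin n)} (hm : 0 < m) {c : ℝ}
    (h : ∀ i, pathCost R (p i) ≤ c) : coverCost R p ≤ c :=
  haveI : Nonempty (Fin m) := ⟨⟨0, hm⟩⟩
  ciSup_le h

/-- A team that visits every vertex by the time `τ` yields a path cover of cost nearly `τ`. -/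
theorem exists_cover_of_team {R : Roadmap n} {T τ : ℝ} (hτ0 : 0 ≤ τ) (hτ : τ ≤ T) (hm : 0 < m)
    (hn : 0 < n) {Y : Fin m → ℝ → Fin n → ℝ} (hY : IsTeamTrajectory R T Y)
    (hvis : ∀ v, ∃ i t, 0 ≤ t ∧ t ≤ τ ∧ Y i t = vertexPoint v) {ε : ℝ} (hε : 0 < ε) :
    ∃ p : Fin m → List (Fin n), IsPathCover R p ∧ coverCost R p ≤ τ + ε := by
  classical
  choose f tm h0 h1 h2 using hvis
  -- One visit has been chosen for each vertex. A robot to which no visit is assigned receives a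
  -- one-vertex path; any other robot passes at most `n` assigned vertices, whence the tolerance `ε
  -- / n` per link.
  have key : ∀ i, ∃ p, IsPath R p ∧ (∀ v, f v = i → v ∈ p) ∧ pathCost R p ≤ τ + ε := fun i => by
    rcases (Finset.univ.filter fun v => f v = i).eq_empty_or_nonempty with he | hne
    · refine ⟨[⟨0, hn⟩], ⟨by simp, by simp⟩, fun v hv => ?_, by simp [pathCost]; positivity⟩
      have : v ∈ Finset.univ.filter fun v => f v = i := by simp [hv]
      simp [he] at this
    · obtain ⟨u, l, z, h3, h4, h5, h6⟩ := exists_path_through_visits (hY i) hτ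
        (ε := ε / n) (by positivity) tm _
        (fun v hv => by
          have : f v = i := by simpa using hv
          exact ⟨h0 v, h1 v, this ▸ h2 v⟩) hne
      refine ⟨u :: l, ⟨by simp, h3.1⟩, fun v hv => (h5 v (by simp [hv])).1, h6.trans ?_⟩
      have hc : (((Finset.univ.filter fun v => f v = i).card : ℕ) : ℝ) ≤ n := by
        exact_mod_cast (Finset.card_le_univ _).trans (by simp)
      have : ((Finset.univ.filter fun v => f v = i).card : ℝ) * (ε / n) ≤ n * (ε / n) := by
        gcongr
      have h7 : (n : ℝ) * (ε / n) = ε := by field_simp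
      linarith [h1 z]
  choose p hp1 hp2 hp3 using key
  exact ⟨p, ⟨hp1, fun v => ⟨f v, hp2 _ v rfl⟩⟩, coverCost_le R hm hp3⟩

theorem refreshTime_bddAbove (T : ℝ) (X : Fin m → ℝ → Fin n → ℝ) :
    BddAbove {d | ∃ (v : Fin n) (t₁ t₂ : ℝ), 0 ≤ t₁ ∧ t₁ ≤ t₂ ∧ t₂ ≤ T ∧
      (∀ (i : Fin m) (t : ℝ), t₁ < t → t < t₂ → X i t ≠ vertexPoint v) ∧ d = t₂ - t₁} :=
  ⟨T, by rintro _ ⟨v, t₁, t₂, h1, h2, h3, -, rfl⟩; linarith⟩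

theorem refreshTime_le {T : ℝ} (hT : 0 < T) (hn : 0 < n) {X : Fin m → ℝ → Fin n → ℝ} {c : ℝ}
    (h : ∀ (v : Fin n) (t₁ t₂ : ℝ), 0 ≤ t₁ → t₁ ≤ t₂ → t₂ ≤ T →
      (∀ (i : Fin m) (t : ℝ), t₁ < t → t < t₂ → X i t ≠ vertexPoint v) → t₂ - t₁ ≤ c) :
    refreshTime T X ≤ c := by
  refine csSup_le ⟨0, ⟨0, hn⟩, 0, 0, le_rfl, le_rfl, hT.le, fun i t h1 h2 => ?_, by simp⟩ ?_
  · linarith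
  · rintro _ ⟨v, t₁, t₂, h1, h2, h3, h4, rfl⟩
    exact h v t₁ t₂ h1 h2 h3 h4

theorem refreshTime_nonneg {T : ℝ} (hT : 0 < T) (hn : 0 < n) (X : Fin m → ℝ → Fin n → ℝ) :
    0 ≤ refreshTime T X :=
  le_csSup (refreshTime_bddAbove T X)
    ⟨⟨0, hn⟩, 0, 0, le_rfl, le_rfl, hT.le, fun i t h1 h2 => by linarith, by simp⟩

/-- The refresh time of a team bounds the cost of a path cover, unless it is the horizon. -/
theorem exists_cover_of_refreshTime_lt {R : Roadmap n} {T τ : ℝ} (hT : 0 < T) (hm : 0 < m)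
    (hn : 0 < n) {Y : Fin m → ℝ → Fin n → ℝ} (hY : IsTeamTrajectory R T Y)
    (h : refreshTime T Y < τ) (hτ : τ ≤ T) {ε : ℝ} (hε : 0 < ε) :
    ∃ p : Fin m → List (Fin n), IsPathCover R p ∧ coverCost R p ≤ τ + ε := by
  have hτ0 : 0 ≤ τ := (refreshTime_nonneg hT hn Y).trans h.le
  refine exists_cover_of_team hτ0 hτ hm hn hY (fun v => ?_) hε
  by_contra hv
  push Not at hv
  -- A vertex that is not visited during `[0, τ]` makes this an admissible interval, of length
  -- greater than the refresh time.
  refine absurd (le_csSup (refreshTime_bddAbove T Y)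
    ⟨v, 0, τ, le_rfl, hτ0, hτ, fun i t h1 h2 => hv i t h1.le h2.le, rfl⟩) ?_
  rw [not_le, sub_zero]; exact h

/-! ### Sweeping a path -/

theorem pathPoint_zero (R : Roadmap n) (u : Fin n) :
    ∀ {l : List (Fin n)}, (u :: l).IsChain R.graph.Adj → pathPoint R (u :: l) 0 = vertexPoint u
  | [], _ => rfl
  | v :: l, h => by
    rw [List.isChain_cons_cons] at h
    rw [pathPoint, if_pos (R.len_pos _ _ h.1).le, zero_div, edgePoint_zero]

theorem continuous_edgePoint (u v : Fin n) : Continuous (edgePoint u v) := by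
  unfold edgePoint; fun_prop

theorem continuous_pathPoint (R : Roadmap n) :
    ∀ {p : List (Fin n)}, p.IsChain R.graph.Adj → Continuous (pathPoint R p)
  | [], _ => continuous_const
  | [_], _ => continuous_const
  | u :: v :: r, h => by
    rw [List.isChain_cons_cons] at h
    have hpos := R.len_pos _ _ h.1
    show Continuous fun s => if s ≤ R.len u v then edgePoint u v (s / R.len u v)
      else pathPoint R (v :: r) (s - R.len u v)
    refine Continuous.if_le ((continuous_edgePoint u v).comp (by fun_prop))
      ((continuous_pathPoint R h.2).comp (by fun_prop)) continuous_id continuous_const ?_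
    rintro s rfl
    rw [div_self hpos.ne', edgePoint_one, sub_self, pathPoint_zero R v h.2]

theorem pathPoint_mem_carrier (R : Roadmap n) :
    ∀ {p : List (Fin n)}, IsPath R p → ∀ {s : ℝ}, 0 ≤ s → pathPoint R p s ∈ R.carrier
  | [], h, _, _ => absurd rfl h.1
  | [v], _, _, _ => ⟨v, v, Or.inl rfl, 0, by simp, (edgePoint_zero v v).symm⟩
  | u :: v :: r, h, s, hs => by
    have h' := List.isChain_cons_cons.1 h.2
    have hpos := R.len_pos _ _ h'.1
    rw [pathPoint]
    split_ifs with hle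
    · exact ⟨u, v, Or.inr h'.1, _, ⟨by positivity, (div_le_one hpos).2 hle⟩, rfl⟩
    · exact pathPoint_mem_carrier R ⟨by simp, h'.2⟩ (by linarith)

/-- The points at which a path passes its vertices. -/
theorem exists_pathPoint_eq (R : Roadmap n) :
    ∀ {p : List (Fin n)}, p.IsChain R.graph.Adj → ∀ {v : Fin n}, v ∈ p →
      ∃ s, 0 ≤ s ∧ s ≤ pathCost R p ∧ pathPoint R p s = vertexPoint v
  | [], _, _, hv => by simp at hv
  | [w], _, v, hv => by
    obtain rfl : v = w := by simpa using hv
    exact ⟨0, le_rfl, le_rfl, rfl⟩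
  | u :: w :: r, h, v, hv => by
    have h' := List.isChain_cons_cons.1 h
    have hpos := R.len_pos _ _ h'.1
    obtain rfl | hv := List.mem_cons.1 hv
    · exact ⟨0, le_rfl, pathCost_nonneg R h, pathPoint_zero R v h⟩
    · obtain ⟨s, h1, h2, h3⟩ := exists_pathPoint_eq R h'.2 hv
      refine ⟨s + R.len u w, by linarith, by rw [pathCost]; linarith, ?_⟩
      -- `pathPoint` assigns the junction to the first edge, so the position at distance `0` on the
      -- tail has to be read there as the end of that edge.
      rcases h1.eq_or_lt with rfl | h1
      · rw [pathPoint, zero_add, if_pos le_rfl, div_self hpos.ne', edgePoint_one, ← h3,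
          pathPoint_zero R w h'.2]
      · rw [pathPoint, if_neg (by linarith), add_sub_cancel_right, h3]

/-- `x` passes through the position `x s` at unit speed or slower. -/
def SlowAt (R : Roadmap n) (x : ℝ → Fin n → ℝ) (s : ℝ) : Prop :=
  DifferentiableAt ℝ x s ∧ ∀ u v, R.graph.Adj u v → x s u + x s v = 1 →
    R.len u v * |deriv (fun r => x r v) s| ≤ 1

theorem SlowAt.congr {R : Roadmap n} {x y : ℝ → Fin n → ℝ} {s : ℝ} (h : SlowAt R x s)
    (hxy : y =ᶠ[nhds s] x) : SlowAt R y s := by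
  refine ⟨h.1.congr_of_eventuallyEq hxy, fun u v huv hsum => ?_⟩
  have : (fun r => y r v) =ᶠ[nhds s] fun r => x r v := hxy.mono fun r hr => by simp only [hr]
  rw [this.deriv_eq]
  exact h.2 u v huv (by rw [← hxy.eq_of_nhds]; exact hsum)

theorem SlowAt.comp {R : Roadmap n} {x : ℝ → Fin n → ℝ} {f : ℝ → ℝ} {f' t : ℝ}
    (h : SlowAt R x (f t)) (hf : HasDerivAt f f' t) (hf' : |f'| ≤ 1) :
    SlowAt R (fun t => x (f t)) t := by
  refine ⟨h.1.comp t hf.differentiableAt, fun u v huv hsum => ?_⟩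
  have hv : DifferentiableAt ℝ (fun r => x r v) (f t) := differentiableAt_pi.1 h.1 v
  have h2 := (hv.hasDerivAt.comp t hf).deriv
  rw [show (fun r => x (f r) v) = (fun r => x r v) ∘ f from rfl, h2, abs_mul]
  have h3 := h.2 u v huv hsum
  have h4 := (R.len_pos u v huv).le
  calc _ = R.len u v * |deriv (fun r => x r v) (f t)| * |f'| := by ring
    _ ≤ 1 * 1 := by gcongr
    _ = 1 := one_mul 1

/-- In the interior of the edge two coordinates are positive, so the only adjacent pair whose
coordinates sum to one is the pair of its ends. At any other vertex the derivative vanishes. -/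
theorem slowAt_edge (R : Roadmap n) {u v : Fin n} (huv : R.graph.Adj u v) {s : ℝ} (h0 : 0 < s)
    (h1 : s < R.len u v) : SlowAt R (fun s => edgePoint u v (s / R.len u v)) s := by
  have hpos := R.len_pos u v huv
  have hder : ∀ w, HasDerivAt (fun r => edgePoint u v (r / R.len u v) w)
      (-(1 / R.len u v) * (if w = u then 1 else 0) + 1 / R.len u v * (if w = v then 1 else 0))
      s := fun w => by
    simp only [edgePoint_apply]
    have h := (hasDerivAt_id s).div_const (R.len u v)
    exact ((h.const_sub 1).mul_const _).add (h.mul_const _)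
  refine ⟨differentiableAt_pi.2 fun w => (hder w).differentiableAt, fun a b hab hsum => ?_⟩
  rw [(hder b).deriv]
  have hne := huv.ne
  have hθ0 : 0 < s / R.len u v := by positivity
  have hθ1 : s / R.len u v < 1 := (div_lt_one hpos).2 h1
  have habs : |1 / R.len u v| = 1 / R.len u v := abs_of_pos (by positivity)
  simp only [edgePoint_apply] at hsum
  by_cases hbu : b = u
  · subst hbu
    have hav : a = v := by
      by_contra hav
      simp [hav, hab.ne, hne] at hsum
      rcases hsum with h | h <;> linarith
    subst hav
    rw [R.len_symm a b hab]
    simp only [if_true, if_neg hne, mul_one, mul_zero, add_zero, abs_neg, habs]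
    rw [mul_one_div_cancel hpos.ne']
  · by_cases hbv : b = v
    · subst hbv
      have hau : a = u := by
        by_contra hau
        simp [hau, hab.ne, hbu] at hsum
        linarith
      subst hau
      simp only [if_true, if_neg hbu, mul_one, mul_zero, zero_add, habs]
      rw [mul_one_div_cancel hpos.ne']
    · simp [hbu, hbv]

theorem slowAt_const (R : Roadmap n) (x : Fin n → ℝ) (s : ℝ) : SlowAt R (fun _ => x) s :=
  ⟨differentiableAt_const _, fun u v _ _ => by simp⟩

/-- The exceptions are the distances at which the path reaches a vertex. Between them the motion is
along one edge, and beyond the end it is at rest. -/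
theorem exists_slowAt_pathPoint (R : Roadmap n) :
    ∀ {p : List (Fin n)}, p.IsChain R.graph.Adj →
      ∃ B : Finset ℝ, ∀ s, 0 < s → s ∉ B → SlowAt R (pathPoint R p) s
  | [], _ => ⟨∅, fun s _ _ => slowAt_const R 0 s⟩
  | [v], _ => ⟨∅, fun s _ _ => slowAt_const R (vertexPoint v) s⟩
  | u :: v :: r, h => by
    have h' := List.isChain_cons_cons.1 h
    obtain ⟨B, hB⟩ := exists_slowAt_pathPoint R h'.2
    refine ⟨insert (R.len u v) (B.image (· + R.len u v)), fun s hs hsB => ?_⟩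
    simp only [Finset.mem_insert, Finset.mem_image, not_or, not_exists, not_and] at hsB
    rcases lt_or_gt_of_ne hsB.1 with hlt | hlt
    · refine (slowAt_edge R h'.1 hs hlt).congr ?_
      filter_upwards [Iio_mem_nhds hlt] with t ht
      rw [pathPoint, if_pos (le_of_lt ht)]
    · have := hB (s - R.len u v) (by linarith) fun hm => hsB.2 _ hm (by ring)
      refine (SlowAt.comp (f := fun s => s - R.len u v) this
        ((hasDerivAt_id s).sub_const _) (by simp)).congr ?_
      filter_upwards [Ioi_mem_nhds hlt] with t ht
      rw [pathPoint, if_neg (not_le.2 ht)]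

/-! ### The triangle wave -/

theorem triangleWave_nonneg (L t : ℝ) : 0 ≤ triangleWave L t := abs_nonneg _

theorem triangleWave_eq_mul {L : ℝ} (hL : 0 < L) (t : ℝ) :
    triangleWave L t = 2 * L * |t / (2 * L) - round (t / (2 * L))| := by
  rw [triangleWave, ← abs_of_pos (show 0 < 2 * L by positivity), ← abs_mul,
    abs_of_pos (show 0 < 2 * L by positivity)]
  congr 1
  field_simp

theorem triangleWave_le_abs {L : ℝ} (hL : 0 < L) (t : ℝ) (k : ℤ) :
    triangleWave L t ≤ |t - 2 * L * k| := by
  have h : |t - 2 * L * k| = 2 * L * |t / (2 * L) - k| := by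
    rw [← abs_of_pos (show 0 < 2 * L by positivity), ← abs_mul,
      abs_of_pos (show 0 < 2 * L by positivity)]
    congr 1
    field_simp
  rw [h, triangleWave_eq_mul hL]
  have := round_le (t / (2 * L)) k
  gcongr

theorem triangleWave_le {L : ℝ} (hL : 0 < L) (t : ℝ) : triangleWave L t ≤ L := by
  rw [triangleWave_eq_mul hL]
  nlinarith [abs_sub_round (t / (2 * L))]

/-- Distinct multiples of `2 * L` are at least `2 * L` apart, so if one of them is within `L` of
`t`, no other is strictly closer. -/
theorem triangleWave_eq_abs {L : ℝ} (hL : 0 < L) {t : ℝ} {k : ℤ} (h : |t - 2 * L * k| ≤ L) :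
    triangleWave L t = |t - 2 * L * k| := by
  refine le_antisymm (triangleWave_le_abs hL t k) ?_
  by_cases hk : round (t / (2 * L)) = k
  · rw [triangleWave, hk]
  · have h1 : (1 : ℝ) ≤ |(round (t / (2 * L)) : ℝ) - k| := by
      exact_mod_cast Int.one_le_abs (sub_ne_zero.2 hk)
    have h2 : 2 * L ≤ triangleWave L t + |t - 2 * L * k| := by
      calc 2 * L ≤ 2 * L * |(round (t / (2 * L)) : ℝ) - k| := by nlinarith
        _ = |(t - 2 * L * k) - (t - 2 * L * round (t / (2 * L)))| := by
          rw [← abs_of_pos (show 0 < 2 * L by positivity), ← abs_mul,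
            abs_of_pos (show 0 < 2 * L by positivity)]
          congr 1; ring
        _ ≤ _ := by rw [add_comm]; exact abs_sub _ _
    linarith

theorem continuous_triangleWave {L : ℝ} (hL : 0 < L) : Continuous (triangleWave L) := by
  refine LipschitzWith.continuous (K := 1) (LipschitzWith.of_le_add fun t t' => ?_)
  have h := triangleWave_le_abs hL t (round (t' / (2 * L)))
  have h2 : |t - 2 * L * round (t' / (2 * L))| ≤
      |t' - 2 * L * round (t' / (2 * L))| + |t - t'| := by
    rw [add_comm]; exact abs_sub_le _ _ _
  rw [Real.dist_eq]
  exact h.trans h2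

/-- Away from its turning values `0` and `L` the wave is locally `±(t - 2 * L * k)` with a fixed
`k`. -/
theorem exists_hasDerivAt_triangleWave {L t : ℝ} (h0 : triangleWave L t ≠ 0) (hL : 0 < L)
    (h1 : triangleWave L t ≠ L) : ∃ f', HasDerivAt (triangleWave L) f' t ∧ |f'| ≤ 1 := by
  set k := round (t / (2 * L)) with hk
  have ht : triangleWave L t = |t - 2 * L * k| := rfl
  have hlt : |t - 2 * L * k| < L := lt_of_le_of_ne (ht ▸ triangleWave_le hL t) (ht ▸ h1)
  have hev : triangleWave L =ᶠ[nhds t] fun r => |r - 2 * L * k| := by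
    have : ∀ᶠ r in nhds t, |r - 2 * L * k| < L :=
      (show Continuous fun r : ℝ => |r - 2 * L * k| by fun_prop).continuousAt.eventually_lt
        continuousAt_const hlt
    filter_upwards [this] with r hr using triangleWave_eq_abs hL hr.le
  have hd : HasDerivAt (fun r : ℝ => r - 2 * L * k) 1 t := (hasDerivAt_id t).sub_const _
  have hne : t - 2 * L * k ≠ 0 := fun h => h0 (by rw [ht, h, abs_zero])
  have hcont : ContinuousAt (fun r : ℝ => r - 2 * L * k) t := hd.continuousAt
  rcases lt_or_gt_of_ne hne with h | h
  · refine ⟨-1, (hd.neg.congr_of_eventuallyEq ?_).congr_of_eventuallyEq hev, by simp⟩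
    filter_upwards [hcont.eventually_lt continuousAt_const h] with r hr
    exact abs_of_neg hr
  · refine ⟨1, (hd.congr_of_eventuallyEq ?_).congr_of_eventuallyEq hev, by simp⟩
    filter_upwards [continuousAt_const.eventually_lt hcont h] with r hr
    exact abs_of_pos hr

/-- Used to pull the finitely many bad distances on a path back to finitely many bad times: a value
`b` is attained only at times `2 * L * k ± b`, and `k` is bounded on a bounded interval. -/
theorem exists_finset_triangleWave {L : ℝ} (hL : 0 < L) (T : ℝ) (B : Finset ℝ) :
    ∃ E : Finset ℝ, ∀ t ∈ Set.Ioo 0 T, triangleWave L t ∈ B → t ∈ E := by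
  classical
  refine ⟨((Finset.Icc (-1) (⌈T / (2 * L)⌉ + 1)) ×ˢ B).image (fun q => 2 * L * (q.1 : ℤ) + q.2) ∪
    ((Finset.Icc (-1) (⌈T / (2 * L)⌉ + 1)) ×ˢ B).image (fun q => 2 * L * (q.1 : ℤ) - q.2),
    fun t ht hB => ?_⟩
  have h1 : 0 < t / (2 * L) := div_pos ht.1 (by positivity)
  have h2 : t / (2 * L) < T / (2 * L) := by gcongr; exact ht.2
  have h3 := abs_le.1 (abs_sub_round (t / (2 * L)))
  have hmem : round (t / (2 * L)) ∈ Finset.Icc (-1) (⌈T / (2 * L)⌉ + 1) := by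
    rw [Finset.mem_Icc]
    constructor
    · have : (-1 : ℝ) ≤ round (t / (2 * L)) := by linarith
      exact_mod_cast this
    · have h4 := Int.le_ceil (T / (2 * L))
      have : ((round (t / (2 * L)) : ℤ) : ℝ) ≤ ((⌈T / (2 * L)⌉ + 1 : ℤ) : ℝ) := by
        push_cast; linarith
      exact_mod_cast this
  rw [Finset.mem_union, Finset.mem_image, Finset.mem_image]
  have h5 : triangleWave L t = |t - 2 * L * round (t / (2 * L))| := rfl
  rcases le_total 0 (t - 2 * L * round (t / (2 * L))) with h | h
  · rw [abs_of_nonneg h] at h5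
    exact Or.inl ⟨(_, _), Finset.mk_mem_product hmem hB, by simp only [h5]; ring⟩
  · rw [abs_of_nonpos h] at h5
    exact Or.inr ⟨(_, _), Finset.mk_mem_product hmem hB, by simp only [h5]; ring⟩

theorem exists_triangleWave_eq {L s : ℝ} (hL : 0 < L) (hs : 0 ≤ s) (hsL : s ≤ L) {t₁ t₂ : ℝ}
    (h : 2 * L < t₂ - t₁) : ∃ t, t₁ < t ∧ t < t₂ ∧ triangleWave L t = s := by
  have h1 := Int.floor_le ((t₁ - s) / (2 * L))
  have h2 := Int.lt_floor_add_one ((t₁ - s) / (2 * L))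
  rw [le_div_iff₀ (by positivity)] at h1
  rw [div_lt_iff₀ (by positivity)] at h2
  -- The wave equals `s` at all times `2 * L * k + s`; this is the first such time after `t₁`.
  refine ⟨2 * L * ((⌊(t₁ - s) / (2 * L)⌋ + 1 : ℤ) : ℝ) + s, ?_, ?_, ?_⟩
  · push_cast; nlinarith
  · push_cast; nlinarith
  · rw [triangleWave_eq_abs hL (k := ⌊(t₁ - s) / (2 * L)⌋ + 1)]
    · rw [add_sub_cancel_left, abs_of_nonneg hs]
    · rw [add_sub_cancel_left, abs_of_nonneg hs]; exact hsL

theorem IsPath.eq_singleton_or_cost_pos {R : Roadmap n} :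
    ∀ {p : List (Fin n)}, IsPath R p → (∃ v, p = [v]) ∨ 0 < pathCost R p
  | [], h => absurd rfl h.1
  | [v], _ => Or.inl ⟨v, rfl⟩
  | u :: v :: r, h => by
    have h' := List.isChain_cons_cons.1 h.2
    exact Or.inr (add_pos_of_pos_of_nonneg (R.len_pos _ _ h'.1) (pathCost_nonneg R h'.2))

theorem isTrajectory_sweep {R : Roadmap n} {p : Fin m → List (Fin n)} (hp : ∀ i, IsPath R (p i))
    (T : ℝ) : IsTeamTrajectory R T (sweep R p) := by
  intro i
  refine ⟨fun t _ => pathPoint_mem_carrier R (hp i) (triangleWave_nonneg _ _), ?_⟩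
  rcases (hp i).eq_singleton_or_cost_pos with ⟨v, hv⟩ | hL
  · have : sweep R p i = fun _ => vertexPoint v := by
      funext t; simp only [sweep, hv, pathPoint]
    rw [this]
    exact ⟨continuousOn_const, ∅, fun t _ _ => slowAt_const R (vertexPoint v) t⟩
  · refine ⟨((continuous_pathPoint R (hp i).2).comp (continuous_triangleWave hL)).continuousOn, ?_⟩
    obtain ⟨B, hB⟩ := exists_slowAt_pathPoint R (hp i).2
    -- The values `0` and `pathCost R (p i)` are added because the wave turns there.
    obtain ⟨E, hE⟩ := exists_finset_triangleWave hL T (insert 0 (insert (pathCost R (p i)) B))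
    refine ⟨E, fun t ht htE => ?_⟩
    have hnot := mt (hE t ht) htE
    simp only [Finset.mem_insert, not_or] at hnot
    obtain ⟨f', h1, h2⟩ := exists_hasDerivAt_triangleWave hnot.1 hL hnot.2.1
    exact (hB _ (lt_of_le_of_ne (triangleWave_nonneg _ _) (Ne.symm hnot.1)) hnot.2.2).comp h1 h2

/-- A vertex of `p i` sits at some distance `s` along that path, and the wave takes the value `s`
inside every interval longer than `2 * pathCost R (p i)`. On a one-vertex path the robot never
leaves. -/
theorem refreshTime_sweep_le {R : Roadmap n} {p : Fin m → List (Fin n)} (hp : IsPathCover R p)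
    (hn : 0 < n) {T : ℝ} (hT : 0 < T) : refreshTime T (sweep R p) ≤ 2 * coverCost R p := by
  refine refreshTime_le hT hn fun v t₁ t₂ h0 h12 hT' hno => ?_
  obtain ⟨i, hi⟩ := hp.2 v
  have hc := le_coverCost R p i
  by_contra! hlt
  have hlt' : 2 * pathCost R (p i) < t₂ - t₁ := by linarith
  rcases (hp.1 i).eq_singleton_or_cost_pos with ⟨w, hw⟩ | hL
  · obtain rfl : v = w := by simpa [hw] using hi
    simp only [hw, pathCost] at hlt'
    exact hno i ((t₁ + t₂) / 2) (by linarith) (by linarith) (by simp only [sweep, hw, pathPoint])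
  · obtain ⟨s, hs1, hs2, hs3⟩ := exists_pathPoint_eq R (hp.1 i).2 hi
    obtain ⟨t, ht1, ht2, ht3⟩ := exists_triangleWave_eq hL hs1 hs2 hlt'
    exact hno i t ht1 ht2 (by simp only [sweep, ht3, hs3])

/-- Twice the cost of the cover, four times the cost of the cover extracted from `Y`, and the latter
is at most the refresh time of `Y` up to an error that tends to zero. -/
theorem refreshTime_sweep_le_mul {R : Roadmap n} {p : Fin m → List (Fin n)} (hm : 0 < m)
    (hn : 0 < n) (hp : IsPathCover R p)
    (h4 : ∀ p' : Fin m → List (Fin n), IsPathCover R p' → coverCost R p ≤ 4 * coverCost R p')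
    {T : ℝ} (hT : 0 < T) {Y : Fin m → ℝ → Fin n → ℝ} (hY : IsTeamTrajectory R T Y) :
    refreshTime T (sweep R p) ≤ 8 * refreshTime T Y := by
  have h0 := refreshTime_nonneg hT hn Y
  rcases lt_or_ge (refreshTime T Y) T with hlt | hge
  · refine le_of_forall_pos_le_add fun ε hε => ?_
    -- The extraction needs `refreshTime T Y < τ ≤ T`. The two errors of at most `ε / 16`,
    -- multiplied by 8, add up to `ε`.
    set δ := min (ε / 16) (T - refreshTime T Y)
    have hδ : 0 < δ := lt_min (by positivity) (by linarith)
    have hδ1 : δ ≤ ε / 16 := min_le_left _ _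
    have hδ2 : δ ≤ T - refreshTime T Y := min_le_right _ _
    obtain ⟨p', hp', hc⟩ := exists_cover_of_refreshTime_lt (τ := refreshTime T Y + δ) hT hm hn hY
      (by linarith) (by linarith) (ε := ε / 16) (by positivity)
    linarith [h4 p' hp', refreshTime_sweep_le hp hn hT]
  -- If `Y` leaves a vertex unvisited for the whole horizon, it says nothing about covers, but no
  -- refresh time exceeds `T`.
  · have : refreshTime T (sweep R p) ≤ T :=
      refreshTime_le hT hn fun v t₁ t₂ h0 h12 hT' _ => by linarith
    linarith

end Patrol

namespace Patrol

variable {n m : ℕ}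

/-! ### Minimum spanning forests -/

/-- `u` and `v` are connected by the edges `H` and by passing between vertices of equal label. -/
def Conn (comp : Fin n → ℕ) (H : List (Fin n × Fin n)) : Fin n → Fin n → Prop :=
  Relation.EqvGen fun a b => comp a = comp b ∨ (a, b) ∈ H

section Conn

variable {comp : Fin n → ℕ} {H : List (Fin n × Fin n)}

theorem Conn.refl (u : Fin n) : Conn comp H u u := Relation.EqvGen.refl u

theorem Conn.symm {u v : Fin n} (h : Conn comp H u v) : Conn comp H v u :=
  Relation.EqvGen.symm _ _ h

theorem Conn.trans {u v w : Fin n} (h : Conn comp H u v) (h' : Conn comp H v w) :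
    Conn comp H u w :=
  Relation.EqvGen.trans _ _ _ h h'

theorem Conn.of_comp {u v : Fin n} (h : comp u = comp v) : Conn comp H u v :=
  Relation.EqvGen.rel _ _ (Or.inl h)

theorem Conn.of_mem {u v : Fin n} (h : (u, v) ∈ H) : Conn comp H u v :=
  Relation.EqvGen.rel _ _ (Or.inr h)

theorem Conn.le {comp' : Fin n → ℕ} {H' : List (Fin n × Fin n)}
    (h1 : ∀ u v, comp u = comp v → Conn comp' H' u v) (h2 : ∀ u v, (u, v) ∈ H → Conn comp' H' u v)
    {u v : Fin n} (h : Conn comp H u v) : Conn comp' H' u v := by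
  induction h with
  | rel a b h => exact h.elim (h1 a b) (h2 a b)
  | refl a => exact .refl a
  | symm a b _ ih => exact ih.symm
  | trans a b c _ _ ih ih' => exact ih.trans ih'

theorem Conn.mono {comp' : Fin n → ℕ} {H' : List (Fin n × Fin n)}
    (h1 : ∀ u v, comp u = comp v → comp' u = comp' v) (h2 : H ⊆ H')
    {u v : Fin n} (h : Conn comp H u v) : Conn comp' H' u v :=
  h.le (fun u v h => .of_comp (h1 u v h)) fun _ _ h => .of_mem (h2 h)

theorem Conn.nil {u v : Fin n} (h : Conn comp [] u v) : comp u = comp v := by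
  induction h with
  | rel a b h => exact h.elim id (by simp)
  | refl a => rfl
  | symm a b _ ih => exact ih.symm
  | trans a b c _ _ ih ih' => exact ih.trans ih'

/-- A connection that uses the edge `xy` can be shortened so as to use it at most once, in one of
the two directions. -/
theorem Conn.of_cons {x y u v : Fin n} (h : Conn comp ((x, y) :: H) u v) :
    Conn comp H u v ∨ (Conn comp H u x ∧ Conn comp H y v) ∨
      (Conn comp H u y ∧ Conn comp H x v) := by
  induction h with
  | rel a b h =>
    rcases h with h | h
    · exact Or.inl (.of_comp h)
    · rcases List.mem_cons.1 h with h | h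
      · cases h; exact Or.inr (Or.inl ⟨.refl _, .refl _⟩)
      · exact Or.inl (.of_mem h)
  | refl a => exact Or.inl (.refl a)
  | symm a b _ ih =>
    rcases ih with h | ⟨h, h'⟩ | ⟨h, h'⟩
    exacts [Or.inl h.symm, Or.inr (Or.inr ⟨h'.symm, h.symm⟩), Or.inr (Or.inl ⟨h'.symm, h.symm⟩)]
  | trans a b c _ _ ih ih' =>
    rcases ih with h | ⟨h, h'⟩ | ⟨h, h'⟩ <;> rcases ih' with k | ⟨k, k'⟩ | ⟨k, k'⟩
    · exact Or.inl (h.trans k)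
    · exact Or.inr (Or.inl ⟨h.trans k, k'⟩)
    · exact Or.inr (Or.inr ⟨h.trans k, k'⟩)
    · exact Or.inr (Or.inl ⟨h, h'.trans k⟩)
    · exact Or.inr (Or.inl ⟨h, k'⟩)
    · exact Or.inl (h.trans k')
    · exact Or.inr (Or.inr ⟨h, h'.trans k⟩)
    · exact Or.inl (h.trans k')
    · exact Or.inr (Or.inr ⟨h, k'⟩)

/-- Exchange: if two labels `comp a ≠ comp b` are merged although `a` and `b` are connected, then
an edge of `H` that joins different labels becomes superfluous. -/
theorem Conn.exchange {a b : Fin n} (w : Fin n × Fin n → ℝ) (hne : comp a ≠ comp b)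
    {comp' : Fin n → ℕ} (hcomp : ∀ u v, comp u = comp v → comp' u = comp' v)
    (hab' : comp' a = comp' b) :
    ∀ {H : List (Fin n × Fin n)}, Conn comp H a b →
      ∃ e ∈ H, ∃ H' : List (Fin n × Fin n), comp e.1 ≠ comp e.2 ∧ H' ⊆ H ∧
        (H.map w).sum = w e + (H'.map w).sum ∧ ∀ u v, Conn comp H u v → Conn comp' H' u v
  | [], h => absurd h.nil hne
  | (x, y) :: H, h => by
    -- If `a` and `b` are connected without the first edge, that edge is kept and a superfluous one
    -- is found further down the list. Otherwise the first edge itself is given up: its ends remain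
    -- connected through `a` and `b`, which now share a label.
    by_cases hc : Conn comp H a b
    · obtain ⟨e, he, H', h1, h2, h3, h4⟩ := Conn.exchange w hne hcomp hab' hc
      refine ⟨e, List.mem_cons_of_mem _ he, (x, y) :: H', h1, List.cons_subset_cons _ h2, ?_, ?_⟩
      · simp only [List.map_cons, List.sum_cons, h3]; ring
      · refine fun u v h => h.le (fun u v h => .of_comp (hcomp u v h)) fun u v h => ?_
        rcases List.mem_cons.1 h with h | h
        · exact .of_mem (h ▸ List.mem_cons_self)
        · exact (h4 u v (.of_mem h)).mono (fun _ _ => id) (List.subset_cons_self _ _)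
    · have hxy : Conn comp H a x ∧ Conn comp H y b ∨ Conn comp H a y ∧ Conn comp H x b :=
        h.of_cons.resolve_left hc
      have hmono : ∀ u v, Conn comp H u v → Conn comp' H u v :=
        fun u v h => h.mono hcomp (List.Subset.refl _)
      have hab : Conn comp' H a b := .of_comp hab'
      refine ⟨(x, y), List.mem_cons_self, H, fun he => hc ?_, List.subset_cons_self _ _, rfl, ?_⟩
      · have he' : Conn comp H x y := .of_comp he
        rcases hxy with ⟨h1, h2⟩ | ⟨h1, h2⟩
        exacts [(h1.trans he').trans h2, (h1.trans he'.symm).trans h2]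
      · refine fun u v h => h.le (fun u v h => .of_comp (hcomp u v h)) fun u v h => ?_
        rcases List.mem_cons.1 h with h | h
        · cases h
          rcases hxy with ⟨h1, h2⟩ | ⟨h1, h2⟩
          · exact ((hmono _ _ h1).symm.trans hab).trans (hmono _ _ h2).symm
          · exact ((hmono _ _ h2).trans hab.symm).trans (hmono _ _ h1)
        · exact .of_mem h

end Conn

/-- Merge the label of `b` into that of `a`. -/
def mergeLabel (comp : Fin n → ℕ) (a b : Fin n) : Fin n → ℕ :=
  fun v => if comp v = comp b then comp a else comp v

/-- The states of a greedy forest construction that always adds a shortest edge between different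
components: `F` lists the edges and `comp` labels the components. -/
inductive Kruskal (R : Roadmap n) : List (Fin n × Fin n) → (Fin n → ℕ) → Prop
  | nil : Kruskal R [] fun v => v
  | cons {F : List (Fin n × Fin n)} {comp : Fin n → ℕ} {a b : Fin n} :
      Kruskal R F comp → R.graph.Adj a b → comp a ≠ comp b →
      (∀ u v, R.graph.Adj u v → comp u ≠ comp v → R.len a b ≤ R.len u v) →
      Kruskal R ((a, b) :: F) (mergeLabel comp a b)

theorem mergeLabel_eq_of_eq {comp : Fin n → ℕ} (a b : Fin n) {u v : Fin n} (h : comp u = comp v) :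
    mergeLabel comp a b u = mergeLabel comp a b v := by simp [mergeLabel, h]

theorem mergeLabel_left_eq_right (comp : Fin n → ℕ) (a b : Fin n) :
    mergeLabel comp a b a = mergeLabel comp a b b := by simp [mergeLabel]

/-- A label is always a vertex of the component that it names. The program can therefore meet every
component exactly once by looking for the `r` with `comp r = r`. -/
theorem Kruskal.exists_root {R : Roadmap n} {F : List (Fin n × Fin n)} {comp : Fin n → ℕ}
    (h : Kruskal R F comp) (v : Fin n) : ∃ r : Fin n, comp v = r ∧ comp r = r := by
  induction h generalizing v with
  | nil => exact ⟨v, rfl, rfl⟩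
  | @cons F comp a b _ _ hne _ ih =>
    by_cases hv : comp v = comp b
    · obtain ⟨r, h1, h2⟩ := ih a
      exact ⟨r, by simp [mergeLabel, hv, h1], by simp [mergeLabel, h2, h1]⟩
    · obtain ⟨r, h1, h2⟩ := ih v
      refine ⟨r, by rw [mergeLabel, if_neg hv, h1], ?_⟩
      rw [mergeLabel, if_neg (by rw [h2, ← h1]; exact hv), h2]

/-- Every merge makes the label of `b` disappear. -/
theorem Kruskal.card_add_length {R : Roadmap n} {F : List (Fin n × Fin n)} {comp : Fin n → ℕ}
    (h : Kruskal R F comp) : (Finset.univ.image comp).card + F.length ≤ n := by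
  induction h with
  | nil => simpa using Finset.card_image_le (s := Finset.univ) (f := fun v : Fin n => (v : ℕ))
  | @cons F comp a b _ _ hne _ ih =>
    have hsub : Finset.univ.image (mergeLabel comp a b) ⊆
        (Finset.univ.image comp).erase (comp b) := by
      intro c hc
      obtain ⟨v, -, rfl⟩ := Finset.mem_image.1 hc
      simp only [mergeLabel]
      split_ifs with hv <;> simp [*]
    have h1 := Finset.card_le_card hsub
    rw [Finset.card_erase_of_mem (by simp)] at h1
    have h2 : 0 < (Finset.univ.image comp).card :=
      Finset.card_pos.2 ⟨comp a, by simp⟩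
    rw [List.length_cons]; omega

theorem Kruskal.length_lt {R : Roadmap n} {F : List (Fin n × Fin n)} {comp : Fin n → ℕ}
    (h : Kruskal R F comp) (hn : 0 < n) : F.length < n := by
  have h1 := h.card_add_length
  have h2 : 0 < (Finset.univ.image comp).card :=
    Finset.card_pos.2 ⟨comp ⟨0, hn⟩, by simp⟩
  omega

/-! ### Charging the forest to a path cover -/

/-- The edges of a path. -/
theorem exists_edges_of_path {R : Roadmap n} (comp : Fin n → ℕ) :
    ∀ {u : Fin n} {l : List (Fin n)}, (u :: l).IsChain R.graph.Adj →
      ∃ H : List (Fin n × Fin n), (∀ e ∈ H, R.graph.Adj e.1 e.2) ∧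
        (H.map fun e => R.len e.1 e.2).sum = pathCost R (u :: l) ∧ ∀ v ∈ u :: l, Conn comp H v u
  | u, [], _ => ⟨[], by simp, rfl, by rintro v hv; rw [List.mem_singleton.1 hv]; exact .refl _⟩
  | u, x :: l, h => by
    have h' := List.isChain_cons_cons.1 h
    obtain ⟨H, h1, h2, h3⟩ := exists_edges_of_path comp h'.2
    refine ⟨(u, x) :: H, ?_, ?_, fun v hv => ?_⟩
    · simpa [h'.1] using fun a b => h1 (a, b)
    · simp [pathCost, h2]
    · rcases List.mem_cons.1 hv with rfl | hv
      · exact .refl _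
      · exact ((h3 v hv).mono (fun _ _ => id) (List.subset_cons_self _ _)).trans
          (Conn.of_mem List.mem_cons_self).symm

/-- The initial value of the potential: all edges of the paths, and the first vertex of each path as
its representative. -/
theorem exists_edges_of_paths {R : Roadmap n} (comp : Fin n → ℕ) {p : Fin m → List (Fin n)}
    (hp : ∀ i, IsPath R (p i)) {c : ℝ} (hc : ∀ i, pathCost R (p i) ≤ c) (I : Finset (Fin m)) :
    ∃ (H : List (Fin n × Fin n)) (reps : Finset (Fin n)), (∀ e ∈ H, R.graph.Adj e.1 e.2) ∧
      (H.map fun e => R.len e.1 e.2).sum ≤ I.card * c ∧ reps.card ≤ I.card ∧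
      ∀ i ∈ I, ∀ v ∈ p i, ∃ r ∈ reps, Conn comp H v r := by
  classical
  induction I using Finset.induction_on with
  | empty => exact ⟨[], ∅, by simp, by simp, by simp, by simp⟩
  | insert i I hi ih =>
    obtain ⟨H, reps, h1, h2, h3, h4⟩ := ih
    obtain ⟨u, l, hul⟩ := List.exists_cons_of_ne_nil (hp i).1
    obtain ⟨H', k1, k2, k3⟩ := exists_edges_of_path comp (hul ▸ (hp i).2)
    refine ⟨H' ++ H, insert u reps, ?_, ?_, ?_, ?_⟩
    · intro e he
      exact (List.mem_append.1 he).elim (k1 e) (h1 e)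
    · rw [List.map_append, List.sum_append, k2, ← hul, Finset.card_insert_of_notMem hi]
      push_cast; linarith [hc i]
    · rw [Finset.card_insert_of_notMem hi]
      exact (Finset.card_insert_le _ _).trans (by omega)
    · intro j hj v hv
      rcases Finset.mem_insert.1 hj with rfl | hj
      · exact ⟨u, by simp, (k3 v (hul ▸ hv)).mono (fun _ _ => id) (List.subset_append_left _ _)⟩
      · obtain ⟨r, hr, h⟩ := h4 j hj v hv
        exact ⟨r, by simp [hr], h.mono (fun _ _ => id) (List.subset_append_right _ _)⟩

/-- No edge of a path is longer than the whole path, so a path of cost at most `c` cannot cross the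
boundary of `S`. -/
theorem IsPath.forall_mem_iff {R : Roadmap n} {c : ℝ} {S : Fin n → Prop}
    (hS : ∀ u v, R.graph.Adj u v → R.len u v ≤ c → (S u ↔ S v)) :
    ∀ {u : Fin n} {l : List (Fin n)}, (u :: l).IsChain R.graph.Adj → pathCost R (u :: l) ≤ c →
      ∀ v ∈ u :: l, (S v ↔ S u)
  | u, [], _, _, v, hv => by rw [List.mem_singleton.1 hv]
  | u, x :: l, h, hc, v, hv => by
    have h' := List.isChain_cons_cons.1 h
    rw [pathCost] at hc
    rcases List.mem_cons.1 hv with rfl | hv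
    · rfl
    · rw [IsPath.forall_mem_iff hS h'.2 (by linarith [R.len_pos _ _ h'.1]) v hv]
      exact (hS u x h'.1 (by linarith [pathCost_nonneg R h'.2])).symm

open Classical in
/-- The total length of the edges of `F` that start in `S`. -/
noncomputable def weightIn (R : Roadmap n) (S : Fin n → Prop) (F : List (Fin n × Fin n)) : ℝ :=
  (F.map fun e => if S e.1 then R.len e.1 e.2 else 0).sum

theorem weightIn_cons (R : Roadmap n) (S : Fin n → Prop) (a b : Fin n) [Decidable (S a)]
    (F : List (Fin n × Fin n)) :
    weightIn R S ((a, b) :: F) = (if S a then R.len a b else 0) + weightIn R S F := by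
  unfold weightIn
  rw [List.map_cons, List.sum_cons]
  congr

theorem sum_len_nonneg {R : Roadmap n} {H : List (Fin n × Fin n)}
    (h : ∀ e ∈ H, R.graph.Adj e.1 e.2) : 0 ≤ (H.map fun e => R.len e.1 e.2).sum := by
  refine List.sum_nonneg fun x hx => ?_
  obtain ⟨e, he, rfl⟩ := List.mem_map.1 hx
  exact (R.len_pos _ _ (h e he)).le

open Classical in
/-- The potential argument: the forest inside a set `S` that no short edge leaves, together with
the superfluous edges of a path cover and the number of parts that are still to be joined. -/
theorem Kruskal.exists_potential {R : Roadmap n} {F : List (Fin n × Fin n)} {comp : Fin n → ℕ}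
    (h : Kruskal R F comp) {c : ℝ} (hF : ∀ e ∈ F, R.len e.1 e.2 ≤ c)
    {p : Fin m → List (Fin n)} (hp : IsPathCover R p) (hc : ∀ i, pathCost R (p i) ≤ c)
    {S : Fin n → Prop} (hS : ∀ u v, R.graph.Adj u v → R.len u v ≤ c → (S u ↔ S v))
    {I : Finset (Fin m)} (hI : ∀ i, ∀ v ∈ p i, S v → i ∈ I) :
    ∃ (H : List (Fin n × Fin n)) (reps : Finset (Fin n)), (∀ e ∈ H, R.graph.Adj e.1 e.2) ∧
      (∀ v, S v → ∃ r ∈ reps, Conn comp H v r) ∧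
      weightIn R S F + (H.map fun e => R.len e.1 e.2).sum + reps.card * c ≤ 2 * I.card * c := by
  induction h with
  | nil =>
    obtain ⟨H, reps, h1, h2, h3, h4⟩ := exists_edges_of_paths (fun v : Fin n => (v : ℕ)) hp.1 hc I
    refine ⟨H, reps, h1, fun v hv => ?_, ?_⟩
    · obtain ⟨i, hi⟩ := hp.2 v
      exact h4 i (hI i v hi hv) v hi
    · rcases I.eq_empty_or_nonempty with rfl | ⟨i, hi⟩
      · have h3' : reps.card = 0 := by simpa using h3
        simp only [Finset.card_empty, Nat.cast_zero, zero_mul] at h2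
        simp [weightIn, h3', h2]
      · have hc0 : 0 ≤ c := (pathCost_nonneg R (hp.1 i).2).trans (hc i)
        have : (reps.card : ℝ) * c ≤ I.card * c := by gcongr
        simp only [weightIn, List.map_nil, List.sum_nil]
        linarith
  | @cons F comp a b _ hadj hne hmin ih =>
    obtain ⟨H, reps, h1, h2, h3⟩ := ih fun e he => hF e (List.mem_cons_of_mem _ he)
    have hlen : R.len a b ≤ c := hF (a, b) List.mem_cons_self
    have hmono : ∀ u v, Conn comp H u v → Conn (mergeLabel comp a b) H u v := fun u v h =>
      h.mono (fun _ _ => mergeLabel_eq_of_eq a b) (List.Subset.refl _)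
    rw [weightIn_cons]
    by_cases ha : S a
    · rw [if_pos ha]
      by_cases hab : Conn comp H a b
      -- The new edge closes a cycle with `H`, so some edge `e` of `H` between different components
      -- can be dropped. The greedy choice makes `e` at least as long as `ab`, and the potential
      -- does not grow.
      · obtain ⟨e, he, H', k1, k2, k3, k4⟩ := Conn.exchange (fun e => R.len e.1 e.2) hne
          (fun _ _ => mergeLabel_eq_of_eq a b) (mergeLabel_left_eq_right comp a b) hab
        refine ⟨H', reps, fun e he => h1 e (k2 he), fun v hv => ?_, ?_⟩
        · obtain ⟨r, hr, h⟩ := h2 v hv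
          exact ⟨r, hr, k4 _ _ h⟩
        · have := hmin e.1 e.2 (h1 e he) k1
          rw [k3] at h3
          linarith
      -- The new edge joins two parts with different representatives. One representative is dropped,
      -- which frees `c` and pays for the edge.
      · obtain ⟨r, hr, har⟩ := h2 a ha
        obtain ⟨r', hr', hbr⟩ := h2 b ((hS a b hadj hlen).1 ha)
        have hrr : r ≠ r' := by rintro rfl; exact hab (har.trans hbr.symm)
        refine ⟨H, reps.erase r', h1, fun v hv => ?_, ?_⟩
        · obtain ⟨x, hx, h⟩ := h2 v hv
          by_cases hxr : x = r'
          · subst hxr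
            refine ⟨r, Finset.mem_erase.2 ⟨hrr, hr⟩, ?_⟩
            exact ((hmono _ _ (h.trans hbr.symm)).trans
              (Conn.of_comp (mergeLabel_left_eq_right comp a b)).symm).trans (hmono _ _ har)
          · exact ⟨x, Finset.mem_erase.2 ⟨hxr, hx⟩, hmono _ _ h⟩
        · have : ((reps.erase r').card : ℝ) + 1 = reps.card := by
            exact_mod_cast Finset.card_erase_add_one hr'
          rw [← this] at h3
          linarith
    · rw [if_neg ha, zero_add]
      exact ⟨H, reps, h1, fun v hv => (h2 v hv).imp fun r h => ⟨h.1, hmono _ _ h.2⟩, h3⟩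

/-- When all remaining edges between components are longer than the cost of a path cover, the
weight of a component is less than twice that of the paths in it. -/
theorem Kruskal.weightIn_le {R : Roadmap n} {F : List (Fin n × Fin n)} {comp : Fin n → ℕ}
    (h : Kruskal R F comp) {c : ℝ} (hF : ∀ e ∈ F, R.len e.1 e.2 ≤ c)
    (hcross : ∀ u v, R.graph.Adj u v → comp u ≠ comp v → c < R.len u v)
    {p : Fin m → List (Fin n)} (hp : IsPathCover R p) (hc : ∀ i, pathCost R (p i) ≤ c)
    (r : Fin n) {I : Finset (Fin m)} (hI : ∀ i, ∀ v ∈ p i, comp v = comp r → i ∈ I) :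
    weightIn R (fun v => comp v = comp r) F + c ≤ 2 * I.card * c := by
  have hS : ∀ u v, R.graph.Adj u v → R.len u v ≤ c → (comp u = comp r ↔ comp v = comp r) := by
    intro u v huv hle
    by_cases he : comp u = comp v
    · rw [he]
    · exact absurd (hcross u v huv he) (not_lt.2 hle)
  obtain ⟨H, reps, h1, h2, h3⟩ := h.exists_potential hF hp hc hS hI
  -- One representative must always be left. It accounts for the extra `c` on the left, which later
  -- makes the count of segments strict.
  obtain ⟨x, hx, -⟩ := h2 r rfl
  obtain ⟨i, hi⟩ := hp.2 r
  have hc0 : 0 ≤ c := (pathCost_nonneg R (hp.1 i).2).trans (hc i)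
  have h4 : (1 : ℝ) ≤ reps.card := by exact_mod_cast Finset.card_pos.2 ⟨x, hx⟩
  have h5 := sum_len_nonneg h1
  nlinarith

/-! ### Weights of components under a merge -/

theorem weightIn_congr (R : Roadmap n) {S S' : Fin n → Prop} {F : List (Fin n × Fin n)}
    (h : ∀ e ∈ F, S e.1 ↔ S' e.1) : weightIn R S F = weightIn R S' F := by
  unfold weightIn
  congr 1
  exact List.map_congr_left fun e he => by rw [show S e.1 = S' e.1 from propext (h e he)]

theorem weightIn_or (R : Roadmap n) {S S' : Fin n → Prop} (F : List (Fin n × Fin n))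
    (h : ∀ v, S v → ¬ S' v) :
    weightIn R (fun v => S v ∨ S' v) F = weightIn R S F + weightIn R S' F := by
  unfold weightIn
  induction F with
  | nil => simp
  | cons e F ih =>
    simp only [List.map_cons, List.sum_cons, ih]
    have := h e.1
    by_cases h1 : S e.1 <;> by_cases h2 : S' e.1 <;> simp_all <;> ring

/-- The weight of the components after a merge. -/
theorem weightIn_mergeLabel (R : Roadmap n) {comp : Fin n → ℕ} {a b : Fin n}
    (hne : comp a ≠ comp b) (F : List (Fin n × Fin n)) (v : Fin n) :
    weightIn R (fun u => mergeLabel comp a b u = mergeLabel comp a b v) ((a, b) :: F) =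
      if comp v = comp a ∨ comp v = comp b then
        weightIn R (fun u => comp u = comp a) F + weightIn R (fun u => comp u = comp b) F +
          R.len a b
      else weightIn R (fun u => comp u = comp v) F := by
  classical
  rw [weightIn_cons]
  split_ifs with h1 h2 h2
  · rw [← weightIn_or R F (by rintro u h h'; exact hne (h.symm.trans h'))]
    rw [add_comm]
    congr 1
    refine weightIn_congr R fun e _ => ?_
    rcases h2 with h2 | h2 <;> by_cases h3 : comp e.1 = comp b <;>
      simp [mergeLabel, h2, h3, hne, hne.symm]
  · exfalso
    simp only [mergeLabel, if_neg hne] at h1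
    split_ifs at h1 with h3
    · exact h2 (Or.inr h3)
    · exact h2 (Or.inl h1.symm)
  · exfalso
    rcases h2 with h2 | h2 <;> simp [mergeLabel, h2, hne] at h1
  · push Not at h2
    rw [zero_add]
    refine weightIn_congr R fun e _ => ?_
    by_cases h3 : comp e.1 = comp b
    · simp [mergeLabel, h2.2, h3, h2.1.symm, h2.2.symm]
    · simp [mergeLabel, h2.2, h3]

end Patrol

namespace Patrol

/-! ### Reasoning about programs -/

/-- A bound for the running time of a program in which every loop is run through at most `X`
times. -/
noncomputable def Prog.costPoly : Prog → Polynomial ℕ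
  | skip => 1
  | seti _ i j e => (i.cost + j.cost + e.cost + 1 : ℕ)
  | setd _ i j e => (i.cost + j.cost + e.cost + 1 : ℕ)
  | seq P Q => P.costPoly + Q.costPoly
  | ite b P Q => (b.cost : Polynomial ℕ) + (P.costPoly + Q.costPoly)
  | loop b P => (Polynomial.X + 1) * ((b.cost : Polynomial ℕ) + P.costPoly)

/-- The natural number arrays that a program may change. -/
def Prog.iwrites : Prog → List ℕ
  | skip => []
  | seti a _ _ _ => [a]
  | setd _ _ _ _ => []
  | seq P Q => P.iwrites ++ Q.iwrites
  | ite _ P Q => P.iwrites ++ Q.iwrites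
  | loop _ P => P.iwrites

/-- The real arrays that a program may change. -/
def Prog.dwrites : Prog → List ℕ
  | skip => []
  | seti _ _ _ _ => []
  | setd a _ _ _ => [a]
  | seq P Q => P.dwrites ++ Q.dwrites
  | ite _ P Q => P.dwrites ++ Q.dwrites
  | loop _ P => P.dwrites

theorem Exec.idx_eq {P : Prog} {s s' : Store} {c : ℕ} (h : Exec P s s' c) {a : ℕ}
    (ha : a ∉ P.iwrites) : s'.idx a = s.idx a := by
  induction h with
  | skip s => rfl
  | seti b i j e s =>
    have : a ≠ b := by simpa [Prog.iwrites] using ha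
    funext i' j'; simp [setCell, this]
  | setd b i j e s => rfl
  | seq _ _ ih ih' =>
    simp only [Prog.iwrites, List.mem_append, not_or] at ha
    rw [ih' ha.2, ih ha.1]
  | ite_true _ _ ih =>
    simp only [Prog.iwrites, List.mem_append, not_or] at ha
    exact ih ha.1
  | ite_false _ _ ih =>
    simp only [Prog.iwrites, List.mem_append, not_or] at ha
    exact ih ha.2
  | loop_done _ => rfl
  | loop_step _ _ _ ih ih' => rw [ih' ha, ih ha]

theorem Exec.dat_eq {P : Prog} {s s' : Store} {c : ℕ} (h : Exec P s s' c) {a : ℕ}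
    (ha : a ∉ P.dwrites) : s'.dat a = s.dat a := by
  induction h with
  | skip s => rfl
  | seti b i j e s => rfl
  | setd b i j e s =>
    have : a ≠ b := by simpa [Prog.dwrites] using ha
    funext i' j'; simp [setCell, this]
  | seq _ _ ih ih' =>
    simp only [Prog.dwrites, List.mem_append, not_or] at ha
    rw [ih' ha.2, ih ha.1]
  | ite_true _ _ ih =>
    simp only [Prog.dwrites, List.mem_append, not_or] at ha
    exact ih ha.1
  | ite_false _ _ ih =>
    simp only [Prog.dwrites, List.mem_append, not_or] at ha
    exact ih ha.2
  | loop_done _ => rfl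
  | loop_step _ _ _ ih ih' => rw [ih' ha, ih ha]

/-- Started in `s`, the program `P` halts in a state that satisfies `Q`, within the time that is
due if every loop is run through at most `N` times. -/
def Runs (N : ℕ) (P : Prog) (s : Store) (Q : Store → Prop) : Prop :=
  ∃ s' c, Exec P s s' c ∧ c ≤ P.costPoly.eval N ∧ Q s'

def Store.seti (s : Store) (a i j x : ℕ) : Store := ⟨setCell s.idx a i j x, s.dat⟩

def Store.setd (s : Store) (a i j : ℕ) (x : ℝ) : Store := ⟨s.idx, setCell s.dat a i j x⟩

section Store

variable (s : Store)

@[simp] theorem Store.dat_seti (a i j x : ℕ) : (s.seti a i j x).dat = s.dat := rfl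

@[simp] theorem Store.idx_setd (a i j : ℕ) (x : ℝ) : (s.setd a i j x).idx = s.idx := rfl

theorem Store.idx_seti_of_ne {a b : ℕ} (h : b ≠ a) (i j x : ℕ) :
    (s.seti a i j x).idx b = s.idx b := by
  funext i' j'; simp [seti, setCell, h]

theorem Store.dat_setd_of_ne {a b : ℕ} (h : b ≠ a) (i j : ℕ) (x : ℝ) :
    (s.setd a i j x).dat b = s.dat b := by
  funext i' j'; simp [setd, setCell, h]

theorem Store.idx_seti_self (a i j x i' j' : ℕ) :
    (s.seti a i j x).idx a i' j' = if i' = i ∧ j' = j then x else s.idx a i' j' := by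
  simp [seti, setCell]

theorem Store.dat_setd_self (a i j : ℕ) (x : ℝ) (i' j' : ℕ) :
    (s.setd a i j x).dat a i' j' = if i' = i ∧ j' = j then x else s.dat a i' j' := by
  simp [setd, setCell]

@[simp] theorem Store.idx_seti_cell (a i j x : ℕ) : (s.seti a i j x).idx a i j = x := by
  simp [idx_seti_self]

@[simp] theorem Store.dat_setd_cell (a i j : ℕ) (x : ℝ) : (s.setd a i j x).dat a i j = x := by
  simp [dat_setd_self]

theorem Store.idx_seti_row (a i j x : ℕ) :
    (s.seti a i j x).idx a i = Function.update (s.idx a i) j x := by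
  funext j'
  rw [idx_seti_self, Function.update_apply]
  simp

end Store

section Runs

variable {N : ℕ} {P P' : Prog} {s : Store} {Q Q' : Store → Prop}

theorem Runs.mono (h : Runs N P s Q) (hQ : ∀ s', Q s' → Q' s') : Runs N P s Q' :=
  let ⟨s', c, h1, h2, h3⟩ := h; ⟨s', c, h1, h2, hQ s' h3⟩

/-- Arrays that the program does not mention on a left hand side keep their contents. -/
theorem Runs.frame (h : Runs N P s Q) :
    Runs N P s fun s' => Q s' ∧ (∀ a, a ∉ P.iwrites → s'.idx a = s.idx a) ∧
      ∀ a, a ∉ P.dwrites → s'.dat a = s.dat a :=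
  let ⟨s', c, h1, h2, h3⟩ := h
  ⟨s', c, h1, h2, h3, fun _ ha => h1.idx_eq ha, fun _ ha => h1.dat_eq ha⟩

theorem Runs.skip (h : Q s) : Runs N .skip s Q :=
  ⟨s, 1, .skip s, by simp [Prog.costPoly], h⟩

theorem Runs.seti {a : ℕ} {i j e : IExp} (h : Q (s.seti a (i.eval s) (j.eval s) (e.eval s))) :
    Runs N (.seti a i j e) s Q :=
  ⟨_, _, .seti a i j e s, by simp only [Prog.costPoly, Polynomial.eval_natCast]; rfl, h⟩

theorem Runs.setd {a : ℕ} {i j : IExp} {e : DExp}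
    (h : Q (s.setd a (i.eval s) (j.eval s) (e.eval s))) : Runs N (.setd a i j e) s Q :=
  ⟨_, _, .setd a i j e s, by simp only [Prog.costPoly, Polynomial.eval_natCast]; rfl, h⟩

theorem Runs.seq (h : Runs N P s fun s' => Runs N P' s' Q) : Runs N (.seq P P') s Q := by
  obtain ⟨s', c, h1, h2, s'', d, h3, h4, h5⟩ := h
  exact ⟨s'', c + d, .seq h1 h3, by simp only [Prog.costPoly, Polynomial.eval_add]; omega, h5⟩

theorem Runs.ite {b : Test} (h1 : b.holds s → Runs N P s Q) (h2 : ¬ b.holds s → Runs N P' s Q) :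
    Runs N (.ite b P P') s Q := by
  by_cases hb : b.holds s
  · obtain ⟨s', c, k1, k2, k3⟩ := h1 hb
    refine ⟨s', _, .ite_true hb k1, ?_, k3⟩
    simp only [Prog.costPoly, Polynomial.eval_add, Polynomial.eval_natCast, Nat.cast_id]; omega
  · obtain ⟨s', c, k1, k2, k3⟩ := h2 hb
    refine ⟨s', _, .ite_false hb k1, ?_, k3⟩
    simp only [Prog.costPoly, Polynomial.eval_add, Polynomial.eval_natCast, Nat.cast_id]; omega

/-- The rule for loops; `k` bounds the number of remaining iterations. -/
theorem Runs.loop {b : Test} (I : ℕ → Store → Prop) {k : ℕ} (hk : k ≤ N) (h0 : I k s)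
    (hstep : ∀ k s, I k s → b.holds s → 0 < k ∧ Runs N P s (I (k - 1)))
    (hdone : ∀ k s, I k s → ¬ b.holds s → Q s) : Runs N (.loop b P) s Q := by
  suffices H : ∀ k s, I k s → ∃ s' c, Exec (.loop b P) s s' c ∧
      c ≤ k * (b.cost + P.costPoly.eval N) + b.cost ∧ Q s' by
    obtain ⟨s', c, h1, h2, h3⟩ := H k s h0
    refine ⟨s', c, h1, h2.trans ?_, h3⟩
    simp only [Prog.costPoly, Polynomial.eval_mul, Polynomial.eval_add, Polynomial.eval_X,
      Polynomial.eval_one, Polynomial.eval_natCast, Nat.cast_id]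
    have : k * (b.cost + P.costPoly.eval N) ≤ N * (b.cost + P.costPoly.eval N) :=
      Nat.mul_le_mul_right _ hk
    rw [add_mul, one_mul]
    omega
  intro k
  induction k with
  | zero =>
    intro s hs
    have hb : ¬ b.holds s := fun hb => absurd (hstep 0 s hs hb).1 (lt_irrefl 0)
    exact ⟨s, b.cost, .loop_done hb, by omega, hdone 0 s hs hb⟩
  | succ k ih =>
    intro s hs
    by_cases hb : b.holds s
    · obtain ⟨-, s', c, h1, h2, h3⟩ := hstep _ s hs hb
      obtain ⟨s'', d, h4, h5, h6⟩ := ih s' h3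
      refine ⟨s'', _, .loop_step hb h1 h4, ?_, h6⟩
      rw [add_mul, one_mul]; omega
    · exact ⟨s, b.cost, .loop_done hb, by omega, hdone _ s hs hb⟩

/-! ### Derived commands -/

/-- The scalar variable that is kept in the first cell of the array `a`. -/
def reg (a : ℕ) : IExp := .get a (.lit 0) (.lit 0)

/-- The entry `e` of the first row of the array `a`. -/
def entry (a : ℕ) (e : IExp) : IExp := .get a (.lit 0) e

def dreg (a : ℕ) : DExp := .get a (.lit 0) (.lit 0)

def setReg (a : ℕ) (e : IExp) : Prog := .seti a (.lit 0) (.lit 0) e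

def setEntry (a : ℕ) (i e : IExp) : Prog := .seti a (.lit 0) i e

def setDReg (a : ℕ) (e : DExp) : Prog := .setd a (.lit 0) (.lit 0) e

def Test.eq (e f : IExp) : Test := .conj (.neg (.ilt e f)) (.neg (.ilt f e))

def Test.or (b c : Test) : Test := .neg (.conj (.neg b) (.neg c))

def block : List Prog → Prog
  | [] => .skip
  | P :: Ps => .seq P (block Ps)

/-- `for v = 0, 1, …, e - 1 do P` -/
def forUpTo (v : ℕ) (e : IExp) (P : Prog) : Prog :=
  .seq (setReg v (.lit 0))
    (.loop (.ilt (reg v) e) (.seq P (setReg v (.add (reg v) (.lit 1)))))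

@[simp] theorem reg_eval (a : ℕ) : (reg a).eval s = s.idx a 0 0 := rfl

@[simp] theorem entry_eval (a : ℕ) (e : IExp) : (entry a e).eval s = s.idx a 0 (e.eval s) := rfl

@[simp] theorem dreg_eval (a : ℕ) : (dreg a).eval s = s.dat a 0 0 := rfl

@[simp] theorem Test.eq_holds (e f : IExp) : (Test.eq e f).holds s ↔ e.eval s = f.eval s := by
  simp only [Test.eq, holds]; omega

@[simp] theorem Test.or_holds (b c : Test) : (Test.or b c).holds s ↔ b.holds s ∨ c.holds s := by
  simp only [Test.or, holds]; tauto

theorem Runs.setReg {a : ℕ} {e : IExp} (h : Q (s.seti a 0 0 (e.eval s))) :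
    Runs N (setReg a e) s Q := Runs.seti h

theorem Runs.setEntry {a : ℕ} {i e : IExp} (h : Q (s.seti a 0 (i.eval s) (e.eval s))) :
    Runs N (setEntry a i e) s Q := Runs.seti h

theorem Runs.setDReg {a : ℕ} {e : DExp} (h : Q (s.setd a 0 0 (e.eval s))) :
    Runs N (setDReg a e) s Q := Runs.setd h

theorem Runs.block_nil (h : Q s) : Runs N (block []) s Q := Runs.skip h

theorem Runs.block_cons {Ps : List Prog} (h : Runs N P s fun s' => Runs N (block Ps) s' Q) :
    Runs N (block (P :: Ps)) s Q := Runs.seq h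

/-- The rule for counting loops; the invariant must not speak of the counter. -/
theorem Runs.forUpTo {v : ℕ} {e : IExp} (I : ℕ → Store → Prop) {K : ℕ} (hK : K ≤ N)
    (hv : v ∉ P.iwrites) (h0 : I 0 s) (hI : ∀ i s x, I i s → I i (s.seti v 0 0 x))
    (he : ∀ i s, I i s → e.eval s = K)
    (hstep : ∀ i s, i < K → s.idx v 0 0 = i → I i s → Runs N P s (I (i + 1)))
    (hdone : ∀ s, I K s → Q s) : Runs N (forUpTo v e P) s Q := by
  -- Here `k` iterations remain when the counter stands at `K - k`.
  refine Runs.seq (Runs.setReg (Runs.loop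
    (fun k s => ∃ i, i + k = K ∧ s.idx v 0 0 = i ∧ I i s) (k := K) hK
    ⟨0, by simp, by simp [IExp.eval], hI _ _ _ h0⟩ ?_ ?_))
  · rintro k s ⟨i, hik, hsi, hIs⟩ hb
    simp only [Test.holds, reg_eval, hsi, he _ _ hIs] at hb
    refine ⟨by omega, Runs.seq ((hstep i s hb hsi hIs).frame.mono ?_)⟩
    rintro s' ⟨h1, h2, -⟩
    refine Runs.setReg ⟨i + 1, by omega, ?_, hI _ _ _ h1⟩
    simp [IExp.eval, h2 v hv, hsi]
  · rintro k s ⟨i, hik, hsi, hIs⟩ hb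
    simp only [Test.holds, reg_eval, hsi, he _ _ hIs] at hb
    obtain rfl : i = K := by omega
    exact hdone s hIs

end Runs

end Patrol

namespace Patrol

variable {n m : ℕ}

/-! ### Closed tours around the trees of a forest

A tour is a cyclic linked list: `nxt` is the successor function on the nodes, and the node `x` is an
occurrence of the vertex `vert x`. -/

open Classical in
/-- The matrix of edge lengths. -/
noncomputable def lenN (R : Roadmap n) (i j : ℕ) : ℝ :=
  if h : i < n ∧ j < n then
    if R.graph.Adj ⟨i, h.1⟩ ⟨j, h.2⟩ then R.len ⟨i, h.1⟩ ⟨j, h.2⟩ else 0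
  else 0

theorem lenN_of_adj {R : Roadmap n} {a b : Fin n} (h : R.graph.Adj a b) :
    lenN R a b = R.len a b := by
  simp [lenN, h]

theorem lenN_self (R : Roadmap n) (i : ℕ) : lenN R i i = 0 := by
  simp [lenN]

theorem lenN_nonneg (R : Roadmap n) (i j : ℕ) : 0 ≤ lenN R i j := by
  unfold lenN
  split_ifs with h h'
  exacts [(R.len_pos _ _ h').le, le_rfl, le_rfl]

/-- Two occurrences of the same vertex or of adjacent ones. -/
def StepN (R : Roadmap n) (u v : ℕ) : Prop :=
  u = v ∨ ∃ a b : Fin n, u = a ∧ v = b ∧ R.graph.Adj a b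

/-- The length of a sequence of vertices with respect to the matrix `d`. -/
def walkSum (d : ℕ → ℕ → ℝ) : List ℕ → ℝ
  | [] => 0
  | [_] => 0
  | x :: y :: l => d x y + walkSum d (y :: l)

/-- The element at the cut belongs to both halves, so that no step is lost. -/
theorem walkSum_split (d : ℕ → ℕ → ℝ) (y : ℕ) (l' : List ℕ) :
    ∀ l : List ℕ, walkSum d (l ++ y :: l') = walkSum d (l ++ [y]) + walkSum d (y :: l')
  | [] => by simp [walkSum]
  | [x] => by simp [walkSum]
  | x :: x' :: l => by
    have := walkSum_split d y l' (x' :: l)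
    simp only [List.cons_append, walkSum] at this ⊢
    rw [this]; ring

theorem walkSum_nonneg {d : ℕ → ℕ → ℝ} (hd : ∀ i j, 0 ≤ d i j) : ∀ l, 0 ≤ walkSum d l
  | [] => le_rfl
  | [_] => le_rfl
  | _ :: y :: l => add_nonneg (hd _ _) (walkSum_nonneg hd (y :: l))

/-- The nodes `x :: l` form a closed tour around the component of `vert x`. -/
structure IsTour (R : Roadmap n) (F : List (Fin n × Fin n)) (comp nxt vert : ℕ → ℕ) (f x : ℕ)
    (l : List ℕ) : Prop where
  chain : (x :: l ++ [x]).IsChain fun a b => nxt a = b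
  nodup : (x :: l).Nodup
  lt : ∀ y ∈ x :: l, y < f
  comp_vert : ∀ y ∈ x :: l, comp (vert y) = comp (vert x)
  mem : ∀ w < n, comp w = comp (vert x) → w ∈ x :: l
  step : ((x :: l ++ [x]).map vert).IsChain (StepN R)
  cost : walkSum (lenN R) ((x :: l ++ [x]).map vert) =
    2 * weightIn R (fun u => comp u = comp (vert x)) F

/-- A closed tour consists of the arc from `x` to `y` and the arc from `y` to `x`. Starting at `y`
only exchanges the two arcs, and every condition splits along them. -/
theorem IsTour.rotate {R : Roadmap n} {F : List (Fin n × Fin n)} {comp nxt vert : ℕ → ℕ}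
    {f x y : ℕ} {l : List ℕ} (h : IsTour R F comp nxt vert f x l) (hy : y ∈ x :: l) :
    ∃ l', IsTour R F comp nxt vert f y l' := by
  rcases List.mem_cons.1 hy with rfl | hy'
  · exact ⟨l, h⟩
  obtain ⟨l₁, l₂, rfl⟩ := List.append_of_mem hy'
  have hmem : ∀ z, z ∈ y :: (l₂ ++ x :: l₁) ↔ z ∈ x :: (l₁ ++ y :: l₂) := fun z => by
    simp only [List.mem_cons, List.mem_append]; tauto
  have hxy := h.comp_vert y hy
  have e1 : x :: (l₁ ++ y :: l₂) ++ [x] = (x :: l₁) ++ y :: (l₂ ++ [x]) := by simp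
  have e2 : y :: (l₂ ++ x :: l₁) ++ [y] = (y :: l₂) ++ x :: (l₁ ++ [y]) := by simp
  refine ⟨l₂ ++ x :: l₁, ?_, ?_, ?_, ?_, ?_, ?_, ?_⟩
  · have := h.chain
    rw [e1, List.isChain_split] at this
    rw [e2, List.isChain_split]
    exact ⟨this.2, this.1⟩
  · have e : (y :: (l₂ ++ x :: l₁)).Perm (x :: (l₁ ++ y :: l₂)) := by
      have : ((y :: l₂) ++ (x :: l₁)).Perm ((x :: l₁) ++ (y :: l₂)) := List.perm_append_comm
      simpa using this
    exact e.nodup_iff.2 h.nodup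
  · exact fun z hz => h.lt z ((hmem z).1 hz)
  · exact fun z hz => (h.comp_vert z ((hmem z).1 hz)).trans hxy.symm
  · exact fun w hw hc => (hmem w).2 (h.mem w hw (hc.trans hxy))
  · have := h.step
    rw [e1, List.map_append, List.map_cons (a := y), List.isChain_split] at this
    rw [e2, List.map_append, List.map_cons (a := x), List.isChain_split]
    exact ⟨by simpa using this.2, by simpa using this.1⟩
  · have := h.cost
    rw [e1, List.map_append, List.map_cons (a := y), walkSum_split] at this
    rw [e2, List.map_append, List.map_cons (a := x), walkSum_split, hxy, ← this]
    simp only [List.map_cons, List.map_append, List.map_nil, List.cons_append]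
    ring

/-- The linked lists `nxt`, `vert` with `f` nodes hold closed tours around the components of the
forest `F`. -/
structure Tours (R : Roadmap n) (F : List (Fin n × Fin n)) (comp nxt vert : ℕ → ℕ) (f : ℕ) :
    Prop where
  kruskal : Kruskal R F fun v => comp v
  fresh : f = n + 2 * F.length
  vert_self : ∀ v < n, vert v = v
  vert_lt : ∀ x < f, vert x < n
  tour : ∀ v < n, ∃ l, IsTour R F comp nxt vert f v l

theorem Tours.singletons (R : Roadmap n) {comp nxt vert : ℕ → ℕ} (h1 : ∀ v < n, comp v = v)
    (h2 : ∀ v < n, nxt v = v) (h3 : ∀ v < n, vert v = v) : Tours R [] comp nxt vert n where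
  kruskal := by
    have : (fun v : Fin n => comp v) = fun v : Fin n => (v : ℕ) := funext fun v => h1 v v.2
    rw [this]; exact .nil
  fresh := by simp
  vert_self := h3
  vert_lt x hx := by rw [h3 x hx]; exact hx
  tour v hv := by
    refine ⟨[], ?_, ?_, ?_, ?_, ?_, ?_, ?_⟩
    · simp [h2 v hv]
    · simp
    · simpa using hv
    · simp
    · intro w hw h
      rw [h3 v hv, h1 v hv, h1 w hw] at h
      simp [h]
    · simp [StepN]
    · simp [walkSum, lenN_self, weightIn]

/-- Nothing is required of `z`, which occurs only as the target of the last step. In a closed tour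
the successor of the repeated head may therefore be redirected. -/
theorem isChain_append_singleton_imp {α : Type*} {r r' : α → α → Prop} {z : α} :
    ∀ {l : List α}, (l ++ [z]).IsChain r → (∀ y ∈ l, ∀ w, r y w → r' y w) →
      (l ++ [z]).IsChain r'
  | [], _, _ => by simp
  | [y], h, h' => by simpa using h' y (by simp) z (by simpa using h)
  | y :: w :: l, h, h' => by
    simp only [List.cons_append, List.isChain_cons_cons] at h ⊢
    refine ⟨h' y (by simp) w h.1, ?_⟩
    exact isChain_append_singleton_imp (l := w :: l) h.2
      fun a ha => h' a (List.mem_cons_of_mem _ ha)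

theorem isChain_replace_head {α : Type*} {r r' : α → α → Prop} {x x' z : α} {l : List α}
    (h : (x :: l ++ [z]).IsChain r) (h1 : ∀ y, r x y → r' x' y)
    (h2 : ∀ y ∈ l, ∀ w, r y w → r' y w) : (x' :: l ++ [z]).IsChain r' := by
  cases l with
  | nil => simpa using h1 z (by simpa using h)
  | cons y l =>
    simp only [List.cons_append, List.isChain_cons_cons] at h ⊢
    exact ⟨h1 y h.1, isChain_append_singleton_imp (l := y :: l) h.2 h2⟩

/-- Join the tours through `a` and `b` by going along the edge `ab` and back; `f` and `f + 1` are
new occurrences of `b` and `a`. -/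
theorem Tours.merge {R : Roadmap n} {F : List (Fin n × Fin n)} {comp nxt vert : ℕ → ℕ} {f : ℕ}
    (h : Tours R F comp nxt vert f) {a b : Fin n} (hadj : R.graph.Adj a b)
    (hne : comp a ≠ comp b)
    (hmin : ∀ u v : Fin n, R.graph.Adj u v → comp u ≠ comp v → R.len a b ≤ R.len u v)
    {comp' nxt' vert' : ℕ → ℕ}
    (hcomp : ∀ v : Fin n, comp' v = mergeLabel (fun v : Fin n => comp v) a b v)
    (hnf : nxt' f = nxt b) (hnf' : nxt' (f + 1) = nxt a) (hna : nxt' a = f)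
    (hnb : nxt' b = f + 1) (hn : ∀ y < f, y ≠ a → y ≠ b → nxt' y = nxt y)
    (hvf : vert' f = b) (hvf' : vert' (f + 1) = a) (hv : ∀ y < f, vert' y = vert y) :
    Tours R ((a, b) :: F) comp' nxt' vert' (f + 2) := by
  have hnf0 : n ≤ f := by rw [h.fresh]; omega
  have haf : (a : ℕ) < f := a.2.trans_le hnf0
  have hbf : (b : ℕ) < f := b.2.trans_le hnf0
  have hva := h.vert_self a a.2
  have hvb := h.vert_self b b.2
  have hva' : vert' a = a := (hv a haf).trans hva
  have hvb' : vert' b = b := (hv b hbf).trans hvb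
  have hfun : (fun v : Fin n => comp' v) = mergeLabel (fun v : Fin n => comp v) a b := funext hcomp
  have hcompN : ∀ v < n, comp' v = if comp v = comp b then comp a else comp v :=
    fun v hv => hcomp ⟨v, hv⟩
  have hw : ∀ v : Fin n, weightIn R (fun u : Fin n => comp' u = comp' v) ((a, b) :: F) =
      if comp v = comp a ∨ comp v = comp b then
        weightIn R (fun u : Fin n => comp u = comp a) F +
          weightIn R (fun u : Fin n => comp u = comp b) F + R.len a b
      else weightIn R (fun u : Fin n => comp u = comp v) F := fun v => by
    simp only [hcomp]
    exact weightIn_mergeLabel R (comp := fun v : Fin n => comp v) hne F v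
  refine ⟨?_, ?_, ?_, ?_, ?_⟩
  · rw [hfun]
    exact .cons h.kruskal hadj hne hmin
  · rw [h.fresh, List.length_cons]; ring
  · exact fun v hv' => (hv v (hv'.trans_le hnf0)).trans (h.vert_self v hv')
  · intro x hx
    rcases (show x < f ∨ x = f ∨ x = f + 1 by omega) with hx | rfl | rfl
    · rw [hv x hx]; exact h.vert_lt x hx
    · rw [hvf]; exact b.2
    · rw [hvf']; exact a.2
  -- the joint tour, starting from `a`
  obtain ⟨la, ta⟩ := h.tour a a.2
  obtain ⟨lb, tb⟩ := h.tour b b.2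
  have hlaf : ∀ y ∈ la, y < f := fun y hy => ta.lt y (by simp [hy])
  have hlbf : ∀ y ∈ lb, y < f := fun y hy => tb.lt y (by simp [hy])
  have hca : ∀ y ∈ (a : ℕ) :: la, comp (vert y) = comp a := fun y hy => by
    rw [ta.comp_vert y hy, hva]
  have hcb : ∀ y ∈ (b : ℕ) :: lb, comp (vert y) = comp b := fun y hy => by
    rw [tb.comp_vert y hy, hvb]
  have hdisj : ∀ y, y ∈ (a : ℕ) :: la → y ∉ (b : ℕ) :: lb := fun y h1 h2 =>
    hne ((hca y h1).symm.trans (hcb y h2))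
  have hal : (a : ℕ) ∉ la := (List.nodup_cons.1 ta.nodup).1
  have hbl : (b : ℕ) ∉ lb := (List.nodup_cons.1 tb.nodup).1
  have hab : (b : ℕ) ∉ (a : ℕ) :: la := fun h' => hdisj _ h' (by simp)
  have hba : (a : ℕ) ∉ (b : ℕ) :: lb := hdisj _ (by simp)
  have hmapa : (la ++ [(a : ℕ)]).map vert' = (la ++ [(a : ℕ)]).map vert :=
    List.map_congr_left fun y hy => hv y (by
      rcases List.mem_append.1 hy with hy | hy
      · exact hlaf y hy
      · rw [List.mem_singleton.1 hy]; exact haf)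
  have hmapb : (lb ++ [(b : ℕ)]).map vert' = (lb ++ [(b : ℕ)]).map vert :=
    List.map_congr_left fun y hy => hv y (by
      rcases List.mem_append.1 hy with hy | hy
      · exact hlbf y hy
      · rw [List.mem_singleton.1 hy]; exact hbf)
  -- Cross from `a` to the copy `f` of `b`, follow the old tour of `b` until it closes at `b`
  -- itself, cross back to the copy `f + 1` of `a`, and follow the old tour of `a`. If `b` was
  -- alone, the step from `f` to `b` stays at one vertex; this is why `StepN` allows equality.
  have key : IsTour R ((a, b) :: F) comp' nxt' vert' (f + 2) a
      (f :: (lb ++ (b : ℕ) :: (f + 1) :: la)) := by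
    have e : ((a : ℕ) :: f :: (lb ++ (b : ℕ) :: (f + 1) :: la)) ++ [(a : ℕ)] =
        (a : ℕ) :: ((f :: lb) ++ (b : ℕ) :: ((f + 1) :: la ++ [(a : ℕ)])) := by simp
    have hcomp_va : comp' (vert' a) = comp a := by
      rw [hva', hcompN a a.2, if_neg hne]
    refine ⟨?_, ?_, ?_, ?_, ?_, ?_, ?_⟩
    · rw [e]
      simp only [List.cons_append, List.isChain_cons_cons]
      refine ⟨hna, ?_⟩
      rw [← List.cons_append, List.isChain_split]
      -- The copy `f` takes over the successor of `b` and replaces it at the head of its old tour,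
      -- while the closing occurrence of `b` remains. Below, `f + 1` does the same for `a`.
      refine ⟨isChain_replace_head tb.chain (fun y hy => hnf.trans hy) fun y hy w hw => ?_, ?_⟩
      · rw [hn y (hlbf y hy) (by rintro rfl; exact hba (by simp [hy]))
          (by rintro rfl; exact hbl hy)]
        exact hw
      · rw [List.isChain_cons_cons]
        refine ⟨hnb, ?_⟩
        refine isChain_replace_head ta.chain (fun y hy => hnf'.trans hy) fun y hy w hw => ?_
        rw [hn y (hlaf y hy) (by rintro rfl; exact hal hy)
          (by rintro rfl; exact hab (by simp [hy]))]
        exact hw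
    · have hf1 : ∀ y ∈ la, y ≠ f ∧ y ≠ f + 1 := fun y hy => by have := hlaf y hy; omega
      have hf2 : ∀ y ∈ lb, y ≠ f ∧ y ≠ f + 1 := fun y hy => by have := hlbf y hy; omega
      have hna' := (List.nodup_cons.1 ta.nodup).2
      have hnb' := (List.nodup_cons.1 tb.nodup).2
      simp only [List.nodup_cons, List.mem_cons, List.mem_append, not_or, List.nodup_append] at *
      refine ⟨⟨by omega, hba.2, fun h' => hne (by rw [h']), by omega, hal⟩,
        ⟨fun h' => (hf2 f h').1 rfl, by omega, by omega, fun h' => (hf1 f h').1 rfl⟩, hnb', ?_, ?_⟩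
      · exact ⟨⟨by omega, hab.2⟩, fun h' => (hf1 _ h').2 rfl, hna'⟩
      · rintro y hy z (rfl | rfl | hz) rfl
        · exact hbl hy
        · exact (hf2 _ hy).2 rfl
        · exact (hdisj y (Or.inr hz)).2 hy
    · intro y hy
      simp only [List.mem_cons, List.mem_append] at hy
      rcases hy with rfl | rfl | hy | rfl | rfl | hy
      exacts [by omega, by omega, by have := hlbf y hy; omega, by omega, by omega,
        by have := hlaf y hy; omega]
    · rw [hcomp_va]
      intro y hy
      simp only [List.mem_cons, List.mem_append] at hy
      have hbb : comp' b = comp a := by rw [hcompN b b.2, if_pos rfl]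
      have haa : comp' a = comp a := by rw [hcompN a a.2, if_neg hne]
      rcases hy with rfl | rfl | hy | rfl | rfl | hy
      · rw [hva', haa]
      · rw [hvf, hbb]
      · rw [hv y (hlbf y hy), hcompN _ (h.vert_lt y (hlbf y hy)), if_pos (hcb y (by simp [hy]))]
      · rw [hvb', hbb]
      · rw [hvf', haa]
      · rw [hv y (hlaf y hy), hcompN _ (h.vert_lt y (hlaf y hy)), hca y (by simp [hy]), if_neg hne]
    · rw [hcomp_va]
      intro w hw' hc
      rw [hcompN w hw'] at hc
      simp only [List.mem_cons, List.mem_append]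
      split_ifs at hc with h1
      · have := tb.mem w hw' (by rw [h1, hvb])
        simp only [List.mem_cons] at this; tauto
      · have := ta.mem w hw' (by rw [hc, hva])
        simp only [List.mem_cons] at this; tauto
    · have hsa := ta.step
      have hsb := tb.step
      rw [List.cons_append, List.map_cons] at hsa hsb
      rw [e, List.map_cons, List.map_append, List.map_cons (a := (b : ℕ)), List.map_cons (a := f),
        List.cons_append, List.isChain_cons_cons]
      refine ⟨Or.inr ⟨a, b, hva', hvf, hadj⟩, ?_⟩
      rw [← List.cons_append, List.isChain_split]
      constructor
      · have : vert' f :: lb.map vert' ++ [vert' b] = vert b :: (lb ++ [(b : ℕ)]).map vert := by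
          rw [← hmapb, hvf, hvb]; simp
        rw [this]; exact hsb
      · rw [List.cons_append, List.map_cons, List.isChain_cons_cons]
        refine ⟨Or.inr ⟨b, a, hvb', hvf', hadj.symm⟩, ?_⟩
        rw [hva] at hsa
        rw [hmapa, hvf']; exact hsa
    · have hsa := ta.cost
      have hsb := tb.cost
      rw [List.cons_append, List.map_cons] at hsa hsb
      rw [e, List.map_cons, List.map_append, List.map_cons (a := (b : ℕ)), List.map_cons (a := f),
        List.cons_append, walkSum, ← List.cons_append, walkSum_split, List.cons_append (a := f + 1),
        List.map_cons (a := f + 1), walkSum]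
      have e1 : vert' f :: lb.map vert' ++ [vert' b] = vert b :: (lb ++ [(b : ℕ)]).map vert := by
        rw [← hmapb, hvf, hvb]; simp
      have e2 : vert' (f + 1) :: (la ++ [(a : ℕ)]).map vert' =
          vert a :: (la ++ [(a : ℕ)]).map vert := by
        rw [hmapa, hvf', hva]
      rw [e1, e2, hsa, hsb, hva', hw a, if_pos (Or.inl rfl), hvf, hvb', hvf', hva, hvb,
        lenN_of_adj hadj, lenN_of_adj hadj.symm, R.len_symm b a hadj.symm]
      ring
  intro v hvn
  by_cases hvab : comp v = comp a ∨ comp v = comp b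
  · refine key.rotate ?_
    simp only [List.mem_cons, List.mem_append]
    rcases hvab with h1 | h1
    · have := ta.mem v hvn (by rw [h1, hva])
      simp only [List.mem_cons] at this; tauto
    · have := tb.mem v hvn (by rw [h1, hvb])
      simp only [List.mem_cons] at this; tauto
  -- The tours of all other components contain neither `a` nor `b`, so none of their links has
  -- changed.
  · obtain ⟨l, t⟩ := h.tour v hvn
    have hvv := h.vert_self v hvn
    have hvf0 : v < f := hvn.trans_le hnf0
    have hc : ∀ y ∈ v :: l, comp (vert y) = comp v := fun y hy => by rw [t.comp_vert y hy, hvv]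
    push Not at hvab
    have hya : ∀ y ∈ v :: l, y ≠ a := by
      rintro y hy rfl; exact hvab.1 (by rw [← hc _ hy, hva])
    have hyb : ∀ y ∈ v :: l, y ≠ b := by
      rintro y hy rfl; exact hvab.2 (by rw [← hc _ hy, hvb])
    have hmem : ∀ y ∈ v :: l ++ [v], y ∈ v :: l := fun y hy => by
      simp only [List.mem_cons, List.mem_append, List.mem_nil_iff, or_false] at hy ⊢; tauto
    have hmap : (v :: l ++ [v]).map vert' = (v :: l ++ [v]).map vert :=
      List.map_congr_left fun y hy => hv y (t.lt y (hmem y hy))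
    have hcv : comp' v = comp v := by rw [hcompN v hvn, if_neg hvab.2]
    have hvv' : vert' v = v := (hv v hvf0).trans hvv
    refine ⟨l, ?_, t.nodup, fun y hy => (t.lt y hy).trans (by omega), ?_, ?_, ?_, ?_⟩
    · refine isChain_replace_head t.chain (fun y hy => ?_) fun y hy w hw => ?_
      · rw [hn v hvf0 (hya v (by simp)) (hyb v (by simp)), hy]
      · have hy' : y ∈ v :: l := by simp [hy]
        rw [hn y (t.lt y hy') (hya y hy') (hyb y hy'), hw]
    · intro y hy
      rw [hv y (t.lt y hy), hcompN _ (h.vert_lt y (t.lt y hy)), hc y hy, if_neg hvab.2, hvv', hcv]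
    · intro w hw' hcw
      refine t.mem w hw' ?_
      rw [hvv', hcv, hcompN w hw'] at hcw
      rw [hvv]
      split_ifs at hcw with h1
      · exact absurd hcw.symm hvab.1
      · exact hcw
    · rw [hmap]; exact t.step
    · rw [hmap, t.cost, hvv', hw ⟨v, hvn⟩, if_neg (by push Not; exact hvab), hvv]

end Patrol

namespace Patrol

variable {n m : ℕ}

/-! ### The program

The natural number arrays are used as follows.
* `0`, `1`, `2`: the input, `3`, `4`: the output;
* `5`: labels of the components; `6`, `7`: successors and vertices of the nodes of the tours;
  `8`: the number of nodes;
* `9`, `10`, `11`, `13`, `20`, `21`: loop counters; `12`, `14`, `15`: nodes;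
* `16`, `17`, `18`: the number of segments into which the tours are cut, their lengths and vertices;
* `19`: whether there is any output; `22`, `23`, `24`: a shortest edge between two components, and
  whether there is one; `25`, `26`: the labels of these components.

The real arrays are: `0`: the input; `1`: the bound for the cost of a segment; `2`: the cost of the
current segment; `3`: the bound for the cost of the output. -/

/-- Begin a new segment with the vertex `e`. -/
def newSeg (e : IExp) : Prog :=
  block [.seti 18 (reg 16) (.lit 0) e, .seti 17 (reg 16) (.lit 0) (.lit 1),
    setReg 16 (.add (reg 16) (.lit 1)), setDReg 2 .zero]

/-- Append the vertex `e` to the current segment. -/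
def appendSeg (e : IExp) : Prog :=
  block [.seti 18 (.sub (reg 16) (.lit 1)) (.get 17 (.sub (reg 16) (.lit 1)) (.lit 0)) e,
    .seti 17 (.sub (reg 16) (.lit 1)) (.lit 0)
      (.add (.get 17 (.sub (reg 16) (.lit 1)) (.lit 0)) (.lit 1))]

/-- The vertices of the current node and of the next one, and the cost of the step. -/
def curVertex : IExp := entry 7 (reg 15)

def nextVertex : IExp := entry 7 (reg 14)

def stepCost : DExp := .get 0 curVertex nextVertex

/-- Go to the next node of a tour and extend the current segment, unless it becomes too long. -/
def cutStep : Prog :=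
  block [setReg 14 (entry 6 (reg 15)),
    .ite (.dlt (dreg 1) (.add (dreg 2) stepCost))
      (newSeg nextVertex)
      (block [setDReg 2 (.add (dreg 2) stepCost),
        .ite (.eq curVertex nextVertex) .skip (appendSeg nextVertex)]),
    setReg 15 (reg 14)]

/-- Cut one tour into segments. -/
def cutTour : Prog :=
  block [newSeg (reg 13), setReg 15 (reg 13),
    .loop (.neg (.eq (entry 6 (reg 15)) (reg 13))) cutStep]

/-- Cut all tours into segments. -/
def cutAll : Prog :=
  block [setReg 16 (.lit 0),
    forUpTo 13 (reg 0) (.ite (.eq (entry 5 (reg 13)) (reg 13)) cutTour .skip)]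

/-- Copy the segments to the output. -/
def save : Prog :=
  block [setReg 19 (.lit 1), setDReg 3 (dreg 1),
    forUpTo 20 (reg 1)
      (.ite (.ilt (reg 20) (reg 16))
        (block [.seti 3 (reg 20) (.lit 0) (.get 17 (reg 20) (.lit 0)),
          forUpTo 21 (.get 17 (reg 20) (.lit 0))
            (.seti 4 (reg 20) (reg 21) (.get 18 (reg 20) (reg 21)))])
        (block [.seti 3 (reg 20) (.lit 0) (.lit 1), .seti 4 (reg 20) (.lit 0) (.lit 0)]))]

/-- Try one bound for the cost of the segments. -/
def tryBound : Prog :=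
  block [cutAll,
    .ite (.conj (.neg (.ilt (reg 1) (reg 16)))
        (.or (.eq (reg 19) (.lit 0)) (.dlt (dreg 1) (dreg 3))))
      save .skip]

/-- Try all bounds that are costs of contiguous parts of tours. -/
def tryBounds : Prog :=
  forUpTo 10 (reg 8)
    (block [setReg 12 (reg 10), setDReg 1 .zero,
      forUpTo 11 (reg 8)
        (block [tryBound,
          setDReg 1 (.add (dreg 1) (.get 0 (entry 7 (reg 12)) (entry 7 (entry 6 (reg 12))))),
          setReg 12 (entry 6 (reg 12))])])

/-- Find a shortest edge between two components. -/
def findEdge : Prog :=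
  block [setReg 24 (.lit 0),
    forUpTo 20 (reg 0) (forUpTo 21 (reg 0)
      (.ite (.conj (.ilt (.lit 0) (.get 2 (reg 20) (reg 21)))
          (.conj (.ilt (entry 5 (reg 20)) (entry 5 (reg 21)))
            (.or (.eq (reg 24) (.lit 0))
              (.dlt (.get 0 (reg 20) (reg 21)) (.get 0 (reg 22) (reg 23))))))
        (block [setReg 22 (reg 20), setReg 23 (reg 21), setReg 24 (.lit 1)]) .skip))]

/-- Join the tours around two components. -/
def mergeTours : Prog :=
  block [setReg 25 (entry 5 (reg 22)), setReg 26 (entry 5 (reg 23)),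
    forUpTo 20 (reg 0)
      (.ite (.eq (entry 5 (reg 20)) (reg 26)) (setEntry 5 (reg 20) (reg 25)) .skip),
    setEntry 7 (reg 8) (reg 23), setEntry 7 (.add (reg 8) (.lit 1)) (reg 22),
    setEntry 6 (reg 8) (entry 6 (reg 23)),
    setEntry 6 (.add (reg 8) (.lit 1)) (entry 6 (reg 22)),
    setEntry 6 (reg 22) (reg 8), setEntry 6 (reg 23) (.add (reg 8) (.lit 1)),
    setReg 8 (.add (reg 8) (.lit 2))]

/-- The tours around single vertices. -/
def initTours : Prog :=
  block [forUpTo 20 (reg 0)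
      (block [setEntry 5 (reg 20) (reg 20), setEntry 6 (reg 20) (reg 20),
        setEntry 7 (reg 20) (reg 20)]),
    setReg 8 (reg 0)]

/-- The algorithm. -/
def pathCoverProg : Prog :=
  block [initTours,
    forUpTo 9 (reg 0)
      (block [tryBounds, findEdge, .ite (.ilt (.lit 0) (reg 24)) mergeTours .skip])]

/-! ### Cutting a tour -/

/-- The memory holds the input and the tours. -/
structure Holds (R : Roadmap n) (m : ℕ) (comp nxt vert : ℕ → ℕ) (f : ℕ) (s : Store) : Prop where
  n_eq : s.idx 0 0 0 = n
  m_eq : s.idx 1 0 0 = m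
  adj_eq : s.idx 2 = (input R m).idx 2
  len_eq : s.dat 0 = lenN R
  comp_eq : s.idx 5 0 = comp
  nxt_eq : s.idx 6 0 = nxt
  vert_eq : s.idx 7 0 = vert
  f_eq : s.idx 8 0 0 = f

section Cut

variable {R : Roadmap n} {comp nxt vert : ℕ → ℕ} {f : ℕ} {s : Store}

theorem Holds.congr {s' : Store} (h : Holds R m comp nxt vert f s)
    (hi : ∀ a ∈ [0, 1, 2, 5, 6, 7, 8], s'.idx a = s.idx a) (hd : s'.dat 0 = s.dat 0) :
    Holds R m comp nxt vert f s' := by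
  obtain ⟨h1, h2, h3, h4, h5, h6, h7, h8⟩ := h
  constructor
  · rw [hi 0 (by simp), h1]
  · rw [hi 1 (by simp), h2]
  · rw [hi 2 (by simp), h3]
  · rw [hd, h4]
  · rw [hi 5 (by simp), h5]
  · rw [hi 6 (by simp), h6]
  · rw [hi 7 (by simp), h7]
  · rw [hi 8 (by simp), h8]

theorem Holds.seti (h : Holds R m comp nxt vert f s) {a : ℕ} (ha : a ∉ [0, 1, 2, 5, 6, 7, 8])
    (i j x : ℕ) : Holds R m comp nxt vert f (s.seti a i j x) :=
  h.congr (fun b hb => s.idx_seti_of_ne (by rintro rfl; exact ha hb) i j x) rfl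

theorem Holds.setd (h : Holds R m comp nxt vert f s) {a : ℕ} (ha : a ≠ 0)
    (i j : ℕ) (x : ℝ) : Holds R m comp nxt vert f (s.setd a i j x) :=
  h.congr (fun _ _ => rfl) (s.dat_setd_of_ne ha.symm i j x)

/-- The memory holds the segments `segs`. -/
def Rep (s : Store) (segs : List (List (Fin n))) : Prop :=
  s.idx 16 0 0 = segs.length ∧ ∀ k (h : k < segs.length),
    segs[k].map Fin.val = (List.range (s.idx 17 k 0)).map (s.idx 18 k)

theorem Rep.congr {s' : Store} {segs : List (List (Fin n))} (h : Rep s segs)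
    (h1 : s'.idx 16 = s.idx 16) (h2 : s'.idx 17 = s.idx 17) (h3 : s'.idx 18 = s.idx 18) :
    Rep s' segs := by
  rw [Rep, h1, h2, h3]; exact h

theorem Store.idx_seti_row_of_ne (s : Store) (a : ℕ) {i i' : ℕ} (h : i' ≠ i) (j x : ℕ) :
    (s.seti a i j x).idx a i' = s.idx a i' := by
  funext j'; simp [Store.idx_seti_self, h]

theorem map_range_update (g : ℕ → ℕ) (k x : ℕ) :
    (List.range (k + 1)).map (Function.update g k x) = (List.range k).map g ++ [x] := by
  rw [List.range_succ, List.map_append]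
  congr 1
  · refine List.map_congr_left fun i hi => ?_
    rw [Function.update_of_ne (List.mem_range.1 hi).ne]
  · simp

theorem runs_newSeg (N : ℕ) {segs : List (List (Fin n))} (h : Rep s segs) {e : IExp} {w : Fin n}
    (hw : e.eval s = w) :
    Runs N (newSeg e) s fun s' => Rep s' (segs ++ [[w]]) ∧ s'.dat 2 0 0 = 0 := by
  refine Runs.block_cons (Runs.seti (Runs.block_cons (Runs.seti (Runs.block_cons (Runs.setReg
    (Runs.block_cons (Runs.setDReg (Runs.block_nil ?_))))))))
  obtain ⟨h1, h2⟩ := h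
  refine ⟨⟨?_, fun k hk => ?_⟩, by simp [DExp.eval]⟩
  · simp [IExp.eval, Store.idx_seti_of_ne, h1]
  · simp only [IExp.eval, reg_eval, hw, h1, Store.idx_setd, ne_eq,
      Nat.reduceEqDiff, not_false_eq_true, Store.idx_seti_of_ne]
    rw [List.length_append, List.length_singleton] at hk
    rcases Nat.lt_succ_iff_lt_or_eq.1 hk with hk | rfl
    · rw [List.getElem_append_left hk, h2 k hk, Store.idx_seti_row_of_ne _ _ hk.ne,
        Store.idx_seti_row_of_ne _ _ hk.ne, Store.idx_seti_of_ne _ (by decide)]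
    · rw [List.getElem_append_right le_rfl]
      simp

theorem runs_appendSeg (N : ℕ) {segs : List (List (Fin n))} {q : List (Fin n)}
    (h : Rep s (segs ++ [q])) {e : IExp} {w : Fin n} (hw : e.eval s = w) :
    Runs N (appendSeg e) s fun s' => Rep s' (segs ++ [q ++ [w]]) := by
  refine Runs.block_cons (Runs.seti (Runs.block_cons (Runs.seti (Runs.block_nil ?_))))
  obtain ⟨h1, h2⟩ := h
  rw [List.length_append, List.length_singleton] at h1
  refine ⟨?_, fun k hk => ?_⟩
  · simp [Store.idx_seti_of_ne, h1]
  · simp only [IExp.eval, reg_eval, hw, h1, ne_eq, add_tsub_cancel_right,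
      Nat.reduceEqDiff, not_false_eq_true, Store.idx_seti_of_ne]
    rw [List.length_append, List.length_singleton] at hk
    rcases Nat.lt_succ_iff_lt_or_eq.1 hk with hk | rfl
    · have := h2 k (by simp; omega)
      rw [List.getElem_append_left hk] at this ⊢
      rw [this, Store.idx_seti_row_of_ne _ _ hk.ne, Store.idx_seti_row_of_ne _ _ hk.ne,
        Store.idx_seti_of_ne _ (by decide)]
    · have := h2 segs.length (by simp)
      rw [List.getElem_append_right le_rfl] at this ⊢
      simp only [tsub_self, List.getElem_cons_zero] at this ⊢
      rw [List.map_append, this, Store.idx_seti_row, Store.idx_seti_row, Function.update_self,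
        map_range_update]
      rfl

/-- The cost of going `j` steps from the node `i`. -/
noncomputable def tourCost (R : Roadmap n) (nxt vert : ℕ → ℕ) (i j : ℕ) : ℝ :=
  ∑ t ∈ Finset.range j, lenN R (vert (nxt^[t] i)) (vert (nxt^[t + 1] i))

/-- All costs of parts of tours that are at most `c` are at most `B`. -/
def Tight (R : Roadmap n) (nxt vert : ℕ → ℕ) (f : ℕ) (B c : ℝ) : Prop :=
  ∀ i < f, ∀ j < f, tourCost R nxt vert i j ≤ c → tourCost R nxt vert i j ≤ B

/-- A segment that is a path of cost at most `B`. -/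
structure SegOK (R : Roadmap n) (B : ℝ) (f : ℕ) (q : List (Fin n)) : Prop where
  isPath : IsPath R q
  cost_le : pathCost R q ≤ B
  length_le : q.length ≤ f

theorem pathCost_append_singleton (R : Roadmap n) (w : Fin n) :
    ∀ {q : List (Fin n)} {c : Fin n}, q.getLast? = some c →
      pathCost R (q ++ [w]) = pathCost R q + R.len c w
  | [], _, h => by simp at h
  | [x], c, h => by
    obtain rfl : x = c := by simpa using h
    simp [pathCost]
  | x :: y :: l, c, h => by
    have := pathCost_append_singleton R w (q := y :: l) (c := c) (by simpa using h)
    simp only [List.cons_append, pathCost] at this ⊢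
    rw [this]; ring

theorem IsPath.append_singleton {q : List (Fin n)} (h : IsPath R q) {c w : Fin n}
    (hc : q.getLast? = some c) (hcw : R.graph.Adj c w) : IsPath R (q ++ [w]) := by
  refine ⟨by simp, List.isChain_append.2 ⟨h.2, by simp, ?_⟩⟩
  intro x hx y hy
  rw [hc] at hx
  obtain rfl : c = x := by simpa using hx
  obtain rfl : w = y := by simpa using hy
  exact hcw

/-- The state while the tour `r :: l` is being cut: the nodes `pre` and `cur` have been visited, and
`g` and `q` are the finished segments and the current one. -/
structure CutInv (R : Roadmap n) (m : ℕ) (comp nxt vert : ℕ → ℕ) (f : ℕ) (B : ℝ) (r : ℕ)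
    (l : List ℕ) (segs g : List (List (Fin n))) (q : List (Fin n)) (pre : List ℕ) (cur : ℕ)
    (rest : List ℕ) (s : Store) : Prop where
  holds : Holds R m comp nxt vert f s
  root_eq : s.idx 13 0 0 = r
  bound_eq : s.dat 1 0 0 = B
  list_eq : r :: l = pre ++ cur :: rest
  cur_eq : s.idx 15 0 0 = cur
  rep : Rep s (segs ++ (g ++ [q]))
  segOK : ∀ q ∈ g, SegOK R B f q
  isPath : IsPath R q
  cost_eq : pathCost R q = s.dat 2 0 0
  cost_le : s.dat 2 0 0 ≤ B
  length_le : q.length + rest.length ≤ f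
  last_eq : ∃ c : Fin n, q.getLast? = some c ∧ vert cur = c
  covers : ∀ x ∈ pre ++ [cur], ∃ q' ∈ g ++ [q], vert x ∈ q'.map Fin.val
  count : ∀ c, Tight R nxt vert f B c →
    g.length * c + s.dat 2 0 0 ≤ walkSum (lenN R) ((pre ++ [cur]).map vert)
  start : ∃ i j, i < f ∧ j + rest.length < f ∧ s.dat 2 0 0 = tourCost R nxt vert i j ∧
    cur = nxt^[j] i

/-- The cost of the current segment, even if extended by the next step, is the cost of a contiguous
part of the tour. Hence a step that exceeds `B` also exceeds every `c` with `Tight R nxt vert f B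
c`, and the finished segment together with the abandoned step pays for one unit `c` in `count`. -/
theorem CutInv.step {N : ℕ} {B : ℝ} (hB : 0 ≤ B) {r : ℕ} {l : List ℕ}
    {segs g : List (List (Fin n))} {q : List (Fin n)} {pre : List ℕ} {cur y : ℕ} {rest : List ℕ}
    (h : CutInv R m comp nxt vert f B r l segs g q pre cur (y :: rest) s)
    (hy : nxt cur = y) (hyf : y < f) (hyn : vert y < n) (hstep : StepN R (vert cur) (vert y)) :
    Runs N cutStep s fun s' => ∃ g' q',
      CutInv R m comp nxt vert f B r l segs g' q' (pre ++ [cur]) y rest s' := by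
  obtain ⟨i, j, hi, hj, hacc, hcur⟩ := h.start
  obtain ⟨v, hv, hvc⟩ := h.last_eq
  rw [List.length_cons] at hj
  have hlen := h.length_le
  rw [List.length_cons] at hlen
  have hlist : r :: l = (pre ++ [cur]) ++ y :: rest := by rw [h.list_eq]; simp
  have hacc' : s.dat 2 0 0 + lenN R (vert cur) (vert y) = tourCost R nxt vert i (j + 1) := by
    rw [tourCost, Finset.sum_range_succ, ← tourCost, ← hacc, Function.iterate_succ_apply', ← hcur,
      hy]
  have hwalk : walkSum (lenN R) ((pre ++ [cur] ++ [y]).map vert) =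
      walkSum (lenN R) ((pre ++ [cur]).map vert) + lenN R (vert cur) (vert y) := by
    have := walkSum_split (lenN R) (vert cur) [vert y] (pre.map vert)
    simpa [walkSum] using this
  have hnode : nxt^[j + 1] i = y := by rw [Function.iterate_succ_apply', ← hcur, hy]
  refine Runs.block_cons (Runs.setReg ?_)
  set s₁ := s.seti 14 0 0 ((entry 6 (reg 15)).eval s) with hs₁
  have hidx : ∀ a, a ≠ 14 → s₁.idx a = s.idx a := fun a ha => s.idx_seti_of_ne ha _ _ _
  have hdat : s₁.dat = s.dat := rfl
  have h14 : s₁.idx 14 0 0 = y := by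
    simp [hs₁, h.holds.nxt_eq, h.cur_eq, hy]
  have hH₁ : Holds R m comp nxt vert f s₁ := h.holds.seti (by simp) _ _ _
  have hrep₁ : Rep s₁ (segs ++ (g ++ [q])) :=
    h.rep.congr (hidx _ (by simp)) (hidx _ (by simp)) (hidx _ (by simp))
  have hcv : curVertex.eval s₁ = vert cur := by
    simp [curVertex, hH₁.vert_eq, hidx 15, h.cur_eq]
  have hnv : nextVertex.eval s₁ = (⟨vert y, hyn⟩ : Fin n) := by
    simp [nextVertex, hH₁.vert_eq, h14]
  have hsc : stepCost.eval s₁ = lenN R (vert cur) (vert y) := by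
    simp only [stepCost, DExp.eval, hcv, hnv, hH₁.len_eq]
  refine Runs.block_cons (Runs.ite (fun hb => ?_) fun hb => ?_)
  · simp only [Test.holds, DExp.eval, dreg_eval, hsc, hdat, h.bound_eq] at hb
    refine (runs_newSeg N hrep₁ hnv).frame.mono ?_
    rintro s₂ ⟨⟨hrep₂, hz⟩, hi₂, hd₂⟩
    refine Runs.block_cons (Runs.setReg (Runs.block_nil ⟨g ++ [q], [⟨vert y, hyn⟩], ?_⟩))
    have hi₂' : ∀ a, a ∉ [14, 16, 17, 18] → s₂.idx a = s.idx a := fun a ha => by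
      simp only [List.mem_cons, List.not_mem_nil, or_false, not_or] at ha
      rw [hi₂ a (by simp [newSeg, block, Prog.iwrites, setReg, setDReg]; tauto), hidx a ha.1]
    have h14₂ : s₂.idx 14 0 0 = y := by
      rw [hi₂ 14 (by decide), h14]
    constructor
    · refine Holds.seti (hH₁.congr (fun a ha => hi₂ a ?_) (hd₂ 0 (by decide))) (by simp) _ _ _
      revert ha; simp [newSeg, block, Prog.iwrites, setReg, setDReg]; omega
    · rw [Store.idx_seti_of_ne _ (by decide), hi₂' 13 (by simp), h.root_eq]
    · rw [Store.dat_seti, hd₂ 1 (by decide), hdat, h.bound_eq]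
    · exact hlist
    · simp [h14₂]
    · refine Rep.congr (s := s₂) (by simpa using hrep₂) ?_ ?_ ?_ <;>
        exact Store.idx_seti_of_ne _ (by decide) _ _ _
    · intro q' hq'
      rcases List.mem_append.1 hq' with hq' | hq'
      · exact h.segOK q' hq'
      · rw [List.mem_singleton.1 hq']
        exact ⟨h.isPath, h.cost_eq ▸ h.cost_le, by omega⟩
    · exact ⟨by simp, by simp⟩
    · simp [pathCost, hz]
    · simpa [hz] using hB
    · simp only [List.length_singleton]
      have : 0 < q.length := List.length_pos_of_ne_nil h.isPath.1
      omega
    · exact ⟨⟨vert y, hyn⟩, by simp, rfl⟩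
    · intro x hx
      rcases List.mem_append.1 hx with hx | hx
      · obtain ⟨q', hq', hxq⟩ := h.covers x hx
        exact ⟨q', List.mem_append_left _ hq', hxq⟩
      · rw [List.mem_singleton.1 hx]
        exact ⟨_, List.mem_append_right _ (List.mem_singleton_self _), by simp⟩
    · intro c hc
      have h1 := h.count c hc
      -- The extended cost is `tourCost R nxt vert i (j + 1)`. Were it at most `c`, tightness would
      -- bound it by `B`, against the test.
      have h2 : c < s.dat 2 0 0 + lenN R (vert cur) (vert y) := by
        by_contra! hle
        rw [hacc'] at hle hb
        exact absurd (hc i hi (j + 1) (by omega) hle) (not_le.2 hb)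
      rw [hwalk, Store.dat_seti, hz, List.length_append, List.length_singleton]
      push_cast; linarith
    · exact ⟨y, 0, hyf, by omega, by simp [hz, tourCost], rfl⟩
  · simp only [Test.holds, DExp.eval, dreg_eval, hsc, hdat, h.bound_eq, not_lt] at hb
    refine Runs.block_cons (Runs.setDReg ?_)
    set s₂ := s₁.setd 2 0 0 ((DExp.add (dreg 2) stepCost).eval s₁) with hs₂
    have hz₂ : s₂.dat 2 0 0 = tourCost R nxt vert i (j + 1) := by
      simp [hs₂, DExp.eval, hsc, hdat, hacc']
    have hd₂ : ∀ a, a ≠ 2 → s₂.dat a = s.dat a := fun a ha => s₁.dat_setd_of_ne ha _ _ _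
    have hi₂ : s₂.idx = s₁.idx := rfl
    have hH₂ : Holds R m comp nxt vert f s₂ := hH₁.setd (by simp) _ _ _
    have hcv₂ : curVertex.eval s₂ = vert cur := hcv
    have hnv₂ : nextVertex.eval s₂ = (⟨vert y, hyn⟩ : Fin n) := hnv
    have hrep₂ : Rep s₂ (segs ++ (g ++ [q])) := hrep₁
    -- Common to the two ways of extending the segment, in which `q'` is `q` itself or `q` with one
    -- more vertex.
    have fin : ∀ (q' : List (Fin n)) (s₃ : Store), Rep s₃ (segs ++ (g ++ [q'])) →
        (∀ a, a ∉ [17, 18] → s₃.idx a = s₂.idx a) → (∀ a, s₃.dat a = s₂.dat a) →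
        IsPath R q' → pathCost R q' = s.dat 2 0 0 + lenN R (vert cur) (vert y) →
        q'.length ≤ q.length + 1 → (∃ c : Fin n, q'.getLast? = some c ∧ vert y = c) → q ⊆ q' →
        Runs N (block [setReg 15 (reg 14)]) s₃ fun s' => ∃ g' q',
          CutInv R m comp nxt vert f B r l segs g' q' (pre ++ [cur]) y rest s' := by
      intro q' s₃ hrep₃ hi₃ hd₃ hp hc hl hlast hsub
      refine Runs.block_cons (Runs.setReg (Runs.block_nil ⟨g, q', ?_⟩))
      have h14₃ : s₃.idx 14 0 0 = y := by rw [hi₃ 14 (by simp), hi₂, h14]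
      constructor
      · refine Holds.seti (hH₂.congr (fun a ha => hi₃ a ?_) (hd₃ 0)) (by simp) _ _ _
        revert ha; simp; omega
      · rw [Store.idx_seti_of_ne _ (by decide), hi₃ 13 (by simp), hi₂, hidx 13 (by simp), h.root_eq]
      · rw [Store.dat_seti, hd₃ 1, hd₂ 1 (by simp), h.bound_eq]
      · exact hlist
      · simp [h14₃]
      · refine Rep.congr (s := s₃) hrep₃ ?_ ?_ ?_ <;>
          exact Store.idx_seti_of_ne _ (by decide) _ _ _
      · exact h.segOK
      · exact hp
      · rw [Store.dat_seti, hd₃ 2, hz₂, hc, hacc']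
      · rw [Store.dat_seti, hd₃ 2, hz₂, ← hacc']; exact hb
      · omega
      · exact hlast
      · intro x hx
        rcases List.mem_append.1 hx with hx | hx
        · obtain ⟨q₁, hq₁, hxq⟩ := h.covers x hx
          rcases List.mem_append.1 hq₁ with hq₁ | hq₁
          · exact ⟨q₁, List.mem_append_left _ hq₁, hxq⟩
          · rw [List.mem_singleton.1 hq₁] at hxq
            exact ⟨q', by simp, List.map_subset _ hsub hxq⟩
        · rw [List.mem_singleton.1 hx]
          obtain ⟨c, hc1, hc2⟩ := hlast
          exact ⟨q', by simp, List.mem_map.2 ⟨c, List.mem_of_getLast? hc1, hc2.symm⟩⟩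
      · intro c hc
        have h1 := h.count c hc
        rw [hwalk, Store.dat_seti, hd₃ 2, hz₂, ← hacc']
        linarith
      · refine ⟨i, j + 1, hi, by omega, ?_, hnode.symm⟩
        rw [Store.dat_seti, hd₃ 2, hz₂]
    refine Runs.block_cons (Runs.ite (fun he => ?_) fun he => ?_)
    · rw [Test.eq_holds, hcv₂, hnv₂] at he
      refine Runs.skip (Runs.block_nil (fin q s₂ hrep₂ (fun _ _ => rfl) (fun _ => rfl) h.isPath ?_
        (by omega) ⟨v, hv, he.symm.trans hvc⟩ (List.Subset.refl _)))
      rw [show vert y = vert cur from he.symm, lenN_self, add_zero, h.cost_eq]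
    · rw [Test.eq_holds, hcv₂, hnv₂] at he
      -- Only a change of vertex is recorded, so that consecutive terms of the segment are adjacent.
      obtain ⟨a, b, ha, hb', hab⟩ := hstep.resolve_left he
      obtain rfl : v = a := Fin.ext (hvc.symm.trans ha)
      obtain rfl : b = ⟨vert y, hyn⟩ := Fin.ext hb'.symm
      rw [← List.append_assoc] at hrep₂
      refine (runs_appendSeg N hrep₂ hnv₂).frame.mono ?_
      rintro s₃ ⟨hrep₃, hi₃, hd₃⟩
      refine Runs.block_nil (fin _ s₃ (by rwa [← List.append_assoc]) (fun a ha => hi₃ a ?_)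
        (fun a => hd₃ a (by simp [appendSeg, block, Prog.dwrites]))
        (h.isPath.append_singleton hv hab) ?_ (by simp) ⟨_, by simp, hb'⟩
        (List.subset_append_left _ _))
      · revert ha; simp [appendSeg, block, Prog.iwrites]; omega
      · rw [pathCost_append_singleton R _ hv, h.cost_eq, ← lenN_of_adj hab, hvc]

end Cut

end Patrol

namespace Patrol

variable {n m : ℕ}

/-! ### Cutting all tours and searching for the best bound -/

section Search

variable {R : Roadmap n} {F : List (Fin n × Fin n)} {comp nxt vert : ℕ → ℕ} {f N : ℕ} {s : Store}

/-- All segments but the last have each used up more than `c` of the tour, whose total cost is twice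
the weight of its tree; hence `g.length - 1`. -/
theorem runs_cutTour (hT : Tours R F comp nxt vert f) (hf : f ≤ N) {r : ℕ} (hr : r < n) {B : ℝ}
    (hB : 0 ≤ B) (hs : Holds R m comp nxt vert f s) (hsr : s.idx 13 0 0 = r)
    (hsB : s.dat 1 0 0 = B) {segs : List (List (Fin n))} (hrep : Rep s segs) :
    Runs N cutTour s fun s' => ∃ g : List (List (Fin n)), Rep s' (segs ++ g) ∧
      (∀ q ∈ g, SegOK R B f q) ∧ (∀ w : Fin n, comp w = comp r → ∃ q ∈ g, w ∈ q) ∧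
      ∀ c, Tight R nxt vert f B c →
        (g.length - 1 : ℝ) * c ≤ 2 * weightIn R (fun u => comp u = comp r) F := by
  obtain ⟨l, t⟩ := hT.tour r hr
  have hvr := hT.vert_self r hr
  have hrf : r < f := t.lt r (by simp)
  -- The nodes of a tour are distinct and less than `f`; this bounds the number of iterations.
  have hlf : l.length + 1 ≤ f := by
    have := Finset.card_le_card fun y (hy : y ∈ (r :: l).toFinset) =>
      Finset.mem_range.2 (t.lt y (List.mem_toFinset.1 hy))
    rwa [List.toFinset_card_of_nodup t.nodup, Finset.card_range] at this
  refine Runs.block_cons ((runs_newSeg N hrep (w := ⟨r, hr⟩) (by simp [hsr])).frame.mono ?_)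
  rintro s₁ ⟨⟨hrep₁, hz₁⟩, hi₁, hd₁⟩
  refine Runs.block_cons (Runs.setReg (Runs.block_cons (Runs.loop
    (fun k s => ∃ g q pre cur rest, rest.length = k ∧
      CutInv R m comp nxt vert f B r l segs g q pre cur rest s) (k := l.length) (by omega)
    ⟨[], [⟨r, hr⟩], [], r, l, rfl, ?_⟩ ?_ ?_)))
  · have hi₁' : s₁.idx 13 0 0 = r := by rw [hi₁ 13 (by decide), hsr]
    constructor
    · refine Holds.seti (hs.congr (fun a ha => hi₁ a ?_) (hd₁ 0 (by decide))) (by simp) _ _ _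
      revert ha; simp [newSeg, block, Prog.iwrites, setReg, setDReg]; omega
    · rw [Store.idx_seti_of_ne _ (by decide), hi₁']
    · rw [Store.dat_seti, hd₁ 1 (by decide), hsB]
    · rfl
    · simp [hi₁']
    · refine Rep.congr (s := s₁) hrep₁ ?_ ?_ ?_ <;> exact Store.idx_seti_of_ne _ (by decide) _ _ _
    · simp
    · exact ⟨by simp, by simp⟩
    · simp [pathCost, hz₁]
    · simpa [hz₁] using hB
    · simp; omega
    · exact ⟨⟨r, hr⟩, by simp, hvr⟩
    · simp [hvr]
    · simp [hz₁, walkSum]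
    · exact ⟨r, 0, hrf, by omega, by simp [hz₁, tourCost], rfl⟩
  · rintro k s ⟨g, q, pre, cur, rest, rfl, h⟩ hb
    have hchain := t.chain
    have hstep := t.step
    have hnodup := t.nodup
    rw [h.list_eq] at hchain hstep hnodup
    simp only [Test.holds, Test.eq_holds, entry_eval, reg_eval, h.cur_eq, h.root_eq,
      h.holds.nxt_eq] at hb
    cases rest with
    | nil =>
      rw [List.append_assoc, List.isChain_append] at hchain
      exact absurd (by simpa using hchain.2.1) hb
    | cons y rest =>
      have hy : y ∈ r :: l := by rw [h.list_eq]; simp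
      have h1 : nxt cur = y := by
        rw [List.append_assoc, List.isChain_append] at hchain
        exact (List.isChain_cons_cons.1 hchain.2.1).1
      have h2 : StepN R (vert cur) (vert y) := by
        rw [List.append_assoc, List.map_append, List.isChain_append] at hstep
        exact (List.isChain_cons_cons.1 hstep.2.1).1
      refine ⟨by simp, (h.step hB h1 (t.lt y hy) (hT.vert_lt y (t.lt y hy)) h2).mono ?_⟩
      rintro s' ⟨g', q', h'⟩
      exact ⟨g', q', _, y, rest, by simp, h'⟩
  · rintro k s ⟨g, q, pre, cur, rest, rfl, h⟩ hb
    simp only [Test.holds, Test.eq_holds, entry_eval, reg_eval, h.cur_eq, h.root_eq,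
      h.holds.nxt_eq, not_not] at hb
    -- A further node would be the successor of `cur`, hence equal to the root, which does not occur
    -- again in the tour.
    have hrest : rest = [] := by
      cases rest with
      | nil => rfl
      | cons y rest =>
        exfalso
        have hchain := t.chain
        have hnodup := t.nodup
        rw [h.list_eq, List.append_assoc, List.isChain_append] at hchain
        have h1 : nxt cur = y := (List.isChain_cons_cons.1 hchain.2.1).1
        have h2 : y ∈ l := by
          have := h.list_eq
          cases pre with
          | nil => simp only [List.nil_append, List.cons.injEq] at this; rw [this.2]; simp
          | cons x pre =>
            simp only [List.cons_append, List.cons.injEq] at this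
            rw [this.2]; simp
        exact (List.nodup_cons.1 hnodup).1 (by rw [← hb, h1]; exact h2)
    subst hrest
    refine Runs.block_nil ⟨g ++ [q], h.rep, ?_, ?_, ?_⟩
    · intro q' hq'
      rcases List.mem_append.1 hq' with hq' | hq'
      · exact h.segOK q' hq'
      · rw [List.mem_singleton.1 hq']
        exact ⟨h.isPath, h.cost_eq ▸ h.cost_le, by simpa using h.length_le⟩
    · intro w hw
      have hmem := t.mem w w.2 (by rw [hw, hvr])
      rw [h.list_eq] at hmem
      obtain ⟨q', hq', hwq⟩ := h.covers w hmem
      rw [hT.vert_self w w.2] at hwq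
      obtain ⟨w', hw', he⟩ := List.mem_map.1 hwq
      exact ⟨q', hq', Fin.ext he ▸ hw'⟩
    · intro c hc
      have h1 := h.count c hc
      have h2 : 0 ≤ s.dat 2 0 0 := h.cost_eq ▸ pathCost_nonneg R h.isPath.2
      have h3 := t.cost
      rw [h.list_eq, List.append_assoc, List.map_append, List.cons_append, List.map_cons,
        walkSum_split, hvr] at h3
      -- The loop stops before the closing step back to the root, whose cost is simply discarded.
      have h4 := walkSum_nonneg (lenN_nonneg R) (vert cur :: ([] ++ [r]).map vert)
      rw [List.map_append, List.map_singleton] at h1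
      rw [List.length_append, List.length_singleton, ← h3]
      push_cast; linarith

theorem weightIn_nonneg (hT : Tours R F comp nxt vert f) {r : ℕ} (hr : r < n) :
    0 ≤ 2 * weightIn R (fun u => comp u = comp r) F := by
  obtain ⟨l, t⟩ := hT.tour r hr
  have := t.cost
  rw [hT.vert_self r hr] at this
  rw [← this]
  exact walkSum_nonneg (lenN_nonneg R) _

/-- The bound `B` is so large that the tours can be cut into at most `m` segments. -/
def Feasible (R : Roadmap n) (F : List (Fin n × Fin n)) (m : ℕ) (comp nxt vert : ℕ → ℕ) (f : ℕ)
    (B : ℝ) : Prop :=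
  ∃ (c : ℝ) (k : ℕ → ℕ), Tight R nxt vert f B c ∧
    (∀ r < n, comp r = r → 2 * weightIn R (fun u => comp u = comp r) F < k r * c) ∧
    ∑ r ∈ Finset.range n, k r ≤ m

/-- Components are met in the order of their labels, so before round `i` exactly those with a label
below `i` have been cut. The segment count is bounded for all `c` and `k` simultaneously, since the
program does not know them. -/
theorem runs_cutAll (hT : Tours R F comp nxt vert f) (hf : f ≤ N) {B : ℝ}
    (hB : 0 ≤ B) (hs : Holds R m comp nxt vert f s) (hsB : s.dat 1 0 0 = B) :
    Runs N cutAll s fun s' => ∃ segs : List (List (Fin n)), Rep s' segs ∧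
      (∀ q ∈ segs, SegOK R B f q) ∧ (∀ w : Fin n, ∃ q ∈ segs, w ∈ q) ∧
      (Feasible R F m comp nxt vert f B → segs.length ≤ m) := by
  have hnf : n ≤ f := by rw [hT.fresh]; omega
  refine Runs.block_cons (Runs.setReg (Runs.block_cons (Runs.forUpTo
    (fun i s => Holds R m comp nxt vert f s ∧ s.dat 1 0 0 = B ∧
      ∃ segs : List (List (Fin n)), Rep s segs ∧ (∀ q ∈ segs, SegOK R B f q) ∧
        (∀ w : Fin n, comp w < i → ∃ q ∈ segs, w ∈ q) ∧
        ∀ (c : ℝ) (k : ℕ → ℕ), Tight R nxt vert f B c →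
          (∀ r < n, comp r = r → 2 * weightIn R (fun u => comp u = comp r) F < k r * c) →
          segs.length ≤ ∑ r ∈ Finset.range i, k r)
    (K := n) (hnf.trans hf) (by decide) ?_ ?_ ?_ ?_ ?_)))
  · exact ⟨hs.seti (by simp) _ _ _, hsB, [], ⟨by simp [IExp.eval], by simp⟩, by simp, by simp,
      by simp⟩
  · rintro i s x ⟨h1, h2, segs, h3, h4⟩
    refine ⟨h1.seti (by simp) _ _ _, h2, segs, ?_, h4⟩
    refine h3.congr ?_ ?_ ?_ <;> exact Store.idx_seti_of_ne _ (by decide) _ _ _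
  · rintro i s ⟨h1, -⟩
    exact h1.n_eq
  · rintro i s hi hsi ⟨h1, h2, segs, h3, h4, h5, h6⟩
    refine Runs.ite (fun hb => ?_) fun hb => ?_
    · simp only [Test.eq_holds, entry_eval, reg_eval, hsi, h1.comp_eq] at hb
      refine (runs_cutTour hT hf hi hB h1 hsi h2 h3).frame.mono ?_
      rintro s' ⟨⟨g, k1, k2, k3, k4⟩, hi', hd'⟩
      refine ⟨h1.congr (fun a ha => hi' a ?_) (hd' 0 (by decide)),
        by rw [hd' 1 (by decide), h2], segs ++ g, k1, ?_, ?_, ?_⟩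
      · revert a; decide
      · intro q hq
        exact (List.mem_append.1 hq).elim (h4 q) (k2 q)
      · intro w hw
        rcases Nat.lt_succ_iff_lt_or_eq.1 hw with hw | hw
        · obtain ⟨q, hq, hwq⟩ := h5 w hw
          exact ⟨q, List.mem_append_left _ hq, hwq⟩
        · obtain ⟨q, hq, hwq⟩ := k3 w (hw.trans hb.symm)
          exact ⟨q, List.mem_append_right _ hq, hwq⟩
      · intro c k hc hk
        have e1 := h6 c k hc hk
        have e2 := k4 c hc
        have e3 := hk i hi hb
        have e4 := weightIn_nonneg hT hi
        have hcpos : 0 < c := by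
          by_contra! hneg
          have : (k i : ℝ) * c ≤ 0 := mul_nonpos_of_nonneg_of_nonpos (by positivity) hneg
          linarith
        -- The strict inequality between integers yields `g.length ≤ k i`, without rounding loss.
        have e5 : (g.length - 1 : ℝ) < k i := lt_of_mul_lt_mul_right (e2.trans_lt e3) hcpos.le
        have e6 : g.length < k i + 1 := by
          have : (g.length : ℝ) < ((k i + 1 : ℕ) : ℝ) := by push_cast; linarith
          exact_mod_cast this
        rw [List.length_append, Finset.sum_range_succ]; omega
    · simp only [Test.eq_holds, entry_eval, reg_eval, hsi, h1.comp_eq] at hb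
      refine Runs.skip ⟨h1, h2, segs, h3, h4, fun w hw => ?_, fun c k hc hk => ?_⟩
      · rcases Nat.lt_succ_iff_lt_or_eq.1 hw with hw | hw
        · exact h5 w hw
        -- If `i` is not its own label, then no vertex has the label `i`, so skipping it loses
        -- nothing.
        · obtain ⟨r, hr1, hr2⟩ := hT.kruskal.exists_root w
          exact absurd (by rw [← hw, hr1, hr2]) hb
      · have := h6 c k hc hk
        rw [Finset.sum_range_succ]; omega
  · rintro s ⟨h1, h2, segs, h3, h4, h5, h6⟩
    refine Runs.block_nil ⟨segs, h3, h4, fun w => h5 w ?_, ?_⟩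
    · obtain ⟨r, hr1, hr2⟩ := hT.kruskal.exists_root w
      rw [hr1]; exact r.2
    · rintro ⟨c, k, hc, hk, hm⟩
      exact (h6 c k hc hk).trans hm

/-- Rows beyond the number of segments are filled with the one-vertex path at vertex `0`, to reach
exactly `m` paths. -/
theorem runs_save (hm : m ≤ N) {B : ℝ} (hsm : s.idx 1 0 0 = m) (hsB : s.dat 1 0 0 = B)
    {segs : List (List (Fin n))} (hrep : Rep s segs) (hlen : ∀ q ∈ segs, q.length ≤ N)
    (v₀ : Fin n) (hv₀ : (v₀ : ℕ) = 0) :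
    Runs N save s fun s' => s'.idx 19 0 0 = 1 ∧ s'.dat 3 0 0 = B ∧
      Outputs s' fun i : Fin m => segs[(i : ℕ)]?.getD [v₀] := by
  set p : ℕ → List (Fin n) := fun i => segs[i]?.getD [v₀] with hp
  refine Runs.block_cons (Runs.setReg (Runs.block_cons (Runs.setDReg (Runs.block_cons
    (Runs.forUpTo (fun i s => s.idx 1 0 0 = m ∧ s.idx 19 0 0 = 1 ∧ s.dat 3 0 0 = B ∧ Rep s segs ∧
      ∀ k < i, (p k).map Fin.val = (List.range (s.idx 3 k 0)).map (s.idx 4 k)) (K := m) hm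
      (by decide) ?_ ?_ ?_ ?_ ?_)))))
  · refine ⟨?_, ?_, ?_, ?_, by simp⟩
    · simpa [Store.idx_seti_of_ne] using hsm
    · simp [IExp.eval]
    · simpa using hsB
    · refine hrep.congr ?_ ?_ ?_ <;> simp [Store.idx_seti_of_ne]
  · rintro i s x ⟨h1, h2, h3, h4, h5⟩
    refine ⟨by simpa [Store.idx_seti_of_ne] using h1, by simpa [Store.idx_seti_of_ne] using h2, h3,
      ?_, by simpa [Store.idx_seti_of_ne] using h5⟩
    refine h4.congr ?_ ?_ ?_ <;> exact Store.idx_seti_of_ne _ (by decide) _ _ _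
  · rintro i s ⟨h1, -⟩
    exact h1
  · rintro i s hi hsi ⟨h1, h2, h3, h4, h5⟩
    refine Runs.ite (fun hb => ?_) fun hb => ?_
    · simp only [Test.holds, reg_eval, hsi, h4.1] at hb
      have hpi : p i = segs[i] := by simp [hp, hb]
      have hrow := h4.2 i hb
      have hlen' : s.idx 17 i 0 ≤ N := by
        have := congrArg List.length hrow
        simp only [List.length_map, List.length_range] at this
        rw [← this]; exact hlen _ (List.getElem_mem hb)
      -- While row `i` is copied, the segments and all finished rows stay as they are.
      refine Runs.block_cons (Runs.seti (Runs.block_cons (Runs.forUpTo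
        (fun j s' => s'.idx 20 0 0 = i ∧ s'.idx 1 0 0 = m ∧ s'.idx 19 0 0 = 1 ∧ s'.dat 3 0 0 = B ∧
          s'.idx 16 = s.idx 16 ∧ s'.idx 17 = s.idx 17 ∧ s'.idx 18 = s.idx 18 ∧
          (∀ k < i, s'.idx 3 k = s.idx 3 k ∧ s'.idx 4 k = s.idx 4 k) ∧
          s'.idx 3 i 0 = s.idx 17 i 0 ∧ ∀ j' < j, s'.idx 4 i j' = s.idx 18 i j')
        (K := s.idx 17 i 0) hlen' (by decide) ?_ ?_ ?_ ?_ ?_)))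
      · simp only [reg_eval, IExp.eval, hsi]
        refine ⟨?_, ?_, ?_, h3, ?_, ?_, ?_, fun k hk => ⟨?_, ?_⟩, ?_, by simp⟩
        · simpa [Store.idx_seti_of_ne] using hsi
        · simpa [Store.idx_seti_of_ne] using h1
        · simpa [Store.idx_seti_of_ne] using h2
        · simp [Store.idx_seti_of_ne]
        · simp [Store.idx_seti_of_ne]
        · simp [Store.idx_seti_of_ne]
        · exact Store.idx_seti_row_of_ne _ _ hk.ne _ _
        · simp [Store.idx_seti_of_ne]
        · simp
      · rintro j s' x h
        simpa [Store.idx_seti_of_ne] using h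
      · rintro j s' ⟨k1, -, -, -, -, k2, -⟩
        simp [IExp.eval, k1, k2]
      · rintro j s' hj hsj ⟨k1, k2, k3, k4, k5, k6, k7, k8, k9, k10⟩
        refine Runs.seti ?_
        simp only [reg_eval, IExp.eval, k1, hsj, k7]
        refine ⟨by simpa [Store.idx_seti_of_ne] using k1, by simpa [Store.idx_seti_of_ne] using k2,
          by simpa [Store.idx_seti_of_ne] using k3, k4, by simpa [Store.idx_seti_of_ne] using k5,
          by simpa [Store.idx_seti_of_ne] using k6, by simpa [Store.idx_seti_of_ne] using k7,
          fun k hk => ⟨?_, ?_⟩, by simpa [Store.idx_seti_of_ne] using k9, fun j' hj' => ?_⟩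
        · rw [Store.idx_seti_of_ne _ (by decide)]; exact (k8 k hk).1
        · rw [Store.idx_seti_row_of_ne _ _ hk.ne]; exact (k8 k hk).2
        · rw [Store.idx_seti_self]
          split_ifs with he
          · rw [he.2]
          · exact k10 j' (by omega)
      · rintro s' ⟨k1, k2, k3, k4, k5, k6, k7, k8, k9, k10⟩
        refine Runs.block_nil ⟨k2, k3, k4, h4.congr k5 k6 k7, fun k hk => ?_⟩
        rcases Nat.lt_succ_iff_lt_or_eq.1 hk with hk | rfl
        · rw [(k8 k hk).1, (k8 k hk).2]; exact h5 k hk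
        · rw [hpi, hrow, k9]
          exact List.map_congr_left fun j hj => (k10 j (List.mem_range.1 hj)).symm
    · simp only [Test.holds, reg_eval, hsi, h4.1, not_lt] at hb
      have hpi : p i = [v₀] := by simp [hp, hb]
      refine Runs.block_cons (Runs.seti (Runs.block_cons (Runs.seti (Runs.block_nil ?_))))
      simp only [reg_eval, IExp.eval, hsi, ne_eq, Nat.reduceEqDiff, not_false_eq_true,
        Store.idx_seti_of_ne]
      refine ⟨by simpa [Store.idx_seti_of_ne] using h1, by simpa [Store.idx_seti_of_ne] using h2,
        h3, ?_, fun k hk => ?_⟩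
      · refine h4.congr ?_ ?_ ?_ <;> simp [Store.idx_seti_of_ne]
      · rcases Nat.lt_succ_iff_lt_or_eq.1 hk with hk | rfl
        · rw [Store.idx_seti_row_of_ne _ _ hk.ne, Store.idx_seti_row_of_ne _ _ hk.ne,
            Store.idx_seti_of_ne _ (by decide)]
          exact h5 k hk
        · rw [hpi]; simp [hv₀]
  · rintro s ⟨h1, h2, h3, h4, h5⟩
    exact Runs.block_nil ⟨h2, h3, fun i => h5 i i.2⟩

/-! ### The search for a bound -/

/-- If there is any output, then it is a path cover whose cost is at most the recorded bound. -/
def OutInv (R : Roadmap n) (m : ℕ) (s : Store) : Prop :=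
  s.idx 19 0 0 ≠ 0 → ∃ p : Fin m → List (Fin n), Outputs s p ∧ IsPathCover R p ∧
    ∀ i, pathCost R (p i) ≤ s.dat 3 0 0

/-- There is output, and the recorded bound is at most `c`. -/
def BestLE (s : Store) (c : ℝ) : Prop := s.idx 19 0 0 ≠ 0 ∧ s.dat 3 0 0 ≤ c

theorem OutInv.congr {s' : Store} (h : OutInv R m s) (h3 : s'.idx 3 = s.idx 3)
    (h4 : s'.idx 4 = s.idx 4) (h19 : s'.idx 19 = s.idx 19) (hd : s'.dat 3 = s.dat 3) :
    OutInv R m s' := by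
  unfold OutInv Outputs
  rw [h3, h4, h19, hd]
  exact h

theorem BestLE.congr {s' : Store} {c : ℝ} (h : BestLE s c) (h19 : s'.idx 19 = s.idx 19)
    (hd : s'.dat 3 = s.dat 3) : BestLE s' c := by
  rw [BestLE, h19, hd]; exact h

/-- Output is replaced only by output with a smaller bound, so no earlier success is lost. A
feasible bound always ends with a record at most `B`: if its segments are not saved, then the record
was already that good. -/
theorem runs_tryBound (hT : Tours R F comp nxt vert f) (hf : f ≤ N) (hm : m ≤ N) (hn : 0 < n)
    {B : ℝ} (hB : 0 ≤ B) (hs : Holds R m comp nxt vert f s) (hsB : s.dat 1 0 0 = B)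
    (ho : OutInv R m s) :
    Runs N tryBound s fun s' => OutInv R m s' ∧ (∀ c, BestLE s c → BestLE s' c) ∧
      (Feasible R F m comp nxt vert f B → BestLE s' B) := by
  refine Runs.block_cons ((runs_cutAll hT hf hB hs hsB).frame.mono ?_)
  rintro s₁ ⟨⟨segs, h1, h2, h3, h4⟩, hi, hd⟩
  have hs₁ : Holds R m comp nxt vert f s₁ :=
    hs.congr (fun a ha => hi a (by revert a; decide)) (hd 0 (by decide))
  have hB₁ : s₁.dat 1 0 0 = B := by rw [hd 1 (by decide), hsB]
  have ho₁ : OutInv R m s₁ :=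
    ho.congr (hi 3 (by decide)) (hi 4 (by decide)) (hi 19 (by decide)) (hd 3 (by decide))
  have hb₁ : ∀ c, BestLE s c → BestLE s₁ c := fun c h =>
    h.congr (hi 19 (by decide)) (hd 3 (by decide))
  refine Runs.block_cons (Runs.ite (fun hb => ?_) fun hb => ?_)
  · simp only [Test.holds, Test.or_holds, Test.eq_holds, reg_eval, dreg_eval, IExp.eval, hs₁.m_eq,
      h1.1, not_lt, hB₁] at hb
    refine (runs_save hm hs₁.m_eq hB₁ h1 (fun q hq => (h2 q hq).length_le.trans hf) ⟨0, hn⟩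
      rfl).mono ?_
    rintro s₂ ⟨k1, k2, k3⟩
    refine Runs.block_nil ⟨fun _ => ⟨_, k3, ⟨fun i => ?_, fun v => ?_⟩, fun i => ?_⟩,
      fun c hc => ⟨by rw [k1]; simp, ?_⟩, fun _ => ⟨by rw [k1]; simp, k2.le⟩⟩
    · rcases lt_or_ge (i : ℕ) segs.length with hi | hi
      · simpa [hi] using (h2 _ (List.getElem_mem hi)).isPath
      · simp only [List.getElem?_eq_none hi, Option.getD_none]
        exact ⟨by simp, by simp⟩
    · obtain ⟨q, hq, hv⟩ := h3 v
      obtain ⟨i, hi, rfl⟩ := List.getElem_of_mem hq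
      exact ⟨⟨i, hi.trans_le hb.1⟩, by simpa [hi] using hv⟩
    · rw [k2]
      rcases lt_or_ge (i : ℕ) segs.length with hi | hi
      · simpa [hi] using (h2 _ (List.getElem_mem hi)).cost_le
      · simpa [hi, pathCost] using hB
    · have := hb₁ c hc
      rw [k2]
      rcases hb.2 with hb | hb
      · exact absurd hb this.1
      · exact hb.le.trans this.2
  · simp only [Test.holds, Test.or_holds, Test.eq_holds, reg_eval, dreg_eval, IExp.eval, hs₁.m_eq,
      h1.1, not_lt, hB₁, not_and, not_or] at hb
    refine Runs.skip (Runs.block_nil ⟨ho₁, hb₁, fun hF => ?_⟩)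
    -- With few enough segments, the failed test says that there is output with a bound at most `B`,
    -- which is `BestLE`.
    exact hb (h4 hF)

theorem tourCost_nonneg (R : Roadmap n) (nxt vert : ℕ → ℕ) (i j : ℕ) :
    0 ≤ tourCost R nxt vert i j :=
  Finset.sum_nonneg fun _ _ => lenN_nonneg R _ _

/-- The state during the search, which began in the state `s₀`. -/
structure SearchInv (R : Roadmap n) (m : ℕ) (comp nxt vert : ℕ → ℕ) (f : ℕ) (s₀ s : Store) :
    Prop where
  holds : Holds R m comp nxt vert f s
  out : OutInv R m s
  best : ∀ c, BestLE s₀ c → BestLE s c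

theorem SearchInv.seti {s₀ : Store} (h : SearchInv R m comp nxt vert f s₀ s) {a : ℕ}
    (ha : a ∉ [0, 1, 2, 3, 4, 5, 6, 7, 8, 19]) (i j x : ℕ) :
    SearchInv R m comp nxt vert f s₀ (s.seti a i j x) := by
  have hne : ∀ b ∈ [0, 1, 2, 3, 4, 5, 6, 7, 8, 19], (s.seti a i j x).idx b = s.idx b :=
    fun b hb => s.idx_seti_of_ne (by rintro rfl; exact ha hb) i j x
  refine ⟨h.holds.congr (fun b hb => hne b ?_) rfl, h.out.congr (hne 3 (by decide))
    (hne 4 (by decide)) (hne 19 (by decide)) rfl, fun c hc => (h.best c hc).congr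
    (hne 19 (by decide)) rfl⟩
  revert b; decide

theorem SearchInv.setd {s₀ : Store} (h : SearchInv R m comp nxt vert f s₀ s) {a : ℕ}
    (h0 : a ≠ 0) (h3 : a ≠ 3) (i j : ℕ) (x : ℝ) :
    SearchInv R m comp nxt vert f s₀ (s.setd a i j x) :=
  ⟨h.holds.setd h0 _ _ _, h.out.congr rfl rfl rfl (s.dat_setd_of_ne h3.symm _ _ _),
    fun c hc => (h.best c hc).congr rfl (s.dat_setd_of_ne h3.symm _ _ _)⟩

theorem BestLE.seti {c : ℝ} (h : BestLE s c) {a : ℕ} (ha : a ≠ 19) (i j x : ℕ) :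
    BestLE (s.seti a i j x) c :=
  h.congr (s.idx_seti_of_ne ha.symm _ _ _) rfl

theorem BestLE.setd {c : ℝ} (h : BestLE s c) {a : ℕ} (ha : a ≠ 3) (i j : ℕ) (x : ℝ) :
    BestLE (s.setd a i j x) c :=
  h.congr rfl (s.dat_setd_of_ne ha.symm _ _ _)

/-- The inner loop keeps the node reached after `j` steps from `i` and the cost of these steps. The
bound is tried before it is extended, so the trivial part with `j = 0` is included. -/
theorem runs_tryBounds (hT : Tours R F comp nxt vert f) (hf : f ≤ N) (hm : m ≤ N) (hn : 0 < n)
    (hs : Holds R m comp nxt vert f s) (ho : OutInv R m s) :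
    Runs N tryBounds s fun s' => SearchInv R m comp nxt vert f s s' ∧
      ∀ i < f, ∀ j < f, Feasible R F m comp nxt vert f (tourCost R nxt vert i j) →
        BestLE s' (tourCost R nxt vert i j) := by
  refine Runs.forUpTo (fun i s' => SearchInv R m comp nxt vert f s s' ∧
      ∀ i' < i, ∀ j < f, Feasible R F m comp nxt vert f (tourCost R nxt vert i' j) →
        BestLE s' (tourCost R nxt vert i' j)) (K := f) hf (by decide)
    ⟨⟨hs, ho, fun _ => id⟩, by simp⟩ ?_ ?_ ?_ fun _ => id
  · rintro i s' x ⟨h1, h2⟩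
    exact ⟨h1.seti (by decide) _ _ _, fun i' hi' j hj hF =>
      (h2 i' hi' j hj hF).seti (by decide) _ _ _⟩
  · rintro i s' ⟨h1, -⟩
    exact h1.holds.f_eq
  rintro i s₁ hi hsi ⟨h1, h2⟩
  refine Runs.block_cons (Runs.setReg (Runs.block_cons (Runs.setDReg (Runs.block_cons
    (Runs.forUpTo (fun j s' => SearchInv R m comp nxt vert f s s' ∧
      s'.idx 12 0 0 = nxt^[j] i ∧ s'.dat 1 0 0 = tourCost R nxt vert i j ∧
      (∀ i' < i, ∀ j < f, Feasible R F m comp nxt vert f (tourCost R nxt vert i' j) →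
        BestLE s' (tourCost R nxt vert i' j)) ∧
      ∀ j' < j, Feasible R F m comp nxt vert f (tourCost R nxt vert i j') →
        BestLE s' (tourCost R nxt vert i j')) (K := f) hf (by decide) ?_ ?_ ?_ ?_ ?_)))))
  · refine ⟨(h1.seti (by decide) _ _ _).setd (by decide) (by decide) _ _ _, by simp [hsi],
      by simp [tourCost, DExp.eval], fun i' hi' j hj hF =>
      ((h2 i' hi' j hj hF).seti (by decide) _ _ _).setd (by decide) _ _ _, by simp⟩
  · rintro j s' x ⟨k1, k2, k3, k4, k5⟩
    exact ⟨k1.seti (by decide) _ _ _, by simpa [Store.idx_seti_of_ne] using k2, k3,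
      fun i' hi' j hj hF => (k4 i' hi' j hj hF).seti (by decide) _ _ _,
      fun j' hj' hF => (k5 j' hj' hF).seti (by decide) _ _ _⟩
  · rintro j s' ⟨k1, -⟩
    exact k1.holds.f_eq
  · rintro j s₂ hj hsj ⟨k1, k2, k3, k4, k5⟩
    refine Runs.block_cons ((runs_tryBound hT hf hm hn (tourCost_nonneg R nxt vert i j) k1.holds k3
      k1.out).frame.mono ?_)
    rintro s₃ ⟨⟨l1, l2, l3⟩, hi', hd'⟩
    have hH : SearchInv R m comp nxt vert f s s₃ :=
      ⟨k1.holds.congr (fun a ha => hi' a (by revert a; decide)) (hd' 0 (by decide)), l1,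
        fun c hc => l2 c (k1.best c hc)⟩
    have h12 : s₃.idx 12 0 0 = nxt^[j] i := by rw [hi' 12 (by decide), k2]
    have hd1 : s₃.dat 1 0 0 = tourCost R nxt vert i j := by rw [hd' 1 (by decide), k3]
    refine Runs.block_cons (Runs.setDReg (Runs.block_cons (Runs.setReg (Runs.block_nil ?_))))
    refine ⟨(hH.setd (by decide) (by decide) _ _ _).seti (by decide) _ _ _, ?_, ?_, ?_, ?_⟩
    · simp [h12, hH.holds.nxt_eq, Function.iterate_succ_apply']
    · simp only [Store.dat_seti, Store.dat_setd_cell, DExp.eval, dreg_eval, entry_eval, reg_eval,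
        h12, hd1, hH.holds.nxt_eq, hH.holds.vert_eq, hH.holds.len_eq]
      rw [tourCost, tourCost, Finset.sum_range_succ, Function.iterate_succ_apply']
    · exact fun i' hi' j hj hF =>
        ((l2 _ (k4 i' hi' j hj hF)).setd (by decide) _ _ _).seti (by decide) _ _ _
    · intro j' hj' hF
      refine BestLE.seti (BestLE.setd ?_ (by decide) _ _ _) (by decide) _ _ _
      rcases Nat.lt_succ_iff_lt_or_eq.1 hj' with hj' | rfl
      · exact l2 _ (k5 j' hj' hF)
      · exact l3 hF
  · rintro s' ⟨k1, k2, k3, k4, k5⟩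
    refine Runs.block_nil ⟨k1, fun i' hi' => ?_⟩
    rcases Nat.lt_succ_iff_lt_or_eq.1 hi' with hi' | rfl
    · exact k4 i' hi'
    · exact k5

end Search

end Patrol

namespace Patrol

variable {n m : ℕ}

section Main

variable {R : Roadmap n} {F : List (Fin n × Fin n)} {comp nxt vert : ℕ → ℕ} {f N : ℕ} {s : Store}

/-! ### Joining components -/

theorem Runs.setReg_of_eval {Q : Store → Prop} {a y : ℕ} {e : IExp} (he : e.eval s = y)
    (h : Q (s.seti a 0 0 y)) : Runs N (Patrol.setReg a e) s Q :=
  Runs.setReg (he ▸ h)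

theorem Runs.setEntry_of_eval {Q : Store → Prop} {a x y : ℕ} {i e : IExp} (hi : i.eval s = x)
    (he : e.eval s = y) (h : Q (s.seti a 0 x y)) : Runs N (Patrol.setEntry a i e) s Q :=
  Runs.setEntry (by rw [hi, he]; exact h)

theorem input_adj_pos (R : Roadmap n) (m : ℕ) (u v : Fin n) :
    0 < (input R m).idx 2 u v ↔ R.graph.Adj u v := by
  by_cases h : R.graph.Adj u v <;> simp [input, h]

/-- The registers hold a shortest edge between different components, among the pairs in `D`. -/
def EdgeInv (R : Roadmap n) (comp : ℕ → ℕ) (D : Fin n → Fin n → Prop) (s : Store) : Prop :=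
  (s.idx 24 0 0 = 0 ∧ ∀ u v, D u v → R.graph.Adj u v → ¬ comp u < comp v) ∨
  (s.idx 24 0 0 ≠ 0 ∧ ∃ a b : Fin n, s.idx 22 0 0 = a ∧ s.idx 23 0 0 = b ∧ R.graph.Adj a b ∧
    comp a < comp b ∧ ∀ u v, D u v → R.graph.Adj u v → comp u < comp v → R.len a b ≤ R.len u v)

theorem EdgeInv.congr {D D' : Fin n → Fin n → Prop} {s' : Store} (h : EdgeInv R comp D s)
    (hD : ∀ u v, D' u v → R.graph.Adj u v → comp u < comp v → D u v)
    (h22 : s'.idx 22 = s.idx 22) (h23 : s'.idx 23 = s.idx 23) (h24 : s'.idx 24 = s.idx 24) :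
    EdgeInv R comp D' s' := by
  rw [EdgeInv, h22, h23, h24]
  rcases h with ⟨h1, h2⟩ | ⟨h1, a, b, h2, h3, h4, h5, h6⟩
  · exact Or.inl ⟨h1, fun u v hu ha hc => h2 u v (hD u v hu ha hc) ha hc⟩
  · exact Or.inr ⟨h1, a, b, h2, h3, h4, h5, fun u v hu ha hc => h6 u v (hD u v hu ha hc) ha hc⟩

/-- All ordered pairs are scanned, so demanding `comp u < comp v` instead of inequality still meets
each edge between components in one of its orientations. -/
theorem runs_findEdge (hs : Holds R m comp nxt vert f s) (hn : n ≤ N) :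
    Runs N findEdge s fun s' => EdgeInv R comp (fun _ _ => True) s' := by
  refine Runs.block_cons (Runs.setReg (Runs.block_cons (Runs.forUpTo
    (fun i s => Holds R m comp nxt vert f s ∧ EdgeInv R comp (fun u _ => (u : ℕ) < i) s)
    (K := n) hn (by decide) ?_ ?_ ?_ ?_ ?_)))
  · exact ⟨hs.seti (by decide) _ _ _, Or.inl ⟨by simp [IExp.eval], by simp⟩⟩
  · rintro i s x ⟨h1, h2⟩
    exact ⟨h1.seti (by decide) _ _ _, h2.congr (fun _ _ h _ _ => h)
      (s.idx_seti_of_ne (by decide) _ _ _) (s.idx_seti_of_ne (by decide) _ _ _)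
      (s.idx_seti_of_ne (by decide) _ _ _)⟩
  · rintro i s ⟨h1, -⟩
    exact h1.n_eq
  · rintro i s hi hsi ⟨h1, h2⟩
    refine Runs.forUpTo (fun j s => Holds R m comp nxt vert f s ∧ s.idx 20 0 0 = i ∧
      EdgeInv R comp (fun u v => (u : ℕ) < i ∨ (u : ℕ) = i ∧ (v : ℕ) < j) s) (K := n) hn (by decide)
      ⟨h1, hsi, h2.congr (fun u v h _ _ => by simpa using h) rfl rfl rfl⟩ ?_ ?_ ?_ ?_
    · rintro j s x ⟨h1, h2, h3⟩
      exact ⟨h1.seti (by decide) _ _ _, by rwa [s.idx_seti_of_ne (by decide)],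
        h3.congr (fun _ _ h _ _ => h)
        (s.idx_seti_of_ne (by decide) _ _ _) (s.idx_seti_of_ne (by decide) _ _ _)
        (s.idx_seti_of_ne (by decide) _ _ _)⟩
    · rintro i s ⟨h1, -⟩
      exact h1.n_eq
    · rintro j s hj hsj ⟨h1, h2, h3⟩
      have hadj : 0 < (input R m).idx 2 i j ↔ R.graph.Adj ⟨i, hi⟩ ⟨j, hj⟩ :=
        input_adj_pos R m ⟨i, hi⟩ ⟨j, hj⟩
      have hlt : ∀ u v : Fin n, ((u : ℕ) < i ∨ (u : ℕ) = i ∧ (v : ℕ) < j + 1) →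
          ((u : ℕ) < i ∨ (u : ℕ) = i ∧ (v : ℕ) < j) ∨ (u = ⟨i, hi⟩ ∧ v = ⟨j, hj⟩) := by
        intro u v huv
        simp only [Fin.ext_iff]; omega
      refine Runs.ite (fun hb => ?_) fun hb => ?_
      · simp only [Test.holds, Test.or_holds, Test.eq_holds, IExp.eval, DExp.eval, reg_eval,
          entry_eval, h1.adj_eq, h1.comp_eq, h1.len_eq, h2, hsj, hadj] at hb
        obtain ⟨hb1, hb2, hb3⟩ := hb
        refine Runs.block_cons (Runs.setReg (Runs.block_cons (Runs.setReg (Runs.block_cons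
          (Runs.setReg (Runs.block_nil ⟨?_, ?_, Or.inr ⟨?_, ⟨i, hi⟩, ⟨j, hj⟩, ?_, ?_, hb1, hb2,
            fun u v huv ha hc => ?_⟩⟩))))))
        · exact ((h1.seti (by decide) _ _ _).seti (by decide) _ _ _).seti (by decide) _ _ _
        · simpa [Store.idx_seti_of_ne] using h2
        · simp [IExp.eval]
        · simp [Store.idx_seti_of_ne, h2]
        · simp [Store.idx_seti_of_ne, hsj]
        · rcases hlt u v huv with huv | ⟨rfl, rfl⟩
          · rcases h3 with ⟨k1, k2⟩ | ⟨k1, a, b, k2, k3, k4, k5, k6⟩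
            · exact absurd hc (k2 u v huv ha)
            · rcases hb3 with hb3 | hb3
              · exact absurd hb3 k1
              · rw [k2, k3, lenN_of_adj k4, lenN_of_adj hb1] at hb3
                exact hb3.le.trans (k6 u v huv ha hc)
          · exact le_rfl
      · simp only [Test.holds, Test.or_holds, Test.eq_holds, IExp.eval, DExp.eval, reg_eval,
          entry_eval, h1.adj_eq, h1.comp_eq, h1.len_eq, h2, hsj, hadj] at hb
        refine Runs.skip ⟨h1, h2, ?_⟩
        rcases h3 with ⟨k1, k2⟩ | ⟨k1, a, b, k2, k3, k4, k5, k6⟩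
        · refine Or.inl ⟨k1, fun u v huv ha hc => ?_⟩
          rcases hlt u v huv with huv | ⟨rfl, rfl⟩
          · exact k2 u v huv ha hc
          · exact hb ⟨ha, hc, Or.inl k1⟩
        · refine Or.inr ⟨k1, a, b, k2, k3, k4, k5, fun u v huv ha hc => ?_⟩
          rcases hlt u v huv with huv | ⟨rfl, rfl⟩
          · exact k6 u v huv ha hc
          · by_contra! hlt
            refine hb ⟨ha, hc, Or.inr ?_⟩
            rw [k2, k3, lenN_of_adj k4, lenN_of_adj ha]
            exact hlt
    · rintro s ⟨h1, h2, h3⟩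
      refine ⟨h1, h3.congr (fun u v h _ _ => ?_) rfl rfl rfl⟩
      have := v.2
      omega
  · rintro s ⟨h1, h2⟩
    exact Runs.block_nil (h2.congr (fun u v _ _ _ => u.2) rfl rfl rfl)

/-- The order of the assignments matters: the labels of `a` and `b` are saved before relabelling,
which may overwrite the label it compares with, and the new nodes copy the old successors before `a`
and `b` are redirected. -/
theorem runs_mergeTours (hT : Tours R F comp nxt vert f) (hs : Holds R m comp nxt vert f s)
    (hn : n ≤ N) {a b : Fin n} (ha : s.idx 22 0 0 = a) (hb : s.idx 23 0 0 = b)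
    (hadj : R.graph.Adj a b) (hne : comp a ≠ comp b)
    (hmin : ∀ u v : Fin n, R.graph.Adj u v → comp u ≠ comp v → R.len a b ≤ R.len u v) :
    Runs N mergeTours s fun s' => ∃ comp' nxt' vert',
      Holds R m comp' nxt' vert' (f + 2) s' ∧
      Tours R ((a, b) :: F) comp' nxt' vert' (f + 2) := by
  have hnf : n ≤ f := by rw [hT.fresh]; omega
  have haf : (a : ℕ) < f := a.2.trans_le hnf
  have hbf : (b : ℕ) < f := b.2.trans_le hnf
  have hab : (a : ℕ) ≠ b := fun h => hne (by rw [h])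
  refine Runs.block_cons (Runs.setReg (Runs.block_cons (Runs.setReg (Runs.block_cons ?_))))
  set s₁ := (s.seti 25 0 0 ((entry 5 (reg 22)).eval s)) with hs₁
  set s₂ := (s₁.seti 26 0 0 ((entry 5 (reg 23)).eval s₁)) with hs₂
  have hH₂ : Holds R m comp nxt vert f s₂ :=
    (hs.seti (by decide) _ _ _).seti (by decide) _ _ _
  have h25 : s₂.idx 25 0 0 = comp a := by
    simp [hs₂, hs₁, Store.idx_seti_of_ne, hs.comp_eq, ha]
  have h26 : s₂.idx 26 0 0 = comp b := by
    simp [hs₂, hs₁, Store.idx_seti_of_ne, hs.comp_eq, hb]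
  have ha₂ : s₂.idx 22 0 0 = a := by simpa [hs₂, hs₁, Store.idx_seti_of_ne] using ha
  have hb₂ : s₂.idx 23 0 0 = b := by simpa [hs₂, hs₁, Store.idx_seti_of_ne] using hb
  have hrelabel : Runs N (forUpTo 20 (reg 0)
      (.ite (.eq (entry 5 (reg 20)) (reg 26)) (setEntry 5 (reg 20) (reg 25)) .skip)) s₂ fun s' =>
      s'.idx 5 0 = fun v => if v < n ∧ comp v = comp b then comp a else comp v := by
    -- After `i` iterations precisely the vertices below `i` carry their new labels.
    refine Runs.forUpTo (fun i s' => s'.idx 0 0 0 = n ∧ s'.idx 25 0 0 = comp a ∧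
      s'.idx 26 0 0 = comp b ∧
      s'.idx 5 0 = fun v => if v < i ∧ comp v = comp b then comp a else comp v) (K := n) hn
      (by decide) ⟨hH₂.n_eq, h25, h26, by simp [hH₂.comp_eq]⟩ ?_ (fun i s h => h.1) ?_
      fun s h => h.2.2.2
    · rintro i s x h
      simpa [Store.idx_seti_of_ne] using h
    · rintro i s hi hsi ⟨k1, k2, k3, k4⟩
      have k5 : s.idx 5 0 i = comp i := by simp [k4]
      refine Runs.ite (fun hb => ?_) fun hb => ?_
      · simp only [Test.eq_holds, entry_eval, reg_eval, hsi, k5, k3] at hb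
        refine Runs.setEntry ⟨?_, ?_, ?_, ?_⟩
        · simpa [Store.idx_seti_of_ne] using k1
        · simpa [Store.idx_seti_of_ne] using k2
        · simpa [Store.idx_seti_of_ne] using k3
        · rw [Store.idx_seti_row, k4]
          funext v
          simp only [reg_eval, hsi, k2, Function.update_apply]
          by_cases hv : v = i
          · subst hv; simp [hb]
          · have : v < i + 1 ↔ v < i := by omega
            simp [hv, this]
      · simp only [Test.eq_holds, entry_eval, reg_eval, hsi, k5, k3] at hb
        refine Runs.skip ⟨k1, k2, k3, ?_⟩
        rw [k4]
        funext v
        by_cases hv : v = i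
        · subst hv; simp [hb]
        · have : v < i + 1 ↔ v < i := by omega
          simp [this]
  refine hrelabel.frame.mono ?_
  rintro s₃ ⟨h5, hi₃, hd₃⟩
  have hi₃' : ∀ c, c ≠ 5 → c ≠ 20 → s₃.idx c = s₂.idx c := fun c h1 h2 => hi₃ c (by
    simp [forUpTo, setReg, setEntry, Prog.iwrites, h1, h2])
  have ha₃ : s₃.idx 22 0 0 = a := by rw [hi₃' 22 (by decide) (by decide), ha₂]
  have hb₃ : s₃.idx 23 0 0 = b := by rw [hi₃' 23 (by decide) (by decide), hb₂]
  have hf₃ : s₃.idx 8 0 0 = f := by rw [hi₃' 8 (by decide) (by decide), hH₂.f_eq]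
  have hn₃ : s₃.idx 6 0 = nxt := by rw [hi₃' 6 (by decide) (by decide), hH₂.nxt_eq]
  have hv₃ : s₃.idx 7 0 = vert := by rw [hi₃' 7 (by decide) (by decide), hH₂.vert_eq]
  have hne1 : (a : ℕ) ≠ f := haf.ne
  have hne2 : (b : ℕ) ≠ f := hbf.ne
  have hne3 : (a : ℕ) ≠ f + 1 := by omega
  have hne4 : (b : ℕ) ≠ f + 1 := by omega
  refine Runs.block_cons (Runs.setEntry_of_eval (x := f) (y := b) hf₃ hb₃ ?_)
  refine Runs.block_cons (Runs.setEntry_of_eval (x := f + 1) (y := a)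
    (by simp [IExp.eval, Store.idx_seti_of_ne, hf₃]) (by simp [Store.idx_seti_of_ne, ha₃]) ?_)
  refine Runs.block_cons (Runs.setEntry_of_eval (x := f) (y := nxt b)
    (by simp [Store.idx_seti_of_ne, hf₃]) (by simp [Store.idx_seti_of_ne, hb₃, hn₃]) ?_)
  refine Runs.block_cons (Runs.setEntry_of_eval (x := f + 1) (y := nxt a)
    (by simp [IExp.eval, Store.idx_seti_of_ne, hf₃])
    (by simp [Store.idx_seti_of_ne, Store.idx_seti_row, ha₃, hn₃, hne1]) ?_)
  refine Runs.block_cons (Runs.setEntry_of_eval (x := a) (y := f)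
    (by simp [Store.idx_seti_of_ne, ha₃]) (by simp [Store.idx_seti_of_ne, hf₃]) ?_)
  refine Runs.block_cons (Runs.setEntry_of_eval (x := b) (y := f + 1)
    (by simp [Store.idx_seti_of_ne, hb₃]) (by simp [IExp.eval, Store.idx_seti_of_ne, hf₃]) ?_)
  refine Runs.block_cons (Runs.setReg_of_eval (y := f + 2)
    (by simp [IExp.eval, Store.idx_seti_of_ne, hf₃]) (Runs.block_nil ?_))
  refine ⟨_, _, _, ⟨?_, ?_, ?_, ?_, rfl, rfl, rfl, by simp⟩, hT.merge hadj hne hmin ?_ ?_ ?_ ?_ ?_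
    ?_ ?_ ?_ ?_⟩
  · simp [Store.idx_seti_of_ne, hi₃', hH₂.n_eq]
  · simp [Store.idx_seti_of_ne, hi₃', hH₂.m_eq]
  · simp [Store.idx_seti_of_ne, hi₃', hH₂.adj_eq]
  · simp only [Store.dat_seti]
    rw [hd₃ 0 (by decide), hH₂.len_eq]
  · intro v
    simp [Store.idx_seti_of_ne, h5, mergeLabel]
  all_goals simp only [ne_eq, Nat.reduceEqDiff, not_false_eq_true,
    Store.idx_seti_of_ne, Store.idx_seti_row, hn₃, hv₃, Function.update_apply]
  · simp [hne1.symm, hne2.symm]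
  · simp [hne3.symm, hne4.symm]
  · simp [hab]
  · simp
  · intro y hy h1 h2
    have h3 : y ≠ f + 1 := by omega
    simp [h1, h2, hy.ne, h3]
  · simp
  · simp
  · intro y hy
    have h3 : y ≠ f + 1 := by omega
    simp [hy.ne, h3]

/-! ### The approximation guarantee -/

/-- Paths of cost zero are single vertices, and `m` of them cannot cover `n > m` vertices.
Positivity makes the inequality `(4k - 2) c < k · 4c` strict. -/
theorem coverCost_pos {p : Fin m → List (Fin n)} (hp : IsPathCover R p) (hmn : m < n) :
    0 < coverCost R p := by
  by_contra! hle
  have hsingle : ∀ i, ∃ v, p i = [v] := fun i =>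
    (hp.1 i).eq_singleton_or_cost_pos.resolve_right fun h =>
      absurd (h.trans_le (le_coverCost R p i)) (not_lt.2 hle)
  choose g hg using hp.2
  have hinj : Function.Injective g := fun u v huv => by
    obtain ⟨w, hw⟩ := hsingle (g u)
    have hu := hg u
    have hv := hg v
    rw [← huv] at hv
    rw [hw, List.mem_singleton] at hu hv
    rw [hu, hv]
  have := Fintype.card_le_of_injective g hinj
  simp only [Fintype.card_fin] at this
  omega

/-- When all edges up to the cost of a path cover have been used, four times this cost is enough to
cut the tours into `m` segments. -/
theorem exists_feasible (hT : Tours R F comp nxt vert f) (hmn : m < n)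
    {p : Fin m → List (Fin n)} (hp : IsPathCover R p)
    (hF : ∀ e ∈ F, R.len e.1 e.2 ≤ coverCost R p)
    (hcross : ∀ u v : Fin n, R.graph.Adj u v → comp u ≠ comp v → coverCost R p < R.len u v) :
    ∃ i < f, ∃ j < f, Feasible R F m comp nxt vert f (tourCost R nxt vert i j) ∧
      tourCost R nxt vert i j ≤ 4 * coverCost R p := by
  classical
  set c := coverCost R p with hc
  have hcpos : 0 < c := coverCost_pos hp hmn
  have hf : 0 < f := by rw [hT.fresh]; omega
  -- The bound is the largest cost of a part of a tour that does not exceed `4 * c`; being largest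
  -- makes it tight for `4 * c`. The empty part shows that there is one.
  obtain ⟨⟨i, j⟩, hij, hmax⟩ := Finset.exists_max_image
    ((Finset.range f ×ˢ Finset.range f).filter fun x => tourCost R nxt vert x.1 x.2 ≤ 4 * c)
    (fun x => tourCost R nxt vert x.1 x.2)
    ⟨(0, 0), Finset.mem_filter.2 ⟨by simp [hf], by simpa [tourCost] using hcpos.le⟩⟩
  simp only [Finset.mem_filter, Finset.mem_product, Finset.mem_range] at hij hmax
  -- The component labelled `r` may use as many segments as there are paths starting in it.
  refine ⟨i, hij.1.1, j, hij.1.2, ⟨4 * c, fun r => (Finset.univ.filter fun i : Fin m =>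
    comp ((p i).head (hp.1 i).1) = r).card, ?_, ?_, ?_⟩, hij.2⟩
  · exact fun i' hi' j' hj' hle => hmax (i', j') ⟨⟨hi', hj'⟩, hle⟩
  · intro r hr hroot
    have key := hT.kruskal.weightIn_le (c := c) hF hcross hp (le_coverCost R p) ⟨r, hr⟩
      (I := Finset.univ.filter fun i : Fin m => comp ((p i).head (hp.1 i).1) = r) ?_
    · simp only at key
      linarith
    -- A path that meets the component lies in it entirely, so its first vertex has the label `r` as
    -- well.
    · intro i v hv hcv
      simp only at hcv
      have hS : ∀ u v : Fin n, R.graph.Adj u v → R.len u v ≤ c →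
          (comp u = comp r ↔ comp v = comp r) := by
        intro u v huv hle
        by_cases he : comp u = comp v
        · rw [he]
        · exact absurd (hcross u v huv he) (not_lt.2 hle)
      obtain ⟨u, l, hul⟩ := List.exists_cons_of_ne_nil (hp.1 i).1
      have h1 := (IsPath.forall_mem_iff hS (hul ▸ (hp.1 i).2) (hul ▸ le_coverCost R p i) v
        (hul ▸ hv)).1 hcv
      simp only [Finset.mem_filter, Finset.mem_univ, true_and, hul, List.head_cons]
      rw [h1, hroot]
  -- Every path starts in exactly one component, so the allowances add up to `m`.
  · have := Finset.card_eq_sum_card_fiberwise (s := (Finset.univ : Finset (Fin m)))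
      (t := Finset.range n) (f := fun i => comp ((p i).head (hp.1 i).1)) (fun i _ => by
        obtain ⟨r, hr, -⟩ := hT.kruskal.exists_root ((p i).head (hp.1 i).1)
        simp only [Finset.coe_range, Set.mem_Iio]
        rw [hr]; exact r.2)
    rw [← this]; simp

/-- The state after `t` rounds: for every path cover, either the output is good enough, or the `t`
edges of the forest are no longer than the cost of the cover. -/
def RoundInv (R : Roadmap n) (m t : ℕ) (s : Store) : Prop :=
  ∃ F comp nxt vert f, Holds R m comp nxt vert f s ∧ Tours R F comp nxt vert f ∧ OutInv R m s ∧
    ∀ p : Fin m → List (Fin n), IsPathCover R p → BestLE s (4 * coverCost R p) ∨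
      (F.length = t ∧ ∀ e ∈ F, R.len e.1 e.2 ≤ coverCost R p)

/-- For each cover separately: either an edge between components is at most as long as its cost, and
then so is the shortest one, which is added; or there is no such edge, and this very round has tried
a feasible bound of at most four times the cost. -/
theorem runs_round (hn : 0 < n) (hmn : m < n) {t : ℕ} (h : RoundInv R m t s) :
    Runs (3 * n) (block [tryBounds, findEdge, .ite (.ilt (.lit 0) (reg 24)) mergeTours .skip]) s
      (RoundInv R m (t + 1)) := by
  obtain ⟨F, comp, nxt, vert, f, h1, h2, h3, h4⟩ := h
  have hf : f ≤ 3 * n := by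
    have := h2.kruskal.length_lt hn
    rw [h2.fresh]; omega
  refine Runs.block_cons ((runs_tryBounds h2 hf (by omega) hn h1 h3).mono ?_)
  rintro s₁ ⟨k1, k2⟩
  refine Runs.block_cons ((runs_findEdge k1.holds (by omega)).frame.mono ?_)
  rintro s₂ ⟨l1, l2, l3⟩
  have hH₂ : Holds R m comp nxt vert f s₂ :=
    k1.holds.congr (fun a ha => l2 a (by revert a; decide)) (l3 0 (by decide))
  have ho₂ : OutInv R m s₂ := k1.out.congr (l2 3 (by decide)) (l2 4 (by decide))
    (l2 19 (by decide)) (l3 3 (by decide))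
  have hb₂ : ∀ c, BestLE s₁ c → BestLE s₂ c := fun c hc =>
    hc.congr (l2 19 (by decide)) (l3 3 (by decide))
  have hgood : ∀ p : Fin m → List (Fin n), IsPathCover R p → BestLE s₂ (4 * coverCost R p) ∨
      (F.length = t ∧ (∀ e ∈ F, R.len e.1 e.2 ≤ coverCost R p) ∧
        ∃ u v : Fin n, R.graph.Adj u v ∧ comp u ≠ comp v ∧ R.len u v ≤ coverCost R p) := by
    intro p hp
    rcases h4 p hp with h | ⟨hl, hF⟩
    · exact Or.inl (hb₂ _ (k1.best _ h))
    · by_cases hcross : ∃ u v : Fin n, R.graph.Adj u v ∧ comp u ≠ comp v ∧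
          R.len u v ≤ coverCost R p
      · exact Or.inr ⟨hl, hF, hcross⟩
      · push Not at hcross
        obtain ⟨i, hi, j, hj, hfe, hle⟩ := exists_feasible h2 hmn hp hF hcross
        have := k2 i hi j hj hfe
        exact Or.inl (hb₂ _ ⟨this.1, this.2.trans hle⟩)
  rcases l1 with ⟨hflag, hnone⟩ | ⟨hflag, a, b, ha, hb, hadj, hlt, hmin⟩
  · refine Runs.block_cons (Runs.ite (fun hb => ?_) fun _ => Runs.skip (Runs.block_nil ?_))
    · simp [Test.holds, IExp.eval, hflag] at hb
    -- If no edge joins two components, the forest stops growing, but then the second alternative is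
    -- excluded for every cover.
    · refine ⟨F, comp, nxt, vert, f, hH₂, h2, ho₂, fun p hp => Or.inl ?_⟩
      rcases hgood p hp with h | ⟨-, -, u, v, huv, hne, -⟩
      · exact h
      · rcases lt_or_gt_of_ne hne with h | h
        · exact absurd h (hnone u v trivial huv)
        · exact absurd h (hnone v u trivial huv.symm)
  · have hmin' : ∀ u v : Fin n, R.graph.Adj u v → comp u ≠ comp v → R.len a b ≤ R.len u v := by
      intro u v huv hne
      rcases lt_or_gt_of_ne hne with h | h
      · exact hmin u v trivial huv h
      · rw [R.len_symm u v huv]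
        exact hmin v u trivial huv.symm h
    refine Runs.block_cons (Runs.ite (fun _ => ?_) fun hb => ?_)
    · refine (runs_mergeTours h2 hH₂ (by omega) ha hb hadj hlt.ne hmin').frame.mono ?_
      rintro s₃ ⟨⟨comp', nxt', vert', hH₃, hT₃⟩, l2', l3'⟩
      refine Runs.block_nil ⟨(a, b) :: F, comp', nxt', vert', f + 2, hH₃, hT₃,
        ho₂.congr (l2' 3 (by decide)) (l2' 4 (by decide)) (l2' 19 (by decide)) (l3' 3 (by decide)),
        fun p hp => ?_⟩
      rcases hgood p hp with h | ⟨hl, hF, u, v, huv, hne, hle⟩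
      · exact Or.inl (h.congr (l2' 19 (by decide)) (l3' 3 (by decide)))
      · refine Or.inr ⟨by simp [hl], fun e he => ?_⟩
        rcases List.mem_cons.1 he with rfl | he
        · exact (hmin' u v huv hne).trans hle
        · exact hF e he
    · exact absurd (Nat.pos_of_ne_zero hflag) (by simpa [Test.holds, IExp.eval] using hb)

theorem runs_initTours (R : Roadmap n) (hN : n ≤ N) :
    Runs N initTours (input R m) (RoundInv R m 0) := by
  have h0 : (input R m).idx 0 0 0 = n := by simp [input]
  have hloop : Runs N (forUpTo 20 (reg 0)
      (block [setEntry 5 (reg 20) (reg 20), setEntry 6 (reg 20) (reg 20),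
        setEntry 7 (reg 20) (reg 20)])) (input R m) fun s' => s'.idx 0 0 0 = n ∧
        ∀ v < n, s'.idx 5 0 v = v ∧ s'.idx 6 0 v = v ∧ s'.idx 7 0 v = v := by
    refine Runs.forUpTo (fun i s' => s'.idx 0 0 0 = n ∧
        ∀ v < i, s'.idx 5 0 v = v ∧ s'.idx 6 0 v = v ∧ s'.idx 7 0 v = v) (K := n) hN (by decide)
      ⟨h0, by simp⟩ ?_ (fun i s h => h.1) ?_ fun _ => id
    · rintro i s x h
      simpa [Store.idx_seti_of_ne] using h
    · rintro i s hi hsi ⟨h1, h2⟩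
      refine Runs.block_cons (Runs.setEntry (Runs.block_cons (Runs.setEntry (Runs.block_cons
        (Runs.setEntry (Runs.block_nil ?_))))))
      simp only [reg_eval, ne_eq, Nat.reduceEqDiff, not_false_eq_true, Store.idx_seti_of_ne, hsi,
        Store.idx_seti_row, Function.update_apply]
      refine ⟨by simpa [Store.idx_seti_of_ne] using h1, fun v hv => ?_⟩
      by_cases hvi : v = i
      · simp [hvi]
      · simpa [hvi] using h2 v (by omega)
  refine Runs.block_cons (hloop.frame.mono ?_)
  rintro s₁ ⟨⟨k1, k2⟩, hi, hd⟩
  refine Runs.block_cons (Runs.setReg (Runs.block_nil ⟨[], s₁.idx 5 0, s₁.idx 6 0, s₁.idx 7 0, n,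
    ⟨?_, ?_, ?_, ?_, ?_, ?_, ?_, ?_⟩, .singletons R (fun v hv => (k2 v hv).1) (fun v hv => (k2 v hv).2.1)
    fun v hv => (k2 v hv).2.2, ?_, fun p hp => Or.inr ⟨rfl, by simp⟩⟩))
  · rw [Store.idx_seti_of_ne _ (by decide), k1]
  · rw [Store.idx_seti_of_ne _ (by decide), hi 1 (by decide)]; simp [input]
  · rw [Store.idx_seti_of_ne _ (by decide), hi 2 (by decide)]
  · rw [Store.dat_seti, hd 0 (by decide)]
    funext i j
    simp only [input, lenN]
    split_ifs with h1 h2 h3 h3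
    exacts [rfl, absurd h2.2 h3, absurd ⟨rfl, h3⟩ h2, rfl, rfl]
  · rw [Store.idx_seti_of_ne _ (by decide)]
  · rw [Store.idx_seti_of_ne _ (by decide)]
  · rw [Store.idx_seti_of_ne _ (by decide)]
  · simp [k1]
  · intro h
    refine absurd ?_ h
    rw [Store.idx_seti_of_ne _ (by decide), hi 19 (by decide)]
    simp [input]

theorem RoundInv.setCounter {t : ℕ} (h : RoundInv R m t s) (x : ℕ) :
    RoundInv R m t (s.seti 9 0 0 x) := by
  obtain ⟨F, comp, nxt, vert, f, h1, h2, h3, h4⟩ := h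
  have h5 : SearchInv R m comp nxt vert f s s := ⟨h1, h3, fun _ => id⟩
  have h6 := h5.seti (a := 9) (by decide) 0 0 x
  exact ⟨F, comp, nxt, vert, f, h6.holds, h2, h6.out, fun p hp => (h4 p hp).imp_left (h6.best _)⟩

theorem runs_pathCoverProg (hn : 0 < n) (hmn : m < n) :
    Runs (3 * n) pathCoverProg (input R m) (RoundInv R m n) := by
  refine Runs.block_cons ((runs_initTours R (by omega)).mono fun s₁ h => Runs.block_cons
    (Runs.forUpTo (RoundInv R m) (K := n) (by omega) (by decide) h
      (fun i s x h => h.setCounter x) ?_ (fun i s _ _ h => runs_round hn hmn h)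
      fun s h => Runs.block_nil h))
  rintro i s ⟨F, comp, nxt, vert, f, h1, -⟩
  exact h1.n_eq

end Main

end Patrol

/-! ### The theorem -/

theorem lemma9 :
    ∃ (P : Patrol.Prog) (q : Polynomial ℕ),
      ∀ (n m : ℕ) (R : Patrol.Roadmap n), 0 < m → m < n →
        ∃ (s : Patrol.Store) (c : ℕ) (p : Fin m → List (Fin n)),
          -- the program halts within polynomial time and outputs `p`
          Patrol.Exec P (Patrol.input R m) s c ∧ c ≤ q.eval n ∧ Patrol.Outputs s p ∧
          -- `p` is a 4-approximate min-max path cover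
          Patrol.IsPathCover R p ∧
          (∀ p' : Fin m → List (Fin n), Patrol.IsPathCover R p' →
            Patrol.coverCost R p ≤ 4 * Patrol.coverCost R p') ∧
          -- sweeping `p` is an 8-approximate solution, whatever the time horizon
          ∀ T : ℝ, 0 < T →
            Patrol.IsTeamTrajectory R T (Patrol.sweep R p) ∧
            ∀ Y : Fin m → ℝ → Fin n → ℝ, Patrol.IsTeamTrajectory R T Y →
              Patrol.refreshTime T (Patrol.sweep R p) ≤ 8 * Patrol.refreshTime T Y := by
  -- Substituting `3 * X` reflects that loops run at most `3 * n` times.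
  refine ⟨Patrol.pathCoverProg, Patrol.pathCoverProg.costPoly.comp (3 * Polynomial.X),
    fun n m R hm hmn => ?_⟩
  have hn : 0 < n := hm.trans hmn
  obtain ⟨s, c, hexec, hcost, F, comp, nxt, vert, f, -, hT, hout, hbest⟩ :=
    Patrol.runs_pathCoverProg (R := R) hn hmn
  -- A forest on `n` vertices has fewer than `n` edges, so after `n` rounds only the good
  -- alternative of `RoundInv` is left.
  have hbest' : ∀ p : Fin m → List (Fin n), Patrol.IsPathCover R p →
      Patrol.BestLE s (4 * Patrol.coverCost R p) := fun p hp =>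
    (hbest p hp).resolve_right fun h => absurd h.1 (hT.kruskal.length_lt hn).ne
  obtain ⟨p₀, hp₀⟩ := Patrol.exists_isPathCover R hm hn
  obtain ⟨p, hp1, hp2, hp3⟩ := hout (hbest' p₀ hp₀).1
  have h4 : ∀ p' : Fin m → List (Fin n), Patrol.IsPathCover R p' →
      Patrol.coverCost R p ≤ 4 * Patrol.coverCost R p' := fun p' hp' =>
    Patrol.coverCost_le R hm fun i => (hp3 i).trans (hbest' p' hp').2
  refine ⟨s, c, p, hexec, ?_, hp1, hp2, h4, fun T hT => ⟨Patrol.isTrajectory_sweep hp2.1 T,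
    fun Y hY => Patrol.refreshTime_sweep_le_mul hm hn hp2 h4 hT hY⟩⟩
  simpa [Polynomial.eval_comp] using hcost
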